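/- **Setting.** Let $n\ge 1$. For $t>0$, $x\in\mathbb{R}^n$ let $$\mathcal{T}_{ij}(t,x)=\frac{1}{(2\pi)^n}\int_{\mathbb{R}^n}e^{\mathrm{i}x\cdot\xi-t|\xi|^2}\Big(\delta_{ij}-\frac{\xi_i\xi_j}{|\xi|^2}\Big)\,\mathrm{d}\xi$$ be the Oseen kernel, and for measurable $u,v:(0,T)\times\mathbb{R}^n\to\mathbb{R}^n$ and $0<t<T$ let $$B_i[u,v](t,x)=\int_0^t\int_{\mathbb{R}^n}\sum_{j,k}\partial_{x_k}\mathcal{T}_{ij}(t-s,x-y)\,u_j(s,y)\,v_k(s,y)\,\mathrm{d}y\,\mathrm{d}s ,\qquad 1\le i\le n,$$ which is said to be defined at $(t,x)$ if each term of the integrand is absolutely integrable on $(0,t)\times\mathbb{R}^n$, for all $i,j,k$. For measurable $f$ on $\mathbb{R}^n$ (or on $\mathbb{R}$) put $\lambda_f(y)=|\{|f|>y\}|$, $f^*(t)=\sup\{y\in(0,\infty):\lambda_f(y)>t\}$, and $$\|f\|^*_{L^{p,q}}=\Big(\frac qp\int_0^\infty\big[t^{1/p}f^*(t)\big]^q\frac{\mathrm{d}t}{t}\Big)^{1/q}\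 (1\le p,q<\infty),\qquad \|f\|^*_{L^{p,\infty}}=\sup_{t>0}t^{1/p}f^*(t)\ (1\le p\le\infty).$$ Write $\|f\|^*_{L^{\overline\infty,\infty}}=\sup_x|f(x)|$ (the actual supremum), and let $\overline r=r$ if $r<\infty$, and $\overline r=\overline\infty$ if $r=\infty$; $n/\infty=0$. For $T\in(0,\infty)$, the spaces $\mathcal{L}^{\alpha,\beta}_{p,\infty}(T)$, $\mathcal{K}^\sigma_{p,\infty}(T)$, $\mathcal{J}^\sigma_{p,\infty}(T)$ consist of the measurable $u$ on $(0,T)\times\mathbb{R}^n$ for which, respectively, the following quantity is finite: $$\|u\|^*_{\mathcal{L}^{\alpha,\beta}_{p,\infty}(T)}=\Big\|t\mapsto\mathbf 1_{(0,T)}(t)\|u(t)\|^*_{L^{p,\infty}(\mathbb{R}^n)}\Big\|^*_{L^{\alpha,\beta}(\mathbb{R})},$$ $$\|u\|^*_{\mathcal{K}^{\sigma}_{p,\infty}(T)}=\operatorname*{ess\,sup}_{t\in(0,T)}t^{-\sigma/2}\|u(t)\|^*_{L^{p,\infty}(\mathbb{R}^n)},\qquad \|u\|^*_{\mathcal{J}^{\sigma}_{p,\infty}(T)}=\sup_{t\in(0,T)}t^{-\sigma/2}\|u(t)\|^*_{L^{p,\infty}(\mathbb{R}^n)}.$$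 **Lemma.** (i) Assume that $r\in(n,\infty]$, $\alpha\in(2,\infty)$, $\beta\in[1,\infty]$ and $\frac2\alpha+\frac nr\le1$. There is a finite constant $C=C(n,r,\alpha,\beta)$ such that for every $T\in(0,\infty)$ and all $u,v\in\mathcal{L}^{\alpha,\beta}_{r,\infty}(T)$: $B[u,v](t,x)$ is defined for almost every $(t,x)\in(0,T)\times\mathbb{R}^n$; if $r=\infty$, then for almost every $t\in(0,T)$ it is defined for all $x\in\mathbb{R}^n$; and $B[u,v]\in\mathcal{L}^{\alpha,\beta}_{\overline r,\infty}(T)$ with $$\|B[u,v]\|^*_{\mathcal{L}^{\alpha,\beta}_{\overline r,\infty}(T)}\le C\,T^{\frac12\left(1-\frac2\alpha-\frac nr\right)}\|u\|^*_{\mathcal{L}^{\alpha,\beta}_{r,\infty}(T)}\|v\|^*_{\mathcal{L}^{\alpha,\beta}_{r,\infty}(T)}.$$ (ii) Assume that $r\in(n,\infty]$, $\sigma\in(-1,\infty)$ and $-\sigma+\frac nr\le1$. There is a finite constant $C=C(n,r,\sigma)$ such that for every $T\in(0,\infty)$ and all $u,v\in\mathcal{K}^{\sigma}_{r,\infty}(T)$: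 for all $t\in(0,T)$, $B[u,v](t,x)$ is defined for almost every $x\in\mathbb{R}^n$; if $r=\infty$, it is defined for all $(t,x)\in(0,T)\times\mathbb{R}^n$; and $B[u,v]\in\mathcal{J}^{\sigma}_{\overline r,\infty}(T)$ with $$\|B[u,v]\|^*_{\mathcal{J}^{\sigma}_{\overline r,\infty}(T)}\le C\,T^{\frac12\left(1+\sigma-\frac nr\right)}\|u\|^*_{\mathcal{K}^{\sigma}_{r,\infty}(T)}\|v\|^*_{\mathcal{K}^{\sigma}_{r,\infty}(T)}.$$ -/

import Mathlib

open MeasureTheory Set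
open scoped ENNReal NNReal

noncomputable section

namespace NSLorentz

/-- The Euclidean space `ℝⁿ`. -/
abbrev E (n : ℕ) : Type := EuclideanSpace ℝ (Fin n)

/-! ### Lorentz quasinorms -/

section Lorentz

variable {X : Type*} [MeasureSpace X]

/-- The distribution function `λ_g(y) = |{x : g x > y}|`. Functions are entered through their
absolute value, as functions with values in `[0, ∞]`. -/
def distribution (g : X → ℝ≥0∞) (y : ℝ≥0∞) : ℝ≥0∞ := volume {x | y < g x}

/-- The decreasing rearrangement `g*(t) = sup {y ∈ (0, ∞) : λ_g(y) > t}`. -/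
def rearrangement (g : X → ℝ≥0∞) (t : ℝ) : ℝ≥0∞ :=
  sSup {y : ℝ≥0∞ | 0 < y ∧ y < ∞ ∧ ENNReal.ofReal t < distribution g y}

/-- The Lorentz quasinorm `‖g‖*_{L^{p,q}}`. It is meant for `p, q ∈ [1, ∞)`, and for
`p ∈ [1, ∞]`, `q = ∞` (with `1 / ∞ = 0`). -/
def lorentzQNorm (p q : ℝ≥0∞) (g : X → ℝ≥0∞) : ℝ≥0∞ :=
  if q = ∞ then
    ⨆ t ∈ Ioi (0 : ℝ), ENNReal.ofReal t ^ (p⁻¹).toReal * rearrangement g t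
  else
    (q / p * ∫⁻ t in Ioi (0 : ℝ),
      (ENNReal.ofReal t ^ (p⁻¹).toReal * rearrangement g t) ^ q.toReal / ENNReal.ofReal t)
        ^ (q⁻¹).toReal

end Lorentz

/-- The exponents `[1, ∞] ∪ {∞̄}` for the space variable: `std p` is the ordinary exponent `p`
(an essential supremum if `p = ∞`), and `supBar` is `∞̄` (an actual supremum). -/
inductive SpaceExponent : Type
  | std (p : ℝ≥0∞)
  | supBar

/-- `r̄`, which is `r` for `r < ∞` and `∞̄` for `r = ∞`. -/
def overline (r : ℝ≥0∞) : SpaceExponent :=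
  if r = ∞ then .supBar else .std r

/-- `‖f‖*_{L^{p,q}(ℝⁿ)}` for a vector field `f`, with `‖f‖*_{L^{∞̄,∞}} = sup_x |f x|`. -/
def spaceQNorm {n : ℕ} (p : SpaceExponent) (q : ℝ≥0∞) (f : E n → E n) : ℝ≥0∞ :=
  match p with
  | .std p => lorentzQNorm p q (fun x => ‖f x‖ₑ)
  | .supBar => ⨆ x, ‖f x‖ₑ

/-! ### Path spaces on `(0, T) × ℝⁿ`; only the values of `u t` for `t ∈ (0, T)` matter -/

/-- `u` is (Borel) measurable on `(0, T) × ℝⁿ`. -/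
def MeasurableOnStrip {n : ℕ} (T : ℝ) (u : ℝ → E n → E n) : Prop :=
  Measurable (fun z : Ioo (0 : ℝ) T × E n => u z.1 z.2)

/-- The quasinorm of `L^{α,β}_t L^{p,q}_x` on `(0, T) × ℝⁿ`. -/
def normL {n : ℕ} (p : SpaceExponent) (q α β : ℝ≥0∞) (T : ℝ) (u : ℝ → E n → E n) : ℝ≥0∞ :=
  lorentzQNorm α β ((Ioo (0 : ℝ) T).indicator fun t => spaceQNorm p q (u t))

/-- `esssup_{t ∈ (0, T)} t^{-σ/2} ‖u t‖*_{L^{p,q}}`. -/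
def normK {n : ℕ} (p : SpaceExponent) (q : ℝ≥0∞) (σ T : ℝ) (u : ℝ → E n → E n) : ℝ≥0∞ :=
  essSup (fun t : ℝ => ENNReal.ofReal (t ^ (-σ / 2)) * spaceQNorm p q (u t))
    (volume.restrict (Ioo (0 : ℝ) T))

/-- `sup_{t ∈ (0, T)} t^{-σ/2} ‖u t‖*_{L^{p,q}}`. -/
def normJ {n : ℕ} (p : SpaceExponent) (q : ℝ≥0∞) (σ T : ℝ) (u : ℝ → E n → E n) : ℝ≥0∞ :=
  ⨆ t ∈ Ioo (0 : ℝ) T, ENNReal.ofReal (t ^ (-σ / 2)) * spaceQNorm p q (u t)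

def MemL {n : ℕ} (p : SpaceExponent) (q α β : ℝ≥0∞) (T : ℝ) (u : ℝ → E n → E n) : Prop :=
  MeasurableOnStrip T u ∧ normL p q α β T u < ∞

def MemK {n : ℕ} (p : SpaceExponent) (q : ℝ≥0∞) (σ T : ℝ) (u : ℝ → E n → E n) : Prop :=
  MeasurableOnStrip T u ∧ normK p q σ T u < ∞

def MemJ {n : ℕ} (p : SpaceExponent) (q : ℝ≥0∞) (σ T : ℝ) (u : ℝ → E n → E n) : Prop :=
  MeasurableOnStrip T u ∧ normJ p q σ T u < ∞

/-! ### The Oseen kernel and the bilinear operator -/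

/-- The Oseen kernel
`(2π)⁻ⁿ ∫ exp(i x·ξ - t|ξ|²) (δ_ij - ξ_i ξ_j / |ξ|²) dξ`, as a complex number. -/
def oseenC {n : ℕ} (i j : Fin n) (t : ℝ) (x : E n) : ℂ :=
  ((2 * Real.pi) ^ n : ℝ)⁻¹ *
    ∫ ξ : E n, Complex.exp (Complex.I * (inner ℝ x ξ : ℝ) - ((t * ‖ξ‖ ^ 2 : ℝ) : ℂ)) *
      (((if i = j then 1 else 0) - ξ i * ξ j / ‖ξ‖ ^ 2 : ℝ) : ℂ)

/-- The Oseen kernel `T_ij(t, x)` as a real number; nothing is lost, see `ofReal_oseen`. -/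
def oseen {n : ℕ} (i j : Fin n) (t : ℝ) (x : E n) : ℝ := (oseenC i j t x).re

/-- The Oseen kernel is real-valued. -/
theorem ofReal_oseen {n : ℕ} (i j : Fin n) (t : ℝ) (x : E n) :
    (oseen i j t x : ℂ) = oseenC i j t x := by
  apply Complex.conj_eq_iff_re.mp
  unfold oseenC
  rw [map_mul, Complex.conj_ofReal, ← integral_conj, ← integral_neg_eq_self]
  congr 2
  funext ξ
  simp [← Complex.exp_conj]

/-- The partial derivative `∇_k T_ij(t, x)` in the `k`-th space direction. -/
def gradOseen {n : ℕ} (k i j : Fin n) (t : ℝ) (x : E n) : ℝ :=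
  lineDeriv ℝ (fun y => oseen i j t y) x (EuclideanSpace.single k 1)

/-- `A[w](t, x)` is defined: the terms `∇_k T_ij(t-s, x-y) w_jk(s, y)` are absolutely integrable
over `(s, y) ∈ (0, t) × ℝⁿ`, so that the iterated integral exists, and the sums over `j, k` may
be taken inside or outside of it. -/
def ADefined {n : ℕ} (w : ℝ → E n → Matrix (Fin n) (Fin n) ℝ) (t : ℝ) (x : E n) : Prop :=
  ∀ i j k : Fin n,
    IntegrableOn (fun z : ℝ × E n => gradOseen k i j (t - z.1) (x - z.2) * w z.1 z.2 j k)
      (Ioo (0 : ℝ) t ×ˢ univ)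

/-- `A_i[w](t, x) = ∫₀ᵗ ∫ ∇_k T_ij(t-s, x-y) w_jk(s, y) dy ds`, summed over `j, k`. -/
def A {n : ℕ} (w : ℝ → E n → Matrix (Fin n) (Fin n) ℝ) (t : ℝ) (x : E n) : E n :=
  WithLp.toLp 2 fun i =>
    ∫ s in Ioo (0 : ℝ) t, ∫ y : E n,
      ∑ j, ∑ k, gradOseen k i j (t - s) (x - y) * w s y j k

/-- `(u ⊗ v)_jk = u_j v_k`. -/
def tensor {n : ℕ} (u v : ℝ → E n → E n) : ℝ → E n → Matrix (Fin n) (Fin n) ℝ :=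
  fun s y => Matrix.of fun j k => u s y j * v s y k

/-- `B[u, v](t, x)` is defined. -/
def BDefined {n : ℕ} (u v : ℝ → E n → E n) (t : ℝ) (x : E n) : Prop :=
  ADefined (tensor u v) t x

/-- `B[u, v] = A[u ⊗ v]`. -/
def B {n : ℕ} (u v : ℝ → E n → E n) : ℝ → E n → E n := A (tensor u v)

end NSLorentz

end

noncomputable section

namespace NSLorentz


/-! ### Layer cake formulas and the Hardy–Littlewood inequality for three functions. -/

section Rearrangement

variable {X : Type*} [MeasureSpace X]

/-! The estimate separates into one in space, at fixed times, and a one-dimensional one in time. The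
gradient of the Oseen kernel at time τ has L¹ norm at most Cτ^(-1/2) and supremum at most
Cτ^(-(n+1)/2) (`OseenBound`). For r > 2 these two bounds alone give convolution from L^{r/2,∞} to
L^{r,∞} with norm Cτ^(-θ), θ = 1/2 + n/(2r). Hence ‖B[u,v](t)‖ is at most a constant times ∫₀ᵗ
(t-s)^(-θ) ‖u(s)‖ ‖v(s)‖ ds (`exists_spaceQNorm_B_le`). If n ≥ 2, then r > n forces r > 2; if n = 1,
the Leray symbol vanishes off the origin and B = 0.

Two tools serve both space and time. One is ∫ f g h ≤ ∫ f* g* h*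
(`lintegral_mul_mul_le_rearrangement`). The other is the control of g* by the integrals of g over
sets of finite measure (`rearrangement_le_of_sets`). Such integrals are linear in g, so they commute
with the time integral and no triangle inequality for the quasinorm is needed.

In part (i) the hypothesis says θ ≤ 1 - 1/α, so on (0,T) the kernel is at most a power of T times
the kernel of fractional integration of order c = 1/α. O'Neil's method bounds t^c times the
rearrangement of the fractional integral of pq by an average of dilates of t^c p*(t), with the
weight min(s^(-2c), s^(-1-c)). The weight is integrable because 2 < α < ∞, and dt/t is dilation
invariant, so Jensen's inequality closes the estimate in L^{α,β}. Only one factor needs the second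
index β. In part (ii) the bounds s^(σ/2) for u and v reduce the time integral to a beta integral,
convergent because θ < 1 and σ > -1.

The L¹ bound for the kernel needs no pointwise decay. The symbol iξ_k(δ_ij - ξ_iξ_j/|ξ|²) is
iξ_kδ_ij plus (iξ_k)(iξ_j)(iξ_i)/|ξ|², and division by |ξ|² is integration of the heat factor over
times s > t. Third derivatives of the heat kernel have L¹ norm a constant times s^(-3/2), which
integrates to a multiple of t^(-1/2). -/

theorem volume_Ioi_inter_ofReal_lt (c : ℝ≥0∞) :
    volume {a : ℝ | 0 < a ∧ ENNReal.ofReal a < c} = c := by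
  by_cases hc : c = ∞
  · subst hc
    have : {a : ℝ | 0 < a ∧ ENNReal.ofReal a < ∞} = Ioi 0 := by ext a; simp
    rw [this, Real.volume_Ioi]
  · have : {a : ℝ | 0 < a ∧ ENNReal.ofReal a < c} = Ioo 0 c.toReal := by
      ext a
      simp only [mem_ofPred_eq, mem_Ioo]
      refine and_congr_right fun ha => ?_
      rw [ENNReal.ofReal_lt_iff_lt_toReal ha.le hc]
    rw [this, Real.volume_Ioo, sub_zero, ENNReal.ofReal_toReal hc]

theorem volume_Ioi_inter_ofReal_le (c : ℝ≥0∞) :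
    volume {a : ℝ | 0 < a ∧ ENNReal.ofReal a ≤ c} = c := by
  by_cases hc : c = ∞
  · subst hc
    have : {a : ℝ | 0 < a ∧ ENNReal.ofReal a ≤ ∞} = Ioi 0 := by ext a; simp
    rw [this, Real.volume_Ioi]
  · have : {a : ℝ | 0 < a ∧ ENNReal.ofReal a ≤ c} = Ioc 0 c.toReal := by
      ext a
      simp only [mem_ofPred_eq, mem_Ioc]
      refine and_congr_right fun ha => ?_
      rw [ENNReal.ofReal_le_iff_le_toReal hc]
    rw [this, Real.volume_Ioc, sub_zero, ENNReal.ofReal_toReal hc]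

theorem measurableSet_ofReal_lt (c : ℝ≥0∞) : MeasurableSet {a : ℝ | ENNReal.ofReal a < c} :=
  measurableSet_lt ENNReal.measurable_ofReal measurable_const

/-- The layer cake identity for a single value, infinity included. -/
theorem lintegral_indicator_ofReal_lt (c : ℝ≥0∞) :
    ∫⁻ a in Ioi (0 : ℝ), {a : ℝ | ENNReal.ofReal a < c}.indicator 1 a = c := by
  rw [lintegral_indicator_one (measurableSet_ofReal_lt c),
    Measure.restrict_apply (measurableSet_ofReal_lt c)]
  conv_rhs => rw [← volume_Ioi_inter_ofReal_lt c]
  congr 1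
  ext a
  simp [and_comm]

theorem distribution_antitone (g : X → ℝ≥0∞) : Antitone (distribution g) :=
  fun _ _ h => measure_mono fun _ hx => lt_of_le_of_lt h hx

theorem rearrangement_antitone (g : X → ℝ≥0∞) : Antitone (rearrangement g) :=
  fun _ _ h => sSup_le_sSup fun _ hy =>
    ⟨hy.1, hy.2.1, (ENNReal.ofReal_le_ofReal h).trans_lt hy.2.2⟩

theorem measurable_rearrangement (g : X → ℝ≥0∞) : Measurable (rearrangement g) :=
  (rearrangement_antitone g).measurable

theorem rearrangement_le {g : X → ℝ≥0∞} {t : ℝ} {M : ℝ≥0∞}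
    (h : ∀ y, 0 < y → y < ∞ → ENNReal.ofReal t < distribution g y → y ≤ M) :
    rearrangement g t ≤ M :=
  sSup_le fun y hy => h y hy.1 hy.2.1 hy.2.2

theorem rearrangement_mono_ae {f g : X → ℝ≥0∞} (h : f ≤ᵐ[volume] g) (t : ℝ) :
    rearrangement f t ≤ rearrangement g t :=
  rearrangement_le fun _ hy0 hy hyt => le_sSup ⟨hy0, hy, hyt.trans_le (measure_mono_ae (by
    filter_upwards [h] with x hx hxy using lt_of_lt_of_le hxy hx))⟩

theorem rearrangement_le_of_forall_le {g : X → ℝ≥0∞} {M : ℝ≥0∞} (h : ∀ x, g x ≤ M) (t : ℝ) :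
    rearrangement g t ≤ M := by
  refine rearrangement_le fun y _ _ hyt => ?_
  by_contra hy
  have : {x | y < g x} = ∅ := by
    ext x
    simp only [mem_ofPred_eq, mem_empty_iff_false, iff_false, not_lt]
    exact (h x).trans (not_le.1 hy).le
  simp [distribution, this] at hyt

/-- The levels a > 0 with λ_g(a) > s form an interval with endpoints 0 and g*(s). Whether the right
endpoint belongs to it does not affect its length. -/
theorem lintegral_indicator_distribution (g : X → ℝ≥0∞) (s : ℝ) :
    ∫⁻ a in Ioi (0 : ℝ), {a : ℝ | ENNReal.ofReal s < distribution g (ENNReal.ofReal a)}.indicator 1 a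
      = rearrangement g s := by
  have hm : MeasurableSet {a : ℝ | ENNReal.ofReal s < distribution g (ENNReal.ofReal a)} :=
    measurableSet_lt measurable_const
      ((distribution_antitone g).measurable.comp ENNReal.measurable_ofReal)
  rw [lintegral_indicator_one hm, Measure.restrict_apply hm]
  apply le_antisymm
  · conv_rhs => rw [← volume_Ioi_inter_ofReal_le (rearrangement g s)]
    refine measure_mono fun a ha => ⟨ha.2, le_sSup ⟨ENNReal.ofReal_pos.2 ha.2, by simp, ha.1⟩⟩
  · conv_lhs => rw [← volume_Ioi_inter_ofReal_lt (rearrangement g s)]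
    refine measure_mono fun a ha => ⟨?_, ha.1⟩
    obtain ⟨y, hy, hay⟩ := lt_sSup_iff.1 ha.2
    exact hy.2.2.trans_le (distribution_antitone g hay.le)

/-- The inductive step of the Hardy-Littlewood inequality for products. -/
theorem setLIntegral_mul_le_of_forall [SFinite (volume : Measure X)]
    {f w : X → ℝ≥0∞} {W : ℝ → ℝ≥0∞} (hf : Measurable f) (hw : Measurable w) (hW : Measurable W)
    (h : ∀ E : Set X, MeasurableSet E → ∫⁻ x in E, w x ≤
      ∫⁻ s in Ioi (0 : ℝ), {s : ℝ | ENNReal.ofReal s < volume E}.indicator 1 s * W s)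
    (E : Set X) (hE : MeasurableSet E) :
    ∫⁻ x in E, f x * w x ≤
      ∫⁻ s in Ioi (0 : ℝ), {s : ℝ | ENNReal.ofReal s < volume E}.indicator 1 s *
        (rearrangement f s * W s) := by
  have hD : Measurable fun a : ℝ => distribution f (ENNReal.ofReal a) :=
    (distribution_antitone f).measurable.comp ENNReal.measurable_ofReal
  calc ∫⁻ x in E, f x * w x
      = ∫⁻ x in E, ∫⁻ a in Ioi (0 : ℝ), {a : ℝ | ENNReal.ofReal a < f x}.indicator 1 a * w x := by
        refine lintegral_congr fun x => ?_
        rw [lintegral_mul_const _ (measurable_one.indicator (measurableSet_ofReal_lt _)),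
          lintegral_indicator_ofReal_lt]
    _ = ∫⁻ a in Ioi (0 : ℝ), ∫⁻ x in E, {a : ℝ | ENNReal.ofReal a < f x}.indicator 1 a * w x := by
        rw [lintegral_lintegral_swap]
        refine Measurable.aemeasurable ?_
        have : MeasurableSet {p : X × ℝ | ENNReal.ofReal p.2 < f p.1} :=
          measurableSet_lt (ENNReal.measurable_ofReal.comp measurable_snd) (hf.comp measurable_fst)
        exact (measurable_one.indicator this).mul (hw.comp measurable_fst)
    _ = ∫⁻ a in Ioi (0 : ℝ), ∫⁻ x in E ∩ {x | ENNReal.ofReal a < f x}, w x := by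
        refine lintegral_congr fun a => ?_
        have hS : MeasurableSet {x | ENNReal.ofReal a < f x} := measurableSet_lt measurable_const hf
        rw [inter_comm, ← Measure.restrict_restrict hS, ← lintegral_indicator hS]
        refine lintegral_congr fun x => ?_
        by_cases hx : ENNReal.ofReal a < f x <;> simp [indicator, hx]
    _ ≤ ∫⁻ a in Ioi (0 : ℝ), ∫⁻ s in Ioi (0 : ℝ),
          {s : ℝ | ENNReal.ofReal s < volume E}.indicator 1 s *
          ({a : ℝ | ENNReal.ofReal s < distribution f (ENNReal.ofReal a)}.indicator 1 a * W s) := by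
        refine lintegral_mono fun a => ?_
        -- The hypothesis is applied to E ∩ {f > a}. Its measure is at most both |E| and λ_f(a), so
        -- its indicator in s is at most the product of the two indicators; integrating over a then
        -- turns the second one into f*(s).
        refine (h _ (hE.inter (measurableSet_lt measurable_const hf))).trans ?_
        refine lintegral_mono fun s => ?_
        rw [← mul_assoc]
        refine mul_le_mul' ?_ le_rfl
        by_cases hs : ENNReal.ofReal s < volume (E ∩ {x | ENNReal.ofReal a < f x})
        · have h1 : ENNReal.ofReal s < volume E := hs.trans_le (measure_mono inter_subset_left)
          have h2 : ENNReal.ofReal s < distribution f (ENNReal.ofReal a) :=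
            hs.trans_le (measure_mono inter_subset_right)
          simp only [indicator, mem_ofPred_eq, h1, h2, if_true]
          split_ifs <;> simp
        · simp [indicator, hs]
    _ = ∫⁻ s in Ioi (0 : ℝ), ∫⁻ a in Ioi (0 : ℝ),
          {s : ℝ | ENNReal.ofReal s < volume E}.indicator 1 s *
          ({a : ℝ | ENNReal.ofReal s < distribution f (ENNReal.ofReal a)}.indicator 1 a * W s) := by
        rw [lintegral_lintegral_swap]
        refine Measurable.aemeasurable ?_
        have : MeasurableSet {p : ℝ × ℝ | ENNReal.ofReal p.2 <
            distribution f (ENNReal.ofReal p.1)} :=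
          measurableSet_lt (ENNReal.measurable_ofReal.comp measurable_snd) (hD.comp measurable_fst)
        exact ((measurable_one.indicator (measurableSet_ofReal_lt _)).comp measurable_snd).mul
          ((measurable_one.indicator this).mul (hW.comp measurable_snd))
    _ = _ := by
        refine lintegral_congr fun s => ?_
        have hm : MeasurableSet {a : ℝ | ENNReal.ofReal s < distribution f (ENNReal.ofReal a)} :=
          measurableSet_lt measurable_const hD
        rw [lintegral_const_mul _ ((measurable_one.indicator hm).mul_const _),
          lintegral_mul_const _ (measurable_one.indicator hm), lintegral_indicator_distribution]

/-- The Hardy-Littlewood rearrangement inequality for three functions. -/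
theorem lintegral_mul_mul_le_rearrangement [SFinite (volume : Measure X)]
    {f g h : X → ℝ≥0∞} (hf : Measurable f) (hg : Measurable g) (hh : Measurable h) :
    ∫⁻ x, f x * (g x * h x) ≤
      ∫⁻ s in Ioi (0 : ℝ), rearrangement f s * (rearrangement g s * rearrangement h s) := by
  have base : ∀ E : Set X, MeasurableSet E → ∫⁻ x in E, (1 : X → ℝ≥0∞) x ≤
      ∫⁻ s in Ioi (0 : ℝ), {s : ℝ | ENNReal.ofReal s < volume E}.indicator 1 s *
        (1 : ℝ → ℝ≥0∞) s := by
    intro E _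
    simp only [Pi.one_apply, mul_one]
    rw [lintegral_indicator_ofReal_lt]
    simp
  -- Each application absorbs one more factor, starting from the constant function 1.
  have h1 := setLIntegral_mul_le_of_forall hh measurable_one measurable_one base
  have h2 := setLIntegral_mul_le_of_forall hg (hh.mul measurable_one)
    ((measurable_rearrangement h).mul measurable_one) h1
  have h3 := setLIntegral_mul_le_of_forall hf (hg.mul (hh.mul measurable_one))
    ((measurable_rearrangement g).mul ((measurable_rearrangement h).mul measurable_one)) h2
    univ MeasurableSet.univ
  simp only [Measure.restrict_univ, mul_one, Pi.mul_apply] at h3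
  refine h3.trans (lintegral_mono fun s => ?_)
  refine mul_le_of_le_one_left (zero_le) ?_
  exact indicator_le (fun _ _ => le_rfl) s |>.trans (by simp)

end Rearrangement


section Scaling

/-! ### Dilations and power integrals in `ℝ≥0∞`. -/

theorem lintegral_comp_smul_of_pos {F : Type*} [NormedAddCommGroup F] [NormedSpace ℝ F]
    [MeasurableSpace F] [BorelSpace F] [FiniteDimensional ℝ F] (μ : Measure F)
    [μ.IsAddHaarMeasure] (f : F → ℝ≥0∞) {R : ℝ} (hR : 0 < R) :
    ∫⁻ x, f (R • x) ∂μ = ENNReal.ofReal R ^ (-(Module.finrank ℝ F : ℝ)) * ∫⁻ x, f x ∂μ := by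
  have h := lintegral_map_equiv (μ := μ) f (MeasurableEquiv.smul₀ R hR.ne')
  have h2 := Measure.map_addHaar_smul μ hR.ne'
  change ∫⁻ x, f x ∂(Measure.map (fun x => R • x) μ) = ∫⁻ x, f (R • x) ∂μ at h
  rw [← h, h2, lintegral_smul_measure, smul_eq_mul, abs_of_pos (by positivity),
    ENNReal.ofReal_rpow_of_pos hR, Real.rpow_neg hR.le, Real.rpow_natCast]

theorem lintegral_Ioi_comp_mul_left (f : ℝ → ℝ≥0∞) {t : ℝ} (ht : 0 < t) :
    ∫⁻ s in Ioi (0 : ℝ), f (t * s) = (ENNReal.ofReal t)⁻¹ * ∫⁻ s in Ioi (0 : ℝ), f s := by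
  have h := lintegral_comp_smul_of_pos volume ((Ioi (0 : ℝ)).indicator f) ht
  rw [Module.finrank_self, Nat.cast_one, ENNReal.rpow_neg_one,
    lintegral_indicator measurableSet_Ioi] at h
  rw [← h, ← lintegral_indicator measurableSet_Ioi]
  refine lintegral_congr fun s => ?_
  by_cases hs : 0 < s
  · simp [indicator, hs, ht]
  · simp [indicator, hs, ht]

theorem lintegral_Ioi_eq_mul_comp_mul_left {f : ℝ → ℝ≥0∞} (hf : Measurable f) {t : ℝ}
    (ht : 0 < t) :
    ∫⁻ s in Ioi (0 : ℝ), f s = ∫⁻ s in Ioi (0 : ℝ), ENNReal.ofReal t * f (t * s) := by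
  rw [lintegral_const_mul, lintegral_Ioi_comp_mul_left f ht, ← mul_assoc,
    ENNReal.mul_inv_cancel (ENNReal.ofReal_pos.2 ht).ne' ENNReal.ofReal_ne_top, one_mul]
  exact hf.comp (measurable_const.mul measurable_id)

theorem lintegral_Ioc_rpow {a c : ℝ} (ha : -1 < a) (hc : 0 < c) :
    ∫⁻ s in Ioc 0 c, ENNReal.ofReal s ^ a = ENNReal.ofReal c ^ (a + 1) / ENNReal.ofReal (a + 1) := by
  have hi : IntegrableOn (fun x : ℝ => x ^ a) (Ioc 0 c) :=
    (intervalIntegrable_iff_integrableOn_Ioc_of_le hc.le).1 (intervalIntegral.intervalIntegrable_rpow' ha)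
  have h1 : ∫⁻ s in Ioc 0 c, ENNReal.ofReal s ^ a = ∫⁻ s in Ioc 0 c, ENNReal.ofReal (s ^ a) :=
    setLIntegral_congr_fun measurableSet_Ioc fun s hs => ENNReal.ofReal_rpow_of_pos hs.1
  rw [h1, ← ofReal_integral_eq_lintegral_ofReal hi, ← intervalIntegral.integral_of_le hc.le,
    integral_rpow (Or.inl ha), Real.zero_rpow (by linarith), sub_zero,
    ENNReal.ofReal_div_of_pos (by linarith), ENNReal.ofReal_rpow_of_pos hc]
  filter_upwards [ae_restrict_mem measurableSet_Ioc] with x hx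
  exact Real.rpow_nonneg hx.1.le a

theorem lintegral_Ioi_rpow {a c : ℝ} (ha : a < -1) (hc : 0 < c) :
    ∫⁻ s in Ioi c, ENNReal.ofReal s ^ a =
      ENNReal.ofReal c ^ (a + 1) / ENNReal.ofReal (-(a + 1)) := by
  have h1 : ∫⁻ s in Ioi c, ENNReal.ofReal s ^ a = ∫⁻ s in Ioi c, ENNReal.ofReal (s ^ a) :=
    setLIntegral_congr_fun measurableSet_Ioi fun s hs => ENNReal.ofReal_rpow_of_pos (hc.trans hs)
  rw [h1, ← ofReal_integral_eq_lintegral_ofReal (integrableOn_Ioi_rpow_of_lt ha hc),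
    integral_Ioi_rpow_of_lt ha hc, neg_div, ← div_neg,
    ENNReal.ofReal_div_of_pos (by linarith), ENNReal.ofReal_rpow_of_pos hc]
  filter_upwards [ae_restrict_mem measurableSet_Ioi] with x hx
  exact Real.rpow_nonneg (hc.trans hx).le a

theorem ofReal_ne_zero_of_pos {s : ℝ} (hs : 0 < s) : ENNReal.ofReal s ≠ 0 :=
  (ENNReal.ofReal_pos.2 hs).ne'

theorem ofReal_rpow_ne_zero {s : ℝ} (hs : 0 < s) (a : ℝ) : ENNReal.ofReal s ^ a ≠ 0 := by
  rw [ENNReal.ofReal_rpow_of_pos hs]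
  exact ofReal_ne_zero_of_pos (Real.rpow_pos_of_pos hs a)

theorem ofReal_rpow_ne_top {s : ℝ} (hs : 0 < s) (a : ℝ) : ENNReal.ofReal s ^ a ≠ ∞ := by
  rw [ENNReal.ofReal_rpow_of_pos hs]
  exact ENNReal.ofReal_ne_top

theorem ofReal_rpow_add {s : ℝ} (hs : 0 < s) (a b : ℝ) :
    ENNReal.ofReal s ^ (a + b) = ENNReal.ofReal s ^ a * ENNReal.ofReal s ^ b :=
  ENNReal.rpow_add _ _ (ofReal_ne_zero_of_pos hs) ENNReal.ofReal_ne_top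

theorem ofReal_rpow_mul_neg {s : ℝ} (hs : 0 < s) (a : ℝ) :
    ENNReal.ofReal s ^ a * ENNReal.ofReal s ^ (-a) = 1 := by
  rw [← ofReal_rpow_add hs, add_neg_cancel, ENNReal.rpow_zero]

theorem measurable_ofReal_rpow (a : ℝ) : Measurable fun s : ℝ => ENNReal.ofReal s ^ a :=
  ENNReal.measurable_ofReal.pow_const a

theorem ofReal_rpow_mul_le_iff {s : ℝ} (hs : 0 < s) (a : ℝ) {x y : ℝ≥0∞} :
    ENNReal.ofReal s ^ a * x ≤ y ↔ x ≤ y * ENNReal.ofReal s ^ (-a) := by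
  rw [ENNReal.rpow_neg, ← div_eq_mul_inv, mul_comm,
    ENNReal.le_div_iff_mul_le (Or.inl (ofReal_rpow_ne_zero hs a)) (Or.inl (ofReal_rpow_ne_top hs a))]

theorem ofReal_rpow_le_rpow_of_nonpos {s t a : ℝ} (hs : 0 < s) (hst : s ≤ t) (ha : a ≤ 0) :
    ENNReal.ofReal t ^ a ≤ ENNReal.ofReal s ^ a := by
  rw [ENNReal.ofReal_rpow_of_pos hs, ENNReal.ofReal_rpow_of_pos (hs.trans_le hst)]
  exact ENNReal.ofReal_le_ofReal (Real.rpow_le_rpow_of_nonpos hs hst ha)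

/-- Integrability of the weights in both the space and the time estimate: the first power is used
below 1, the second above. -/
theorem lintegral_min_rpow_lt_top {a b : ℝ} (ha : a < 1) (hb : 1 < b) :
    ∫⁻ s in Ioi (0 : ℝ), min (ENNReal.ofReal s ^ (-a)) (ENNReal.ofReal s ^ (-b)) < ∞ := by
  rw [← Ioc_union_Ioi_eq_Ioi (zero_le_one : (0 : ℝ) ≤ 1)]
  refine (lintegral_union_le _ _ _).trans_lt (ENNReal.add_lt_top.2 ⟨?_, ?_⟩)
  · refine (lintegral_mono fun s => min_le_left _ _).trans_lt ?_
    rw [lintegral_Ioc_rpow (by linarith) one_pos]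
    exact ENNReal.div_lt_top (ofReal_rpow_ne_top one_pos _) (ofReal_ne_zero_of_pos (by linarith))
  · refine (lintegral_mono fun s => min_le_right _ _).trans_lt ?_
    rw [lintegral_Ioi_rpow (by linarith) one_pos]
    exact ENNReal.div_lt_top (ofReal_rpow_ne_top one_pos _) (ofReal_ne_zero_of_pos (by linarith))

end Scaling

/-! ### Weak quasinorms and their control by integrals over sets. -/

section WeakNorm

variable {X : Type*} [MeasureSpace X]

theorem rearrangement_le_lorentzQNorm (p : ℝ≥0∞) (g : X → ℝ≥0∞) {t : ℝ} (ht : 0 < t) :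
    rearrangement g t ≤ lorentzQNorm p ∞ g * ENNReal.ofReal t ^ (-(p⁻¹).toReal) := by
  rw [← ofReal_rpow_mul_le_iff ht, lorentzQNorm, if_pos rfl]
  exact le_iSup₂ (f := fun t (_ : t ∈ Ioi (0 : ℝ)) =>
    ENNReal.ofReal t ^ (p⁻¹).toReal * rearrangement g t) t ht

theorem lorentzQNorm_top_le {p : ℝ≥0∞} {g : X → ℝ≥0∞} {M : ℝ≥0∞}
    (h : ∀ t : ℝ, 0 < t → rearrangement g t ≤ M * ENNReal.ofReal t ^ (-(p⁻¹).toReal)) :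
    lorentzQNorm p ∞ g ≤ M := by
  rw [lorentzQNorm, if_pos rfl]
  exact iSup₂_le fun t ht => (ofReal_rpow_mul_le_iff ht _).2 (h t ht)

theorem lorentzQNorm_mono_rearrangement {p q : ℝ≥0∞} {f g : X → ℝ≥0∞}
    (h : ∀ t : ℝ, 0 < t → rearrangement f t ≤ rearrangement g t) :
    lorentzQNorm p q f ≤ lorentzQNorm p q g := by
  unfold lorentzQNorm
  split_ifs with hq
  · exact iSup₂_mono fun t ht => by gcongr; exact h t ht
  · refine ENNReal.rpow_le_rpow ?_ ENNReal.toReal_nonneg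
    refine mul_le_mul' le_rfl ?_
    refine setLIntegral_mono' measurableSet_Ioi fun t ht => ?_
    gcongr
    exact h t ht

theorem lorentzQNorm_mono_ae {p q : ℝ≥0∞} {f g : X → ℝ≥0∞} (h : f ≤ᵐ[volume] g) :
    lorentzQNorm p q f ≤ lorentzQNorm p q g :=
  lorentzQNorm_mono_rearrangement fun t _ => rearrangement_mono_ae h t

/-- As g* decreases, g*(s) ≥ g*(t) for s ≤ t, and (q/p) ∫₀ᵗ s^(q/p-1) ds = t^(q/p). The factor q/p
in the quasinorm is what makes the constant equal to one. -/
theorem lorentzQNorm_top_le_lorentzQNorm {p q : ℝ≥0∞} (hp : p ≠ 0) (hp' : p ≠ ∞) (hq : q ≠ 0)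
    (g : X → ℝ≥0∞) : lorentzQNorm p ∞ g ≤ lorentzQNorm p q g := by
  by_cases hq' : q = ∞
  · rw [hq']
  have hp0 : 0 < p.toReal := ENNReal.toReal_pos hp hp'
  have hq0 : 0 < q.toReal := ENNReal.toReal_pos hq hq'
  refine lorentzQNorm_top_le fun t ht => ?_
  rw [← ofReal_rpow_mul_le_iff ht, lorentzQNorm, if_neg hq', ENNReal.toReal_inv q,
    ENNReal.le_rpow_inv_iff hq0]
  have hpt : (p⁻¹).toReal = p.toReal⁻¹ := ENNReal.toReal_inv p
  have hqp : q / p = ENNReal.ofReal (q.toReal / p.toReal) := by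
    rw [ENNReal.ofReal_div_of_pos hp0, ENNReal.ofReal_toReal hq', ENNReal.ofReal_toReal hp']
  have hqp0 : 0 < q.toReal / p.toReal := div_pos hq0 hp0
  calc (ENNReal.ofReal t ^ (p⁻¹).toReal * rearrangement g t) ^ q.toReal
      = q / p * (ENNReal.ofReal t ^ (q.toReal / p.toReal - 1 + 1) /
          ENNReal.ofReal (q.toReal / p.toReal - 1 + 1) * rearrangement g t ^ q.toReal) := by
        rw [ENNReal.mul_rpow_of_nonneg _ _ hq0.le, ← ENNReal.rpow_mul, hpt, sub_add_cancel, hqp,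
          ← mul_assoc, ENNReal.mul_div_cancel (ofReal_ne_zero_of_pos hqp0) ENNReal.ofReal_ne_top,
          inv_mul_eq_div]
    _ = q / p * ∫⁻ s in Ioc 0 t, ENNReal.ofReal s ^ (q.toReal / p.toReal - 1) *
          rearrangement g t ^ q.toReal := by
        rw [lintegral_mul_const _ (measurable_ofReal_rpow _), lintegral_Ioc_rpow (by linarith) ht]
    _ ≤ q / p * ∫⁻ s in Ioc 0 t,
          (ENNReal.ofReal s ^ (p⁻¹).toReal * rearrangement g s) ^ q.toReal / ENNReal.ofReal s := by
        gcongr 1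
        refine setLIntegral_mono' measurableSet_Ioc fun s hs => ?_
        rw [ENNReal.mul_rpow_of_nonneg _ _ hq0.le, ← ENNReal.rpow_mul, hpt, sub_eq_add_neg,
          ofReal_rpow_add hs.1, ENNReal.rpow_neg_one, ENNReal.div_eq_inv_mul, inv_mul_eq_div,
          mul_assoc, mul_left_comm]
        gcongr
        exact rearrangement_antitone g hs.2
    _ ≤ _ := by
        gcongr 1
        exact lintegral_mono_set Ioc_subset_Ioi_self

/-- If λ_g(y) > t, then {g > y} contains a set E of finite measure greater than t, by σ-finiteness,
and ∫_E g ≥ y|E|. Every level y that competes for g*(t) is thus tested by such a set. -/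
theorem rearrangement_le_of_sets [SigmaFinite (volume : Measure X)] {g : X → ℝ≥0∞}
    (hg : Measurable g) {t : ℝ} {M : ℝ≥0∞}
    (h : ∀ (y : ℝ≥0∞) (E : Set X), MeasurableSet E → ENNReal.ofReal t < volume E → volume E < ∞ →
      y * volume E ≤ ∫⁻ x in E, g x → y ≤ M) :
    rearrangement g t ≤ M := by
  refine rearrangement_le fun y _ _ hyt => ?_
  obtain ⟨E, hEm, hE, h1, h2⟩ := Measure.exists_subset_measure_lt_top
    (measurableSet_lt measurable_const hg) hyt
  refine h y E hEm h1 h2 ?_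
  rw [← setLIntegral_const]
  exact setLIntegral_mono hg fun x hx => (hE hx : y < g x).le

theorem rearrangement_le_div [SigmaFinite (volume : Measure X)] {g : X → ℝ≥0∞}
    (hg : Measurable g) {t : ℝ} (ht : 0 < t) :
    rearrangement g t ≤ (∫⁻ x, g x) * ENNReal.ofReal t ^ (-1 : ℝ) := by
  refine rearrangement_le_of_sets hg fun y E _ h1 h2 h3 => ?_
  rw [← ofReal_rpow_mul_le_iff ht, ENNReal.rpow_one, mul_comm]
  exact (mul_le_mul' le_rfl h1.le).trans (h3.trans (setLIntegral_le_lintegral _ _))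

/-- An average of a set function `a ↦ a ^ (1 - c)` gives a weak type bound. -/
theorem rearrangement_le_of_setLIntegral_le [SigmaFinite (volume : Measure X)] {g : X → ℝ≥0∞}
    (hg : Measurable g) {c : ℝ} (hc : 0 ≤ c) {N : ℝ≥0∞}
    (h : ∀ E : Set X, MeasurableSet E → 0 < volume E → volume E < ∞ →
      ∫⁻ x in E, g x ≤ N * volume E ^ (1 - c)) {t : ℝ} (ht : 0 < t) :
    rearrangement g t ≤ N * ENNReal.ofReal t ^ (-c) := by
  refine rearrangement_le_of_sets hg fun y E hE h1 h2 h3 => ?_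
  have h0 : 0 < volume E := (zero_le).trans_lt h1
  rw [← ofReal_rpow_mul_le_iff ht]
  have h4 := h3.trans (h E hE h0 h2)
  have h5 : volume E = volume E ^ c * volume E ^ (1 - c) := by
    rw [← ENNReal.rpow_add _ _ h0.ne' h2.ne, add_sub_cancel, ENNReal.rpow_one]
  nth_rewrite 1 [h5] at h4
  rw [← mul_assoc, ENNReal.mul_le_mul_iff_left (ENNReal.rpow_pos h0 h2.ne).ne'
    (ENNReal.rpow_ne_top_of_ne_zero h0.ne' h2.ne), mul_comm] at h4
  refine le_trans ?_ h4
  gcongr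

end WeakNorm


/-! ### Fractional integration of a product in Lorentz spaces on the line. -/

section FractionalIntegral

/-- The kernel `τ ↦ τ ^ (c - 1)` on the positive half line. -/
def fracKernel (c τ : ℝ) : ℝ≥0∞ :=
  (Ioi (0 : ℝ)).indicator (fun τ => ENNReal.ofReal τ ^ (c - 1)) τ

/-- The fractional integral of order `c` of the product `p q`. -/
def fracInt (c : ℝ) (p q : ℝ → ℝ≥0∞) (t : ℝ) : ℝ≥0∞ :=
  ∫⁻ s, fracKernel c (t - s) * (p s * q s)

theorem measurable_fracKernel (c : ℝ) : Measurable (fracKernel c) :=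
  (measurable_ofReal_rpow _).indicator measurableSet_Ioi

theorem measurable_fracInt (c : ℝ) {p q : ℝ → ℝ≥0∞} (hp : Measurable p) (hq : Measurable q) :
    Measurable (fracInt c p q) := by
  refine Measurable.lintegral_prod_right' (f := fun z : ℝ × ℝ =>
    fracKernel c (z.1 - z.2) * (p z.2 * q z.2)) ?_
  exact ((measurable_fracKernel c).comp (measurable_fst.sub measurable_snd)).mul
    ((hp.comp measurable_snd).mul (hq.comp measurable_snd))

/-- With m = |G|, the part of the kernel on (0, m] has integral m^c/c, and beyond m the decreasing
kernel is at most m^(c-1), which contributes at most m^c. -/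
theorem setLIntegral_fracKernel_le {c : ℝ} (hc : 0 < c) (hc1 : c < 1) (G : Set ℝ)
    (hG0 : 0 < volume G) (hG : volume G < ∞) :
    ∫⁻ τ in G, fracKernel c τ ≤ (ENNReal.ofReal c⁻¹ + 1) * volume G ^ c := by
  obtain ⟨m, hm, hmG⟩ : ∃ m : ℝ, 0 < m ∧ volume G = ENNReal.ofReal m :=
    ⟨(volume G).toReal, ENNReal.toReal_pos hG0.ne' hG.ne, (ENNReal.ofReal_toReal hG.ne).symm⟩
  calc ∫⁻ τ in G, fracKernel c τ
      ≤ ∫⁻ τ in G, ((Ioc 0 m).indicator (fun τ => ENNReal.ofReal τ ^ (c - 1)) τ +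
          ENNReal.ofReal m ^ (c - 1)) := by
        refine lintegral_mono fun τ => ?_
        unfold fracKernel
        by_cases h0 : 0 < τ
        · by_cases h1 : τ ≤ m
          · simp [indicator, h0, h1]
          · simp only [indicator, mem_Ioi, h0, mem_Ioc, h1, and_false, if_false, if_true, zero_add]
            exact ofReal_rpow_le_rpow_of_nonpos hm (not_le.1 h1).le (by linarith)
        · simp [indicator, h0]
    _ ≤ ENNReal.ofReal m ^ c / ENNReal.ofReal c + ENNReal.ofReal m ^ c := by
        rw [lintegral_add_right _ measurable_const, setLIntegral_const, hmG]
        refine add_le_add ?_ ?_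
        · refine (setLIntegral_le_lintegral _ _).trans ?_
          rw [lintegral_indicator measurableSet_Ioc, lintegral_Ioc_rpow (by linarith) hm,
            sub_add_cancel]
        · rw [sub_eq_add_neg, ofReal_rpow_add hm, ENNReal.rpow_neg_one, mul_assoc,
            ENNReal.inv_mul_cancel (ofReal_ne_zero_of_pos hm) ENNReal.ofReal_ne_top, mul_one]
    _ = _ := by
        rw [hmG, ENNReal.ofReal_inv_of_pos hc, add_mul, one_mul, ENNReal.div_eq_inv_mul]

theorem setLIntegral_fracKernel_sub_right_le {c : ℝ} (hc : 0 < c) (hc1 : c < 1) {G : Set ℝ}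
    (hGm : MeasurableSet G) (hG0 : 0 < volume G) (hG : volume G < ∞) (s : ℝ) :
    ∫⁻ t in G, fracKernel c (t - s) ≤ (ENNReal.ofReal c⁻¹ + 1) * volume G ^ c := by
  have hv : volume ((fun t => t + s) ⁻¹' G) = volume G := measure_preimage_add_right _ _ _
  have h := setLIntegral_fracKernel_le hc hc1 ((fun t => t + s) ⁻¹' G) (by rwa [hv]) (by rwa [hv])
  rw [hv] at h
  refine le_trans (le_of_eq ?_) h
  rw [← (measurePreserving_add_right volume s).setLIntegral_comp_preimage hGm
    (f := fun t => fracKernel c (t - s))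
    ((measurable_fracKernel c).comp (measurable_id.sub_const s))]
  simp

theorem setLIntegral_fracKernel_sub_left_le {c : ℝ} (hc : 0 < c) (hc1 : c < 1) {G : Set ℝ}
    (hGm : MeasurableSet G) (hG0 : 0 < volume G) (hG : volume G < ∞) (t : ℝ) :
    ∫⁻ s in G, fracKernel c (t - s) ≤ (ENNReal.ofReal c⁻¹ + 1) * volume G ^ c := by
  have hv : volume ((fun s => t - s) ⁻¹' G) = volume G :=
    (Measure.measurePreserving_sub_left volume t).measure_preimage hGm.nullMeasurableSet
  have h := setLIntegral_fracKernel_le hc hc1 ((fun s => t - s) ⁻¹' G) (by rwa [hv]) (by rwa [hv])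
  rw [hv] at h
  refine le_trans (le_of_eq ?_) h
  rw [← (Measure.measurePreserving_sub_left volume t).setLIntegral_comp_preimage hGm
    (f := fun s => fracKernel c (t - s))
    ((measurable_fracKernel c).comp (measurable_const.sub measurable_id))]
  simp

/-- O'Neil's inequality for fractional integration. -/
theorem rearrangement_fracInt_le {c : ℝ} (hc : 0 < c) (hc1 : c < 1) {p q : ℝ → ℝ≥0∞}
    (hp : Measurable p) (hq : Measurable q) {Q : ℝ≥0∞}
    (hQ : ∀ s : ℝ, 0 < s → rearrangement q s ≤ Q * ENNReal.ofReal s ^ (-c)) {t : ℝ} (ht : 0 < t) :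
    rearrangement (fracInt c p q) t ≤ (ENNReal.ofReal c⁻¹ + 1) * Q *
      ∫⁻ s in Ioi (0 : ℝ), rearrangement p (t * s) *
        min (ENNReal.ofReal s ^ (-c)) (ENNReal.ofReal s ^ (-1 : ℝ)) := by
  set b : ℝ≥0∞ := ENNReal.ofReal c⁻¹ + 1 with hb
  have hmp := measurable_rearrangement p
  refine rearrangement_le_of_sets (measurable_fracInt c hp hq) fun y E hE h1 h2 h3 => ?_
  have h0 : 0 < volume E := (zero_le).trans_lt h1
  obtain ⟨m, hm, hmE⟩ : ∃ m : ℝ, 0 < m ∧ volume E = ENNReal.ofReal m :=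
    ⟨(volume E).toReal, ENNReal.toReal_pos h0.ne' h2.ne, (ENNReal.ofReal_toReal h2.ne).symm⟩
  have htm : t ≤ m := by
    rw [hmE] at h1
    exact ((ENNReal.ofReal_lt_ofReal_iff hm).1 h1).le
  -- By Tonelli, ∫_E of the fractional integral is ∫ φ p q, to which the three-function inequality
  -- applies. The kernel bound gives φ ≤ b|E|^c, and, integrated over G instead, φ*(s) ≤
  -- b|E|s^(c-1).
  set φ : ℝ → ℝ≥0∞ := fun s => ∫⁻ x in E, fracKernel c (x - s) with hφ
  have hkm : Measurable fun z : ℝ × ℝ => fracKernel c (z.2 - z.1) :=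
    (measurable_fracKernel c).comp (measurable_snd.sub measurable_fst)
  have hφm : Measurable φ := Measurable.lintegral_prod_right' hkm
  have hφ1 : ∀ s, rearrangement φ s ≤ b * ENNReal.ofReal m ^ c := by
    refine rearrangement_le_of_forall_le fun s => ?_
    rw [← hmE]
    exact setLIntegral_fracKernel_sub_right_le hc hc1 hE h0 h2 s
  have hφ2 : ∀ s : ℝ, 0 < s →
      rearrangement φ s ≤ b * ENNReal.ofReal m * ENNReal.ofReal s ^ (-(1 - c)) := by
    intro s hs
    refine rearrangement_le_of_setLIntegral_le hφm (by linarith) (fun G hGm hG0 hG => ?_) hs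
    rw [sub_sub_cancel, hφ, lintegral_lintegral_swap hkm.aemeasurable, ← hmE]
    calc ∫⁻ x in E, ∫⁻ s in G, fracKernel c (x - s)
        ≤ ∫⁻ _ in E, b * volume G ^ c :=
          lintegral_mono fun x => setLIntegral_fracKernel_sub_left_le hc hc1 hGm hG0 hG x
      _ = b * volume E * volume G ^ c := by rw [setLIntegral_const]; ring
  have h4 : y * ENNReal.ofReal m ≤ ∫⁻ s in Ioi (0 : ℝ), b * Q * ENNReal.ofReal m *
      (rearrangement p s * (ENNReal.ofReal s ^ (-c) *
        min (ENNReal.ofReal t ^ (c - 1)) (ENNReal.ofReal s ^ (c - 1)))) := by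
    calc y * ENNReal.ofReal m ≤ ∫⁻ x in E, fracInt c p q x := by rwa [← hmE]
      _ = ∫⁻ s, φ s * (p s * q s) := by
          unfold fracInt
          rw [lintegral_lintegral_swap]
          · refine lintegral_congr fun s => ?_
            rw [lintegral_mul_const]
            exact hkm.comp (measurable_const.prodMk measurable_id)
          · exact (((measurable_fracKernel c).comp (measurable_fst.sub measurable_snd)).mul
              ((hp.comp measurable_snd).mul (hq.comp measurable_snd))).aemeasurable
      _ ≤ ∫⁻ s in Ioi (0 : ℝ), rearrangement φ s * (rearrangement p s * rearrangement q s) :=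
          lintegral_mul_mul_le_rearrangement hφm hp hq
      _ ≤ _ := by
          refine setLIntegral_mono' measurableSet_Ioi fun s hs => ?_
          have h5 : rearrangement φ s ≤ b * ENNReal.ofReal m *
              min (ENNReal.ofReal t ^ (c - 1)) (ENNReal.ofReal s ^ (c - 1)) := by
            -- Since t ≤ m = |E|, one has m^c = m·m^(c-1) ≤ m·t^(c-1). Both bounds for φ* then carry
            -- the factor m, which cancels against |E| on the left.
            rcases min_choice (ENNReal.ofReal t ^ (c - 1)) (ENNReal.ofReal s ^ (c - 1)) with h | h
            · rw [h]
              refine (hφ1 s).trans ?_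
              rw [mul_assoc]
              refine mul_le_mul' le_rfl ?_
              calc ENNReal.ofReal m ^ c = ENNReal.ofReal m * ENNReal.ofReal m ^ (c - 1) := by
                    nth_rewrite 2 [← ENNReal.rpow_one (ENNReal.ofReal m)]
                    rw [← ofReal_rpow_add hm, add_sub_cancel]
                _ ≤ _ := mul_le_mul' le_rfl (ofReal_rpow_le_rpow_of_nonpos ht htm (by linarith))
            · rw [h]
              simpa using hφ2 s hs
          calc _ ≤ (b * ENNReal.ofReal m *
              min (ENNReal.ofReal t ^ (c - 1)) (ENNReal.ofReal s ^ (c - 1))) *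
                (rearrangement p s * (Q * ENNReal.ofReal s ^ (-c))) := by
                gcongr
                exact hQ s hs
            _ = _ := by ring
  have hΨm : Measurable fun s : ℝ => rearrangement p s * (ENNReal.ofReal s ^ (-c) *
      min (ENNReal.ofReal t ^ (c - 1)) (ENNReal.ofReal s ^ (c - 1))) :=
    hmp.mul ((measurable_ofReal_rpow _).mul (measurable_const.min (measurable_ofReal_rpow _)))
  rw [lintegral_const_mul _ hΨm, mul_right_comm,
    ENNReal.mul_le_mul_iff_left (ofReal_ne_zero_of_pos hm) ENNReal.ofReal_ne_top] at h4
  refine h4.trans (mul_le_mul' le_rfl (le_of_eq ?_))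
  -- The substitution s ↦ ts makes the powers of t cancel: 1 - c + (c - 1) = 0.
  rw [lintegral_Ioi_eq_mul_comp_mul_left hΨm ht]
  refine setLIntegral_congr_fun measurableSet_Ioi fun s (hs : 0 < s) => ?_
  have e1 : ENNReal.ofReal (t * s) ^ (c - 1) =
      ENNReal.ofReal t ^ (c - 1) * ENNReal.ofReal s ^ (c - 1) := by
    rw [ENNReal.ofReal_mul ht.le, ENNReal.mul_rpow_of_ne_top ENNReal.ofReal_ne_top ENNReal.ofReal_ne_top]
  have e2 : ENNReal.ofReal (t * s) ^ (-c) =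
      ENNReal.ofReal t ^ (-c) * ENNReal.ofReal s ^ (-c) := by
    rw [ENNReal.ofReal_mul ht.le, ENNReal.mul_rpow_of_ne_top ENNReal.ofReal_ne_top ENNReal.ofReal_ne_top]
  have e3 : min (ENNReal.ofReal t ^ (c - 1)) (ENNReal.ofReal (t * s) ^ (c - 1)) =
      ENNReal.ofReal t ^ (c - 1) * min 1 (ENNReal.ofReal s ^ (c - 1)) := by
    rw [e1, mul_min, mul_one]
  have e4 : min (ENNReal.ofReal s ^ (-c)) (ENNReal.ofReal s ^ (-1 : ℝ)) =
      ENNReal.ofReal s ^ (-c) * min 1 (ENNReal.ofReal s ^ (c - 1)) := by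
    rw [mul_min, mul_one, ← ofReal_rpow_add hs]
    congr 2; ring
  have e5 : ENNReal.ofReal t * (ENNReal.ofReal t ^ (-c) * ENNReal.ofReal t ^ (c - 1)) = 1 := by
    nth_rewrite 1 [← ENNReal.rpow_one (ENNReal.ofReal t)]
    rw [← ofReal_rpow_add ht, ← ofReal_rpow_add ht]
    ring_nf
    exact ENNReal.rpow_zero
  rw [e2, e3, e4]
  calc _ = (ENNReal.ofReal t * (ENNReal.ofReal t ^ (-c) * ENNReal.ofReal t ^ (c - 1))) *
        (rearrangement p (t * s) * (ENNReal.ofReal s ^ (-c) *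
          min 1 (ENNReal.ofReal s ^ (c - 1)))) := by ring
    _ = _ := by rw [e5, one_mul]

/-- Jensen's inequality for a measure that is not normalized, read off from the comparison of L¹ and
L^b norms. -/
theorem rpow_lintegral_le {Y : Type*} [MeasurableSpace Y] (μ : Measure Y) {f : Y → ℝ≥0∞}
    (hf : Measurable f) {b : ℝ} (hb : 1 ≤ b) :
    (∫⁻ x, f x ∂μ) ^ b ≤ μ univ ^ (b - 1) * ∫⁻ x, f x ^ b ∂μ := by
  have hb0 : 0 < b := by linarith
  have h := eLpNorm_le_eLpNorm_mul_rpow_measure_univ (μ := μ) (f := f) (p := 1)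
    (q := ENNReal.ofReal b) (by simpa using ENNReal.ofReal_le_ofReal hb) hf.aestronglyMeasurable
  rw [eLpNorm_one_eq_lintegral_enorm, eLpNorm_eq_lintegral_rpow_enorm_toReal
    (ofReal_ne_zero_of_pos hb0) ENNReal.ofReal_ne_top] at h
  simp only [enorm_eq_self, ENNReal.toReal_ofReal hb0.le, ENNReal.toReal_one, div_one] at h
  refine (ENNReal.rpow_le_rpow h hb0.le).trans (le_of_eq ?_)
  rw [ENNReal.mul_rpow_of_nonneg _ _ hb0.le, ← ENNReal.rpow_mul, ← ENNReal.rpow_mul,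
    one_div_mul_cancel hb0.ne', ENNReal.rpow_one, sub_mul, one_div_mul_cancel hb0.ne', one_mul,
    mul_comm]

/-- Jensen's inequality for a weighted integral of dilations. -/
theorem lintegral_rpow_lintegral_dilation_le {f κ : ℝ → ℝ≥0∞} (hf : Measurable f)
    (hκ : Measurable κ) {b : ℝ} (hb : 1 ≤ b) :
    ∫⁻ t in Ioi (0 : ℝ), (∫⁻ s in Ioi (0 : ℝ), f (t * s) * κ s) ^ b / ENNReal.ofReal t ≤
      (∫⁻ s in Ioi (0 : ℝ), κ s) ^ b * ∫⁻ t in Ioi (0 : ℝ), f t ^ b / ENNReal.ofReal t := by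
  set ν : Measure ℝ := (volume.restrict (Ioi (0 : ℝ))).withDensity κ with hν
  have hνu : ν univ = ∫⁻ s in Ioi (0 : ℝ), κ s := by
    rw [hν, withDensity_apply _ MeasurableSet.univ, Measure.restrict_univ]
  have hνf : ∀ g : ℝ → ℝ≥0∞, Measurable g →
      ∫⁻ s, g s ∂ν = ∫⁻ s in Ioi (0 : ℝ), g s * κ s := by
    intro g hg
    rw [hν, lintegral_withDensity_eq_lintegral_mul _ hκ hg]
    simp only [Pi.mul_apply, mul_comm]
  have hfd : ∀ t : ℝ, Measurable fun s => f (t * s) := fun t =>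
    hf.comp (measurable_const.mul measurable_id)
  have hfd2 : Measurable fun z : ℝ × ℝ => f (z.1 * z.2) ^ b :=
    (hf.comp (measurable_fst.mul measurable_snd)).pow_const b
  -- Invariance of dt/t under dilations: after Tonelli each dilate contributes equally.
  have hscale : ∀ s : ℝ, 0 < s → ∫⁻ t in Ioi (0 : ℝ), f (t * s) ^ b / ENNReal.ofReal t =
      ∫⁻ t in Ioi (0 : ℝ), f t ^ b / ENNReal.ofReal t := by
    intro s hs
    rw [lintegral_Ioi_eq_mul_comp_mul_left (f := fun t => f t ^ b / ENNReal.ofReal t)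
      ((hf.pow_const b).div ENNReal.measurable_ofReal) hs]
    refine lintegral_congr fun t => ?_
    rw [ENNReal.ofReal_mul hs.le, mul_comm t s, ENNReal.div_eq_inv_mul, ENNReal.div_eq_inv_mul,
      ENNReal.mul_inv (Or.inl (ofReal_ne_zero_of_pos hs)) (Or.inl ENNReal.ofReal_ne_top),
      ← mul_assoc, ← mul_assoc, ENNReal.mul_inv_cancel (ofReal_ne_zero_of_pos hs)
      ENNReal.ofReal_ne_top, one_mul]
  calc ∫⁻ t in Ioi (0 : ℝ), (∫⁻ s in Ioi (0 : ℝ), f (t * s) * κ s) ^ b / ENNReal.ofReal t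
      ≤ ∫⁻ t in Ioi (0 : ℝ), ν univ ^ (b - 1) *
          ∫⁻ s in Ioi (0 : ℝ), f (t * s) ^ b / ENNReal.ofReal t * κ s := by
        refine lintegral_mono fun t => ?_
        rw [← hνf _ (hfd t), ← hνf _ (((hfd t).pow_const b).div_const _)]
        simp only [div_eq_mul_inv]
        rw [lintegral_mul_const _ ((hfd t).pow_const b), ← mul_assoc]
        exact mul_le_mul' (rpow_lintegral_le ν (hfd t) hb) le_rfl
    _ = ν univ ^ (b - 1) * ∫⁻ s in Ioi (0 : ℝ), ∫⁻ t in Ioi (0 : ℝ),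
          f (t * s) ^ b / ENNReal.ofReal t * κ s := by
        have hm : Measurable fun z : ℝ × ℝ =>
            f (z.1 * z.2) ^ b / ENNReal.ofReal z.1 * κ z.2 :=
          (hfd2.div (ENNReal.measurable_ofReal.comp measurable_fst)).mul (hκ.comp measurable_snd)
        rw [lintegral_const_mul _ (Measurable.lintegral_prod_right' hm),
          lintegral_lintegral_swap hm.aemeasurable]
    _ = ν univ ^ (b - 1) * ∫⁻ s in Ioi (0 : ℝ),
          (∫⁻ t in Ioi (0 : ℝ), f t ^ b / ENNReal.ofReal t) * κ s := by
        congr 1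
        refine setLIntegral_congr_fun measurableSet_Ioi fun s hs => ?_
        rw [lintegral_mul_const, hscale s hs]
        exact ((hf.comp (measurable_id.mul measurable_const)).pow_const b).div
          ENNReal.measurable_ofReal
    _ = _ := by
        rw [lintegral_const_mul _ hκ, hνu]
        set I := ∫⁻ s in Ioi (0 : ℝ), κ s
        have : I ^ b = I ^ (b - 1) * I := by
          nth_rewrite 3 [← ENNReal.rpow_one I]
          rw [← ENNReal.rpow_add_of_nonneg _ _ (by linarith) zero_le_one, sub_add_cancel]
        rw [this]
        ring

/-- Fractional integration of order `1 / α` maps `L^{α,β} · L^{α,∞}` into `L^{α,β}`. -/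
theorem exists_lorentzQNorm_fracInt_le {α β : ℝ≥0∞} (hα : 2 < α) (hα' : α < ∞) (hβ : 1 ≤ β) :
    ∃ C : ℝ≥0, ∀ p q : ℝ → ℝ≥0∞, Measurable p → Measurable q →
      lorentzQNorm α β (fracInt (α⁻¹).toReal p q) ≤
        C * lorentzQNorm α β p * lorentzQNorm α ∞ q := by
  set c : ℝ := (α⁻¹).toReal with hc
  have hα2 : 2 < α.toReal := by
    simpa using (ENNReal.toReal_lt_toReal (by simp) hα'.ne).2 hα
  have hc' : c = α.toReal⁻¹ := ENNReal.toReal_inv α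
  have hc0 : 0 < c := by rw [hc']; positivity
  have hc2 : c < 1 / 2 := by rw [hc', inv_lt_comm₀ (by linarith) (by norm_num)]; simpa using hα2
  -- The weight left in O'Neil's inequality once s^c is moved over to p*. It is integrable at 0
  -- because 2c < 1 (α > 2) and at infinity because c > 0 (α < ∞).
  set κ : ℝ → ℝ≥0∞ := fun s =>
    min (ENNReal.ofReal s ^ (-(2 * c))) (ENNReal.ofReal s ^ (-(1 + c))) with hκ
  have hκm : Measurable κ := (measurable_ofReal_rpow _).min (measurable_ofReal_rpow _)
  set I : ℝ≥0∞ := ∫⁻ s in Ioi (0 : ℝ), κ s with hI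
  have hIfin : I < ∞ := lintegral_min_rpow_lt_top (by linarith) (by linarith)
  set b : ℝ≥0∞ := ENNReal.ofReal c⁻¹ + 1 with hb
  have hbfin : b < ∞ := by rw [hb]; exact ENNReal.add_lt_top.2 ⟨ENNReal.ofReal_lt_top, by simp⟩
  refine ⟨(b * I).toNNReal, fun p q hp hq => ?_⟩
  rw [ENNReal.coe_toNNReal (ENNReal.mul_lt_top hbfin hIfin).ne]
  set Q := lorentzQNorm α ∞ q with hQ
  have hκs : ∀ s : ℝ, 0 < s → min (ENNReal.ofReal s ^ (-c)) (ENNReal.ofReal s ^ (-1 : ℝ)) =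
      ENNReal.ofReal s ^ c * κ s := by
    intro s hs
    rw [hκ, mul_min, ← ofReal_rpow_add hs, ← ofReal_rpow_add hs]
    congr 2 <;> ring
  have key : ∀ t : ℝ, 0 < t → ENNReal.ofReal t ^ c * rearrangement (fracInt c p q) t ≤
      b * Q * ∫⁻ s in Ioi (0 : ℝ),
        (ENNReal.ofReal (t * s) ^ c * rearrangement p (t * s)) * κ s := by
    intro t ht
    have h := rearrangement_fracInt_le hc0 (by linarith) hp hq
      (fun s hs => rearrangement_le_lorentzQNorm α q hs) ht
    refine (mul_le_mul' le_rfl h).trans (le_of_eq ?_)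
    rw [mul_left_comm, ← lintegral_const_mul]
    · congr 1
      refine setLIntegral_congr_fun measurableSet_Ioi fun s hs => ?_
      rw [hκs s hs, ENNReal.ofReal_mul ht.le, ENNReal.mul_rpow_of_nonneg _ _ hc0.le]
      ring
    · exact ((measurable_rearrangement p).comp (measurable_const.mul measurable_id)).mul
        ((measurable_ofReal_rpow _).min (measurable_ofReal_rpow _))
  by_cases hβ' : β = ∞
  · subst hβ'
    refine lorentzQNorm_top_le fun t ht => ?_
    rw [← hc, ← ofReal_rpow_mul_le_iff ht]
    refine (key t ht).trans ?_
    calc _ ≤ b * Q * ∫⁻ s in Ioi (0 : ℝ), lorentzQNorm α ∞ p * κ s := by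
          refine mul_le_mul' le_rfl (setLIntegral_mono' measurableSet_Ioi fun s hs => ?_)
          refine mul_le_mul' ?_ le_rfl
          rw [ofReal_rpow_mul_le_iff (mul_pos ht hs)]
          exact rearrangement_le_lorentzQNorm α p (mul_pos ht hs)
      _ = _ := by rw [lintegral_const_mul _ hκm, ← hI]; ring
  · have hb1 : 1 ≤ β.toReal := by
      simpa using (ENNReal.toReal_le_toReal (by simp) hβ').2 hβ
    have hb0 : 0 < β.toReal := by linarith
    have hpm : Measurable fun t : ℝ => ENNReal.ofReal t ^ c * rearrangement p t :=
      (measurable_ofReal_rpow _).mul (measurable_rearrangement p)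
    simp only [lorentzQNorm, if_neg hβ']
    rw [← hc, mul_right_comm, ENNReal.toReal_inv β]
    have e : ∀ x y : ℝ≥0∞, x * y ^ β.toReal⁻¹ = (x ^ β.toReal * y) ^ β.toReal⁻¹ := by
      intro x y
      rw [ENNReal.mul_rpow_of_nonneg _ _ (by positivity), ← ENNReal.rpow_mul,
        mul_inv_cancel₀ hb0.ne', ENNReal.rpow_one]
    rw [e]
    refine ENNReal.rpow_le_rpow ?_ (by positivity)
    calc _ ≤ β / α * ∫⁻ t in Ioi (0 : ℝ), (b * Q) ^ β.toReal *
          ((∫⁻ s in Ioi (0 : ℝ), (ENNReal.ofReal (t * s) ^ c * rearrangement p (t * s)) * κ s) ^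
            β.toReal / ENNReal.ofReal t) := by
          refine mul_le_mul' le_rfl (setLIntegral_mono' measurableSet_Ioi fun t ht => ?_)
          rw [← mul_div_assoc, ← ENNReal.mul_rpow_of_nonneg _ _ hb0.le]
          exact ENNReal.div_le_div_right (ENNReal.rpow_le_rpow (key t ht) hb0.le) _
      _ ≤ β / α * ((b * Q) ^ β.toReal * (I ^ β.toReal * ∫⁻ t in Ioi (0 : ℝ),
          (ENNReal.ofReal t ^ c * rearrangement p t) ^ β.toReal / ENNReal.ofReal t)) := by
          rw [lintegral_const_mul]
          · refine mul_le_mul' le_rfl (mul_le_mul' le_rfl ?_)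
            exact lintegral_rpow_lintegral_dilation_le hpm hκm hb1
          · refine Measurable.div (Measurable.pow_const ?_ _) ENNReal.measurable_ofReal
            refine Measurable.lintegral_prod_right' (f := fun z : ℝ × ℝ =>
              ENNReal.ofReal (z.1 * z.2) ^ c * rearrangement p (z.1 * z.2) * κ z.2) ?_
            exact (hpm.comp (measurable_fst.mul measurable_snd)).mul (hκm.comp measurable_snd)
      _ = _ := by
          rw [show b * I * Q = b * Q * I by ring, ENNReal.mul_rpow_of_nonneg (b * Q) I hb0.le]
          ring

end FractionalIntegral


/-! ### Almost everywhere consequences of weak bounds. -/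

section AlmostEverywhere

variable {X : Type*} [MeasureSpace X]

theorem exists_pos_ofReal_lt {m : ℝ≥0∞} (hm : 0 < m) : ∃ t : ℝ, 0 < t ∧ ENNReal.ofReal t < m := by
  obtain ⟨t, ht0, ht⟩ := ENNReal.lt_iff_exists_real_btwn.1 hm
  exact ⟨t, ENNReal.ofReal_pos.1 ht.1, ht.2⟩

/-- If {g > q} has positive measure, then g*(t) ≥ q for small t > 0, so no level q above the
quasinorm is exceeded on a set of positive measure. Rational levels make the exceptional sets
countably many. -/
theorem ae_le_lorentzQNorm_top_top (g : X → ℝ≥0∞) : ∀ᵐ x, g x ≤ lorentzQNorm ∞ ∞ g := by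
  have h : ∀ q : ℚ, lorentzQNorm ∞ ∞ g < ENNReal.ofReal q →
      ∀ᵐ x, g x ≤ ENNReal.ofReal q := by
    intro q hq
    by_contra hne
    have hpos : 0 < distribution g (ENNReal.ofReal q) := by
      refine pos_iff_ne_zero.2 fun h0 => hne ?_
      rw [ae_iff]
      simpa only [not_le, distribution] using h0
    obtain ⟨t, ht0, ht⟩ := exists_pos_ofReal_lt hpos
    have h1 : ENNReal.ofReal q ≤ rearrangement g t :=
      le_sSup ⟨(zero_le).trans_lt hq, ENNReal.ofReal_lt_top, ht⟩
    have h2 := rearrangement_le_lorentzQNorm ∞ g ht0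
    simp only [ENNReal.inv_top, ENNReal.toReal_zero, neg_zero, ENNReal.rpow_zero, mul_one] at h2
    exact absurd (h1.trans h2) (not_le.2 hq)
  have h' : ∀ᵐ x, ∀ q : ℚ, lorentzQNorm ∞ ∞ g < ENNReal.ofReal q → g x ≤ ENNReal.ofReal q := by
    rw [ae_all_iff]
    intro q
    by_cases hq : lorentzQNorm ∞ ∞ g < ENNReal.ofReal q
    · filter_upwards [h q hq] with x hx _ using hx
    · exact Filter.Eventually.of_forall fun x hx => absurd hx hq
  filter_upwards [h'] with x hx
  by_contra hlt
  obtain ⟨q, _, hq1, hq2⟩ := ENNReal.lt_iff_exists_rat_btwn.1 (not_le.1 hlt)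
  exact absurd (hx q hq1) (not_le.2 hq2)

theorem ae_lt_top_of_rearrangement_lt_top {g : X → ℝ≥0∞}
    (h : ∀ t : ℝ, 0 < t → rearrangement g t < ∞) : ∀ᵐ x, g x < ∞ := by
  by_contra hne
  have hpos : 0 < volume {x | ¬ g x < ∞} := pos_iff_ne_zero.2 fun h0 => hne (ae_iff.2 h0)
  obtain ⟨t, ht0, ht⟩ := exists_pos_ofReal_lt hpos
  obtain ⟨y, hy, hy'⟩ := ENNReal.lt_iff_exists_nnreal_btwn.1 (h t ht0)
  have h1 : (y : ℝ≥0∞) ≤ rearrangement g t := by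
    refine le_sSup ⟨(zero_le).trans_lt hy, ENNReal.coe_lt_top, ht.trans_le ?_⟩
    exact measure_mono fun x hx => ENNReal.coe_lt_top.trans_le (not_lt.1 hx)
  exact absurd h1 (not_le.2 hy)

theorem ae_lt_top_of_lorentzQNorm_top_lt_top {p : ℝ≥0∞} {g : X → ℝ≥0∞}
    (h : lorentzQNorm p ∞ g < ∞) : ∀ᵐ x, g x < ∞ :=
  ae_lt_top_of_rearrangement_lt_top fun _ ht =>
    (rearrangement_le_lorentzQNorm p g ht).trans_lt
      (ENNReal.mul_lt_top h (ofReal_rpow_ne_top ht _).lt_top)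

end AlmostEverywhere

/-! ### Convolution with the kernel at a fixed time. -/

section SpaceEstimate

/-- Hölder's inequality in Lorentz spaces, the third factor being bounded and integrable. -/
theorem lintegral_mul_mul_le_of_bounded_integrable {X : Type*} [MeasureSpace X]
    [SigmaFinite (volume : Measure X)] (r : ℝ≥0∞) {ψ f g : X → ℝ≥0∞} (hψ : Measurable ψ)
    (hf : Measurable f) (hg : Measurable g) {M : ℝ≥0∞} {s₀ : ℝ} (hs₀ : 0 < s₀)
    (h1 : ∀ x, ψ x ≤ M) (h2 : ∫⁻ x, ψ x ≤ M * ENNReal.ofReal s₀) :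
    ∫⁻ x, ψ x * (f x * g x) ≤ M * ENNReal.ofReal s₀ ^ (1 - 2 * (r⁻¹).toReal) *
      (∫⁻ s in Ioi (0 : ℝ), min (ENNReal.ofReal s ^ (-(2 * (r⁻¹).toReal)))
        (ENNReal.ofReal s ^ (-(1 + 2 * (r⁻¹).toReal)))) *
      (lorentzQNorm r ∞ f * lorentzQNorm r ∞ g) := by
  set ρ := (r⁻¹).toReal with hρ
  set A := lorentzQNorm r ∞ f with hA
  set B := lorentzQNorm r ∞ g with hB
  have hmm : ∀ c d : ℝ, Measurable fun s : ℝ =>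
      min (ENNReal.ofReal s ^ c) (ENNReal.ofReal s ^ d) := fun c d =>
    (measurable_ofReal_rpow _).min (measurable_ofReal_rpow _)
  have hΦ : Measurable fun s : ℝ =>
      M * min 1 (ENNReal.ofReal s₀ * ENNReal.ofReal s ^ (-1 : ℝ)) *
        (A * ENNReal.ofReal s ^ (-ρ) * (B * ENNReal.ofReal s ^ (-ρ))) :=
    (measurable_const.mul (measurable_const.min (measurable_const.mul (measurable_ofReal_rpow _)))).mul
      ((measurable_const.mul (measurable_ofReal_rpow _)).mul
        (measurable_const.mul (measurable_ofReal_rpow _)))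
  calc ∫⁻ x, ψ x * (f x * g x)
      ≤ ∫⁻ s in Ioi (0 : ℝ), rearrangement ψ s * (rearrangement f s * rearrangement g s) :=
        lintegral_mul_mul_le_rearrangement hψ hf hg
    _ ≤ ∫⁻ s in Ioi (0 : ℝ), M * min 1 (ENNReal.ofReal s₀ * ENNReal.ofReal s ^ (-1 : ℝ)) *
        (A * ENNReal.ofReal s ^ (-ρ) * (B * ENNReal.ofReal s ^ (-ρ))) := by
        refine setLIntegral_mono' measurableSet_Ioi fun s hs => ?_
        refine mul_le_mul' ?_ (mul_le_mul' (rearrangement_le_lorentzQNorm r f hs)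
          (rearrangement_le_lorentzQNorm r g hs))
        -- The supremum and the integral of ψ together give ψ*(s) ≤ M min(1, s₀/s); s₀ is the scale
        -- at which the two bounds meet.
        rw [mul_min, mul_one]
        refine le_min (rearrangement_le_of_forall_le h1 s) ?_
        rw [← mul_assoc]
        exact (rearrangement_le_div hψ hs).trans (mul_le_mul' h2 le_rfl)
    _ = ∫⁻ s in Ioi (0 : ℝ), M * ENNReal.ofReal s₀ ^ (1 - 2 * ρ) * (A * B) *
          min (ENNReal.ofReal s ^ (-(2 * ρ))) (ENNReal.ofReal s ^ (-(1 + 2 * ρ))) := by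
        rw [lintegral_Ioi_eq_mul_comp_mul_left hΦ hs₀]
        refine setLIntegral_congr_fun measurableSet_Ioi fun s (hs : 0 < s) => ?_
        have e1 : ENNReal.ofReal s₀ * ENNReal.ofReal (s₀ * s) ^ (-1 : ℝ) =
            ENNReal.ofReal s ^ (-1 : ℝ) := by
          rw [ENNReal.ofReal_mul hs₀.le,
            ENNReal.mul_rpow_of_ne_top ENNReal.ofReal_ne_top ENNReal.ofReal_ne_top, ← mul_assoc]
          nth_rewrite 1 [← ENNReal.rpow_one (ENNReal.ofReal s₀)]
          rw [ofReal_rpow_mul_neg hs₀, one_mul]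
        have e2 : ENNReal.ofReal (s₀ * s) ^ (-ρ) =
            ENNReal.ofReal s₀ ^ (-ρ) * ENNReal.ofReal s ^ (-ρ) := by
          rw [ENNReal.ofReal_mul hs₀.le,
            ENNReal.mul_rpow_of_ne_top ENNReal.ofReal_ne_top ENNReal.ofReal_ne_top]
        have e3 : ENNReal.ofReal s₀ ^ (1 - 2 * ρ) =
            ENNReal.ofReal s₀ * (ENNReal.ofReal s₀ ^ (-ρ) * ENNReal.ofReal s₀ ^ (-ρ)) := by
          nth_rewrite 2 [← ENNReal.rpow_one (ENNReal.ofReal s₀)]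
          rw [← ofReal_rpow_add hs₀, ← ofReal_rpow_add hs₀]
          congr 1; ring
        have e4 : min (ENNReal.ofReal s ^ (-(2 * ρ))) (ENNReal.ofReal s ^ (-(1 + 2 * ρ))) =
            ENNReal.ofReal s ^ (-ρ) * ENNReal.ofReal s ^ (-ρ) *
              min 1 (ENNReal.ofReal s ^ (-1 : ℝ)) := by
          rw [mul_min, mul_one, ← ofReal_rpow_add hs, ← ofReal_rpow_add hs]
          congr 2 <;> ring
        rw [e1, e2, e3, e4]
        ring
    _ = _ := by
        rw [lintegral_const_mul _ (hmm _ _)]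
        ring

/-- The kernel bounds of the gradient of the Oseen kernel. -/
structure OseenBound {n : ℕ} (K : ℝ → E n → ℝ≥0∞) (C : ℝ≥0) : Prop where
  meas : Measurable fun z : ℝ × E n => K z.1 z.2
  lintegral_le : ∀ τ, 0 < τ → ∫⁻ x, K τ x ≤ C * ENNReal.ofReal τ ^ (-(1 / 2) : ℝ)
  le : ∀ τ, 0 < τ → ∀ x, K τ x ≤ C * ENNReal.ofReal τ ^ (-((n + 1) / 2) : ℝ)

variable {n : ℕ} {K : ℝ → E n → ℝ≥0∞} {C : ℝ≥0}

theorem OseenBound.convolution_le (hK : OseenBound K C) {τ : ℝ} (hτ : 0 < τ) (a b : E n → ℝ≥0∞)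
    (x : E n) : ∫⁻ y, K τ (x - y) * (a y * b y) ≤
      C * ENNReal.ofReal τ ^ (-(1 / 2) : ℝ) * (lorentzQNorm ∞ ∞ a * lorentzQNorm ∞ ∞ b) := by
  have hKx : Measurable fun y => K τ (x - y) :=
    hK.meas.comp (measurable_const.prodMk (measurable_const.sub measurable_id))
  calc _ ≤ ∫⁻ y, K τ (x - y) * (lorentzQNorm ∞ ∞ a * lorentzQNorm ∞ ∞ b) := by
        refine lintegral_mono_ae ?_
        filter_upwards [ae_le_lorentzQNorm_top_top a, ae_le_lorentzQNorm_top_top b] with y h1 h2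
        gcongr
    _ = (∫⁻ y, K τ y) * (lorentzQNorm ∞ ∞ a * lorentzQNorm ∞ ∞ b) := by
        rw [lintegral_mul_const _ hKx, lintegral_sub_left_eq_self (fun y => K τ y) x]
    _ ≤ _ := by gcongr; exact hK.lintegral_le τ hτ

/-- A Young inequality in weak Lebesgue spaces: convolution with `K τ` maps
`L^{r/2,∞}` to `L^{r,∞}`. -/
theorem OseenBound.exists_setLIntegral_convolution_le (hK : OseenBound K C) {r : ℝ≥0∞}
    (hr : 2 < r) :
    ∃ C' : ℝ≥0, ∀ (τ : ℝ) (S : Set (E n)) (a b : E n → ℝ≥0∞), 0 < τ → MeasurableSet S →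
      0 < volume S → volume S < ∞ → Measurable a → Measurable b →
      ∫⁻ x in S, ∫⁻ y, K τ (x - y) * (a y * b y) ≤
        C' * volume S ^ (1 - (r⁻¹).toReal) *
          (ENNReal.ofReal τ ^ (-(1 / 2 + n * (r⁻¹).toReal / 2)) *
            (lorentzQNorm r ∞ a * lorentzQNorm r ∞ b)) := by
  set ρ := (r⁻¹).toReal with hρ
  have hr' : r⁻¹ < 2⁻¹ := ENNReal.inv_lt_inv.2 hr
  have hρ2 : 2 * ρ < 1 := by
    have := (ENNReal.toReal_lt_toReal hr'.ne_top (by simp)).2 hr'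
    rw [ENNReal.toReal_inv 2, ENNReal.toReal_ofNat] at this
    linarith
  have hρ0 : 0 ≤ ρ := ENNReal.toReal_nonneg
  -- For r = ∞ the Hölder weight behaves like 1/s at infinity and is not integrable; the L¹ bound
  -- for the kernel suffices there.
  by_cases hρz : ρ = 0
  · refine ⟨C, fun τ S a b hτ hS hS0 hSt ha hb => ?_⟩
    have hrtop : r = ∞ := by
      rcases (ENNReal.toReal_eq_zero_iff _).1 hρz with h | h
      · simpa using h
      · exact absurd h hr'.ne_top
    subst hrtop
    refine (lintegral_mono fun x => hK.convolution_le hτ a b x).trans (le_of_eq ?_)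
    rw [setLIntegral_const, hρz]
    simp only [sub_zero, ENNReal.rpow_one, mul_zero, zero_div, add_zero]
    ring
  have hρpos : 0 < ρ := lt_of_le_of_ne hρ0 (Ne.symm hρz)
  set I := ∫⁻ s in Ioi (0 : ℝ), min (ENNReal.ofReal s ^ (-(2 * ρ)))
        (ENNReal.ofReal s ^ (-(1 + 2 * ρ))) with hI
  have hIfin : I < ∞ := lintegral_min_rpow_lt_top hρ2 (by linarith)
  refine ⟨C * I.toNNReal, fun τ S a b hτ hS hS0 hSt ha hb => ?_⟩
  set m := volume S with hm
  set t := ENNReal.ofReal τ with ht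
  set ψ : E n → ℝ≥0∞ := fun y => ∫⁻ x in S, K τ (x - y) with hψ
  have hKm : Measurable fun z : E n × E n => K τ (z.2 - z.1) :=
    hK.meas.comp (measurable_const.prodMk (measurable_snd.sub measurable_fst))
  have hKm' : Measurable fun z : E n × E n => K τ (z.1 - z.2) :=
    hK.meas.comp (measurable_const.prodMk (measurable_fst.sub measurable_snd))
  have hψm : Measurable ψ := Measurable.lintegral_prod_right' hKm
  -- The quotient of the bound Cτ^(-1/2)m for ∫ψ by the bound for sup ψ that follows.
  set s₀ : ℝ := (t ^ ((n : ℝ) / 4) * m ^ (1 / 2 : ℝ)).toReal with hs₀d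
  have hmh0 : m ^ (1 / 2 : ℝ) ≠ 0 := (ENNReal.rpow_pos hS0 hSt.ne).ne'
  have hmht : m ^ (1 / 2 : ℝ) ≠ ∞ := ENNReal.rpow_ne_top_of_ne_zero hS0.ne' hSt.ne
  have hs₀' : t ^ ((n : ℝ) / 4) * m ^ (1 / 2 : ℝ) ≠ ∞ :=
    ENNReal.mul_ne_top (ofReal_rpow_ne_top hτ _) hmht
  have hs₀ : 0 < s₀ := ENNReal.toReal_pos (mul_ne_zero (ofReal_rpow_ne_zero hτ _) hmh0) hs₀'
  have hs₀e : ENNReal.ofReal s₀ = t ^ ((n : ℝ) / 4) * m ^ (1 / 2 : ℝ) := ENNReal.ofReal_toReal hs₀'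
  have hsq : ∀ x : ℝ≥0∞, x ^ (1 / 2 : ℝ) * x ^ (1 / 2 : ℝ) = x := by
    intro x
    rw [← ENNReal.rpow_add_of_nonneg _ _ (by norm_num) (by norm_num), add_halves, ENNReal.rpow_one]
  -- The geometric mean of ψ ≤ Cτ^(-1/2) and ψ ≤ Cτ^(-(n+1)/2)|S|. The first bound alone would end
  -- in |S|^(1-2ρ) rather than |S|^(1-ρ).
  have hψ1 : ∀ y, ψ y ≤ C * t ^ (-(1 / 2 + n / 4) : ℝ) * m ^ (1 / 2 : ℝ) := by
    intro y
    have i1 : ψ y ≤ C * t ^ (-(1 / 2) : ℝ) := by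
      refine (setLIntegral_le_lintegral _ _).trans ?_
      rw [lintegral_sub_right_eq_self (fun x => K τ x) y]
      exact hK.lintegral_le τ hτ
    have i2 : ψ y ≤ C * t ^ (-((n + 1) / 2) : ℝ) * m := by
      rw [hm, ← setLIntegral_const]
      exact lintegral_mono fun x => hK.le τ hτ _
    calc ψ y = ψ y ^ (1 / 2 : ℝ) * ψ y ^ (1 / 2 : ℝ) := (hsq _).symm
      _ ≤ (C * t ^ (-(1 / 2) : ℝ)) ^ (1 / 2 : ℝ) *
          (C * t ^ (-((n + 1) / 2) : ℝ) * m) ^ (1 / 2 : ℝ) := by gcongr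
      _ = ((C : ℝ≥0∞) ^ (1 / 2 : ℝ) * (C : ℝ≥0∞) ^ (1 / 2 : ℝ)) *
          (t ^ (-(1 / 2) * (1 / 2) : ℝ) * t ^ (-((n + 1) / 2) * (1 / 2) : ℝ)) * m ^ (1 / 2 : ℝ) := by
          rw [ENNReal.mul_rpow_of_nonneg _ _ (by norm_num : (0 : ℝ) ≤ 1 / 2),
            ENNReal.mul_rpow_of_nonneg _ _ (by norm_num : (0 : ℝ) ≤ 1 / 2),
            ENNReal.mul_rpow_of_nonneg _ _ (by norm_num : (0 : ℝ) ≤ 1 / 2),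
            ← ENNReal.rpow_mul, ← ENNReal.rpow_mul]
          ring
      _ = _ := by
          rw [hsq, ← ofReal_rpow_add hτ]
          congr 3; ring
  have hψ2 : ∫⁻ y, ψ y ≤ C * t ^ (-(1 / 2 + n / 4) : ℝ) * m ^ (1 / 2 : ℝ) * ENNReal.ofReal s₀ := by
    rw [hψ, lintegral_lintegral_swap hKm.aemeasurable]
    calc ∫⁻ x in S, ∫⁻ y, K τ (x - y) = ∫⁻ _ in S, ∫⁻ y, K τ y :=
          lintegral_congr fun x => lintegral_sub_left_eq_self (fun y => K τ y) x
      _ ≤ C * t ^ (-(1 / 2) : ℝ) * m := by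
          rw [setLIntegral_const]
          gcongr
          exact hK.lintegral_le τ hτ
      _ = C * (t ^ (-(1 / 2 + n / 4) : ℝ) * t ^ ((n : ℝ) / 4)) *
            (m ^ (1 / 2 : ℝ) * m ^ (1 / 2 : ℝ)) := by
          rw [hsq, ← ofReal_rpow_add hτ]
          congr 3; ring
      _ = _ := by rw [hs₀e]; ring
  calc ∫⁻ x in S, ∫⁻ y, K τ (x - y) * (a y * b y) = ∫⁻ y, ψ y * (a y * b y) := by
        rw [lintegral_lintegral_swap]
        · refine lintegral_congr fun y => ?_
          rw [lintegral_mul_const]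
          exact hKm.comp (measurable_const.prodMk measurable_id)
        · exact (hKm'.mul ((ha.comp measurable_snd).mul (hb.comp measurable_snd))).aemeasurable
    _ ≤ _ := lintegral_mul_mul_le_of_bounded_integrable r hψm ha hb hs₀ hψ1 hψ2
    _ = C * I * (m ^ (1 / 2 : ℝ) * m ^ (1 / 2 * (1 - 2 * ρ))) *
          ((t ^ (-(1 / 2 + n / 4) : ℝ) * t ^ ((n : ℝ) / 4 * (1 - 2 * ρ))) *
            (lorentzQNorm r ∞ a * lorentzQNorm r ∞ b)) := by
        rw [hs₀e, ENNReal.mul_rpow_of_nonneg _ _ (by linarith : 0 ≤ 1 - 2 * ρ),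
          ← ENNReal.rpow_mul, ← ENNReal.rpow_mul]
        ring
    _ = _ := by
        rw [← ENNReal.rpow_add _ _ hS0.ne' hSt.ne, ← ofReal_rpow_add hτ, ENNReal.coe_mul,
          ENNReal.coe_toNNReal hIfin.ne]
        congr 3
        · ring
        · ring

end SpaceEstimate


/-! ### Homogeneity of the quasinorms, and their measurability in a parameter. -/

section Homogeneity

variable {X : Type*} [MeasureSpace X]

theorem rearrangement_const_mul_le (k : ℝ≥0) (g : X → ℝ≥0∞) (t : ℝ) :
    rearrangement (fun x => k * g x) t ≤ k * rearrangement g t := by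
  by_cases hk : k = 0
  · subst hk
    simpa using rearrangement_le_of_forall_le (g := fun _ : X => (0 : ℝ≥0∞)) (fun _ => le_rfl) t
  have hk' : (k : ℝ≥0∞) ≠ 0 := by simpa using hk
  refine rearrangement_le fun y hy0 hy hyt => ?_
  have h : y / k ≤ rearrangement g t := by
    refine le_sSup ⟨ENNReal.div_pos hy0.ne' ENNReal.coe_ne_top, ENNReal.div_lt_top hy.ne hk', ?_⟩
    refine hyt.trans_le (measure_mono fun x (hx : y < k * g x) => ?_)
    change y / k < g x
    rwa [ENNReal.div_lt_iff (Or.inl hk') (Or.inl ENNReal.coe_ne_top), mul_comm]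
  rwa [ENNReal.div_le_iff hk' ENNReal.coe_ne_top, mul_comm] at h

theorem lorentzQNorm_const_mul_le {p q : ℝ≥0∞} (hq : q ≠ 0) (k : ℝ≥0) (g : X → ℝ≥0∞) :
    lorentzQNorm p q (fun x => k * g x) ≤ k * lorentzQNorm p q g := by
  by_cases hq' : q = ∞
  · subst hq'
    refine lorentzQNorm_top_le fun t ht => (rearrangement_const_mul_le k g t).trans ?_
    rw [mul_assoc]
    gcongr
    exact rearrangement_le_lorentzQNorm p g ht
  have hq0 : 0 < q.toReal := ENNReal.toReal_pos hq hq'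
  simp only [lorentzQNorm, if_neg hq']
  have e : ∀ y : ℝ≥0∞, k * y ^ (q⁻¹).toReal = ((k : ℝ≥0∞) ^ q.toReal * y) ^ (q⁻¹).toReal := by
    intro y
    rw [ENNReal.toReal_inv, ENNReal.mul_rpow_of_nonneg _ _ (by positivity), ← ENNReal.rpow_mul,
      mul_inv_cancel₀ hq0.ne', ENNReal.rpow_one]
  rw [e]
  refine ENNReal.rpow_le_rpow ?_ ENNReal.toReal_nonneg
  rw [mul_left_comm]
  refine mul_le_mul' le_rfl ?_
  rw [← lintegral_const_mul' _ _ (ENNReal.rpow_ne_top_of_nonneg hq0.le ENNReal.coe_ne_top)]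
  refine lintegral_mono fun t => ?_
  rw [← mul_div_assoc, ← ENNReal.mul_rpow_of_nonneg _ _ hq0.le, mul_left_comm]
  exact ENNReal.div_le_div_right (ENNReal.rpow_le_rpow
    (mul_le_mul' le_rfl (rearrangement_const_mul_le k g t)) hq0.le) _

/-- The weak quasinorm is the supremum of t^(1/p) y over pairs with λ_g(y) > t. This condition
persists when t and y decrease, and t^(1/p) y is continuous, so rational pairs suffice. The
countable form yields measurability in time of the norm in space. -/
theorem lorentzQNorm_top_eq_iSup_rat (p : ℝ≥0∞) (g : X → ℝ≥0∞) :
    lorentzQNorm p ∞ g = ⨆ (t : ℚ) (y : ℚ),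
      {m : ℝ≥0∞ | 0 < t ∧ 0 < y ∧ ENNReal.ofReal t < m}.indicator
        (fun _ => ENNReal.ofReal t ^ (p⁻¹).toReal * ENNReal.ofReal y)
        (distribution g (ENNReal.ofReal y)) := by
  rw [lorentzQNorm, if_pos rfl]
  set c := (p⁻¹).toReal with hc
  have hc0 : 0 ≤ c := ENNReal.toReal_nonneg
  apply le_antisymm
  · refine iSup₂_le fun t (ht : 0 < t) => ?_
    rw [ofReal_rpow_mul_le_iff ht]
    refine rearrangement_le fun y hy0 hy hyt => ?_
    rw [← ofReal_rpow_mul_le_iff ht]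
    refine le_of_forall_lt fun z hz => ?_
    have h1 : z < ENNReal.ofReal (t ^ c * y.toReal) := by
      rwa [ENNReal.ofReal_mul (by positivity), ENNReal.ofReal_toReal hy.ne,
        ← ENNReal.ofReal_rpow_of_pos ht]
    have hy1 : 0 < y.toReal := ENNReal.toReal_pos hy0.ne' hy.ne
    have hcont : ContinuousAt (fun w : ℝ => ENNReal.ofReal ((t * w) ^ c * (y.toReal * w))) 1 := by
      refine ENNReal.continuous_ofReal.continuousAt.comp (ContinuousAt.mul ?_ (by fun_prop))
      exact ContinuousAt.rpow_const (by fun_prop) (Or.inr hc0)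
    -- Shrinking t and y by a common factor w < 1 near 1 leaves room for rationals in (tw, t) and
    -- (yw, y).
    have h2 : ∀ᶠ w in nhds (1 : ℝ), z < ENNReal.ofReal ((t * w) ^ c * (y.toReal * w)) :=
      hcont.eventually (lt_mem_nhds (by simpa using h1))
    obtain ⟨ε, hε, hball⟩ := Metric.eventually_nhds_iff.1 h2
    obtain ⟨w, hw0, hw1⟩ : ∃ w : ℝ, max 0 (1 - ε) < w ∧ w < 1 :=
      exists_between (max_lt one_pos (by linarith))
    have hw : 0 < w := (le_max_left _ _).trans_lt hw0
    have h3 : z < ENNReal.ofReal ((t * w) ^ c * (y.toReal * w)) := by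
      refine hball ?_
      rw [Real.dist_eq, abs_lt]
      have := (le_max_right 0 (1 - ε)).trans_lt hw0
      constructor <;> linarith
    obtain ⟨t', ht1, ht2⟩ := exists_rat_btwn (by nlinarith : t * w < t)
    obtain ⟨y', hy2, hy3⟩ := exists_rat_btwn (by nlinarith : y.toReal * w < y.toReal)
    have ht0 : (0 : ℝ) < t' := (mul_pos ht hw).trans ht1
    have hy0' : (0 : ℝ) < y' := (mul_pos hy1 hw).trans hy2
    have hmem : ENNReal.ofReal t' < distribution g (ENNReal.ofReal y') := by
      refine ((ENNReal.ofReal_le_ofReal ht2.le).trans_lt hyt).trans_le (distribution_antitone g ?_)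
      rw [ENNReal.ofReal_le_iff_le_toReal hy.ne]
      exact hy3.le
    refine lt_of_lt_of_le h3 (le_iSup₂_of_le t' y' ?_)
    rw [indicator_of_mem (by exact ⟨by exact_mod_cast ht0, by exact_mod_cast hy0', hmem⟩),
      ENNReal.ofReal_rpow_of_pos ht0, ← ENNReal.ofReal_mul (by positivity)]
    exact ENNReal.ofReal_le_ofReal (by gcongr)
  · refine iSup₂_le fun t y => ?_
    by_cases h : distribution g (ENNReal.ofReal y) ∈
        {m : ℝ≥0∞ | 0 < t ∧ 0 < y ∧ ENNReal.ofReal t < m}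
    · rw [indicator_of_mem h]
      refine le_iSup₂_of_le (t : ℝ) (mem_Ioi.2 (by exact_mod_cast h.1)) (mul_le_mul' le_rfl (le_sSup ?_))
      exact ⟨ENNReal.ofReal_pos.2 (by exact_mod_cast h.2.1), ENNReal.ofReal_lt_top, h.2.2⟩
    · rw [indicator_of_notMem h]
      exact zero_le

theorem measurable_lorentzQNorm_top {Y : Type*} [MeasurableSpace Y] [SFinite (volume : Measure X)]
    (p : ℝ≥0∞) {g : Y → X → ℝ≥0∞} (hg : Measurable fun z : Y × X => g z.1 z.2) :
    Measurable fun y => lorentzQNorm p ∞ (g y) := by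
  simp only [lorentzQNorm_top_eq_iSup_rat]
  refine Measurable.iSup fun t => Measurable.iSup fun y => ?_
  have hd : Measurable fun s => distribution (g s) (ENNReal.ofReal y) :=
    measurable_measure_prodMk_left (measurableSet_lt measurable_const hg)
  refine (Measurable.indicator measurable_const ?_).comp hd
  by_cases h : 0 < t ∧ 0 < y
  · simp only [h.1, h.2, true_and]
    exact measurableSet_lt measurable_const measurable_id
  · have : {m : ℝ≥0∞ | 0 < t ∧ 0 < y ∧ ENNReal.ofReal t < m} = ∅ := by
      ext m
      simp only [mem_ofPred_eq, mem_empty_iff_false, iff_false]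
      tauto
    rw [this]
    exact MeasurableSet.empty

end Homogeneity

/-! ### The Duhamel integral and the time potentials that dominate it. -/

section Duhamel

variable {n : ℕ} {K : ℝ → E n → ℝ≥0∞} {C : ℝ≥0}

/-- The Duhamel integral of `a b` with the positive kernel `K`. -/
def duhamel (K : ℝ → E n → ℝ≥0∞) (a b : ℝ → E n → ℝ≥0∞) (t : ℝ) (x : E n) : ℝ≥0∞ :=
  ∫⁻ s in Ioo 0 t, ∫⁻ y, K (t - s) (x - y) * (a s y * b s y)

/-- The integral of `(t - s) ^ (-θ) p q` over `0 < s < t`. -/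
def timePotential (θ : ℝ) (p q : ℝ → ℝ≥0∞) (t : ℝ) : ℝ≥0∞ :=
  ∫⁻ s in Ioo 0 t, ENNReal.ofReal (t - s) ^ (-θ) * (p s * q s)

theorem measurable_duhamel_integrand (hK : Measurable fun z : ℝ × E n => K z.1 z.2)
    {a b : ℝ → E n → ℝ≥0∞} (ha : Measurable fun z : ℝ × E n => a z.1 z.2)
    (hb : Measurable fun z : ℝ × E n => b z.1 z.2) :
    Measurable fun z : ((ℝ × E n) × ℝ) × E n =>
      K (z.1.1.1 - z.1.2) (z.1.1.2 - z.2) * (a z.1.2 z.2 * b z.1.2 z.2) := by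
  have h1 : Measurable fun z : ((ℝ × E n) × ℝ) × E n => (z.1.1.1 - z.1.2, z.1.1.2 - z.2) := by
    fun_prop
  have h2 : Measurable fun z : ((ℝ × E n) × ℝ) × E n => (z.1.2, z.2) := by fun_prop
  exact (hK.comp h1).mul ((ha.comp h2).mul (hb.comp h2))

theorem measurable_duhamel (hK : Measurable fun z : ℝ × E n => K z.1 z.2)
    {a b : ℝ → E n → ℝ≥0∞} (ha : Measurable fun z : ℝ × E n => a z.1 z.2)
    (hb : Measurable fun z : ℝ × E n => b z.1 z.2) :
    Measurable fun z : ℝ × E n => duhamel K a b z.1 z.2 := by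
  have h1 : Measurable fun z : (ℝ × E n) × ℝ =>
      ∫⁻ y, K (z.1.1 - z.2) (z.1.2 - y) * (a z.2 y * b z.2 y) :=
    (measurable_duhamel_integrand hK ha hb).lintegral_prod_right'
  have hS : MeasurableSet {z : (ℝ × E n) × ℝ | z.2 ∈ Ioo 0 z.1.1} :=
    (measurableSet_lt measurable_const measurable_snd).inter
      (measurableSet_lt measurable_snd (measurable_fst.comp measurable_fst))
  have h2 := (h1.indicator hS).lintegral_prod_right' (ν := volume)
  convert! h2 using 1
  funext z
  rw [duhamel, ← lintegral_indicator measurableSet_Ioo]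
  rfl

/-- The fixed-time estimate is an integral over a set S with the bound |S|^(1-1/r), so Tonelli
carries it through the time integral; only then is it converted into a weak quasinorm. -/
theorem OseenBound.exists_lorentzQNorm_duhamel_le (hK : OseenBound K C) {r : ℝ≥0∞} (hr : 2 < r) :
    ∃ C' : ℝ≥0, ∀ a b : ℝ → E n → ℝ≥0∞, Measurable (fun z : ℝ × E n => a z.1 z.2) →
      Measurable (fun z : ℝ × E n => b z.1 z.2) → ∀ t : ℝ,
      lorentzQNorm r ∞ (duhamel K a b t) ≤ C' * timePotential (1 / 2 + n * (r⁻¹).toReal / 2)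
        (fun s => lorentzQNorm r ∞ (a s)) (fun s => lorentzQNorm r ∞ (b s)) t := by
  obtain ⟨C', hC'⟩ := hK.exists_setLIntegral_convolution_le hr
  refine ⟨C', fun a b ha hb t => lorentzQNorm_top_le fun τ hτ => ?_⟩
  have hD := measurable_duhamel hK.meas ha hb
  refine rearrangement_le_of_setLIntegral_le (hD.comp measurable_prodMk_left)
    ENNReal.toReal_nonneg (fun S hS hS0 hSt => ?_) hτ
  have hm : Measurable fun z : E n × ℝ =>
      ∫⁻ y, K (t - z.2) (z.1 - y) * (a z.2 y * b z.2 y) :=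
    (measurable_duhamel_integrand hK.meas ha hb).lintegral_prod_right'.comp
      ((measurable_const.prodMk measurable_fst).prodMk measurable_snd)
  have hfin : C' * volume S ^ (1 - (r⁻¹).toReal) ≠ ∞ :=
    ENNReal.mul_ne_top ENNReal.coe_ne_top (ENNReal.rpow_ne_top_of_ne_zero hS0.ne' hSt.ne)
  calc ∫⁻ x in S, duhamel K a b t x
      = ∫⁻ s in Ioo 0 t, ∫⁻ x in S, ∫⁻ y, K (t - s) (x - y) * (a s y * b s y) := by
        unfold duhamel
        rw [lintegral_lintegral_swap hm.aemeasurable]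
    _ ≤ ∫⁻ s in Ioo 0 t, C' * volume S ^ (1 - (r⁻¹).toReal) *
          (ENNReal.ofReal (t - s) ^ (-(1 / 2 + n * (r⁻¹).toReal / 2)) *
            (lorentzQNorm r ∞ (a s) * lorentzQNorm r ∞ (b s))) :=
        setLIntegral_mono' measurableSet_Ioo fun s hs => hC' (t - s) S (a s) (b s)
          (sub_pos.2 hs.2) hS hS0 hSt (ha.comp measurable_prodMk_left)
          (hb.comp measurable_prodMk_left)
    _ = _ := by
        rw [lintegral_const_mul' _ _ hfin, timePotential]
        ring

/-- The case r = ∞. Essential bounds on a and b suffice for a bound at every x, which is what an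
actual supremum on the left requires. -/
theorem OseenBound.duhamel_le (hK : OseenBound K C) (a b : ℝ → E n → ℝ≥0∞) (t : ℝ) (x : E n) :
    duhamel K a b t x ≤ C * timePotential (1 / 2)
        (fun s => lorentzQNorm ∞ ∞ (a s)) (fun s => lorentzQNorm ∞ ∞ (b s)) t := by
  rw [timePotential, ← lintegral_const_mul' _ _ ENNReal.coe_ne_top]
  refine setLIntegral_mono' measurableSet_Ioo fun s hs => ?_
  rw [← mul_assoc]
  exact hK.convolution_le (sub_pos.2 hs.2) (a s) (b s) x

/-- Since t - s < T and 1 - c - θ ≥ 0, (t-s)^(-θ) = (t-s)^(1-c-θ) (t-s)^(c-1) ≤ T^(1-c-θ)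
(t-s)^(c-1). -/
theorem timePotential_le_fracInt {θ c T t : ℝ} (hθ : θ ≤ 1 - c) (ht : t ∈ Ioo 0 T)
    (p q : ℝ → ℝ≥0∞) :
    timePotential θ p q t ≤ ENNReal.ofReal T ^ (1 - c - θ) *
      fracInt c ((Ioo 0 T).indicator p) ((Ioo 0 T).indicator q) t := by
  have hT : 0 < T := ht.1.trans ht.2
  rw [fracInt, ← lintegral_const_mul' _ _ (ofReal_rpow_ne_top hT _), timePotential,
    ← lintegral_indicator measurableSet_Ioo]
  refine lintegral_mono fun s => ?_
  by_cases hs : s ∈ Ioo 0 t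
  · have hs' : s ∈ Ioo 0 T := ⟨hs.1, hs.2.trans ht.2⟩
    have hts : 0 < t - s := sub_pos.2 hs.2
    rw [indicator_of_mem hs, indicator_of_mem hs', indicator_of_mem hs', fracKernel,
      indicator_of_mem (show t - s ∈ Ioi (0 : ℝ) from hts),
      ← mul_assoc (ENNReal.ofReal T ^ _)]
    refine mul_le_mul' ?_ le_rfl
    rw [show -θ = (1 - c - θ) + (c - 1) by ring, ofReal_rpow_add hts]
    refine mul_le_mul' (ENNReal.rpow_le_rpow (ENNReal.ofReal_le_ofReal ?_) (by linarith)) le_rfl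
    linarith [hs.1, ht.2]
  · rw [indicator_of_notMem hs]
    exact zero_le

theorem exists_lorentzQNorm_timePotential_le {α β : ℝ≥0∞} (hα : 2 < α) (hα' : α < ∞)
    (hβ : 1 ≤ β) {θ : ℝ} (hθ : θ ≤ 1 - (α⁻¹).toReal) :
    ∃ C : ℝ≥0, ∀ (T : ℝ) (p q : ℝ → ℝ≥0∞), 0 < T → Measurable p → Measurable q →
      lorentzQNorm α β ((Ioo 0 T).indicator p) < ∞ →
      lorentzQNorm α β ((Ioo 0 T).indicator q) < ∞ →
      (∀ᵐ t, t ∈ Ioo 0 T → timePotential θ p q t < ∞) ∧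
      lorentzQNorm α β ((Ioo 0 T).indicator (timePotential θ p q)) ≤
        C * ENNReal.ofReal T ^ (1 - (α⁻¹).toReal - θ) *
          lorentzQNorm α β ((Ioo 0 T).indicator p) * lorentzQNorm α β ((Ioo 0 T).indicator q) := by
  obtain ⟨C, hC⟩ := exists_lorentzQNorm_fracInt_le hα hα' hβ
  refine ⟨C, fun T p q hT hp hq hpf hqf => ?_⟩
  set c := (α⁻¹).toReal with hc
  have hα0 : α ≠ 0 := (by positivity : (0 : ℝ≥0∞) < 2).trans hα |>.ne'
  have hβ0 : β ≠ 0 := (one_pos.trans_le hβ).ne'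
  have h1 := hC _ _ (hp.indicator (measurableSet_Ioo (a := 0) (b := T)))
    (hq.indicator (measurableSet_Ioo (a := 0) (b := T)))
  -- Fractional integration asks only for L^{α,∞} of the second factor, and L^{α,β} embeds there.
  have h2 := h1.trans (mul_le_mul' le_rfl (lorentzQNorm_top_le_lorentzQNorm hα0 hα'.ne hβ0 _))
  have hTf : ENNReal.ofReal T ^ (1 - c - θ) ≠ ∞ := ofReal_rpow_ne_top hT _
  constructor
  · have h3 : lorentzQNorm α ∞
        (fracInt c ((Ioo 0 T).indicator p) ((Ioo 0 T).indicator q)) < ∞ :=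
      (lorentzQNorm_top_le_lorentzQNorm hα0 hα'.ne hβ0 _).trans_lt (h2.trans_lt
        (ENNReal.mul_lt_top (ENNReal.mul_lt_top ENNReal.coe_lt_top hpf) hqf))
    filter_upwards [ae_lt_top_of_lorentzQNorm_top_lt_top h3] with t ht htT
    exact (timePotential_le_fracInt hθ htT p q).trans_lt (ENNReal.mul_lt_top hTf.lt_top ht)
  · calc _ ≤ lorentzQNorm α β fun t => (ENNReal.ofReal T ^ (1 - c - θ)).toNNReal *
          fracInt c ((Ioo 0 T).indicator p) ((Ioo 0 T).indicator q) t := by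
          refine lorentzQNorm_mono_ae (Filter.Eventually.of_forall fun t => ?_)
          by_cases ht : t ∈ Ioo 0 T
          · rw [indicator_of_mem ht, ENNReal.coe_toNNReal hTf]
            exact timePotential_le_fracInt hθ ht p q
          · rw [indicator_of_notMem ht]
            exact zero_le
      _ ≤ _ := lorentzQNorm_const_mul_le hβ0 _ _
      _ ≤ _ := mul_le_mul' le_rfl h2
      _ = _ := by rw [ENNReal.coe_toNNReal hTf]; ring

/-- The beta integral with parameters σ + 1 and 1 - θ, both positive. -/
theorem lintegral_beta_lt_top {θ σ : ℝ} (hθ : θ < 1) (hσ : -1 < σ) :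
    ∫⁻ s in Ioo (0 : ℝ) 1, ENNReal.ofReal (1 - s) ^ (-θ) * ENNReal.ofReal s ^ σ < ∞ := by
  have h := Complex.betaIntegral_convergent (u := ((σ + 1 : ℝ) : ℂ)) (v := ((1 - θ : ℝ) : ℂ))
    (by simp only [Complex.ofReal_re]; linarith) (by simp only [Complex.ofReal_re]; linarith)
  rw [intervalIntegrable_iff_integrableOn_Ioo_of_le zero_le_one] at h
  refine lt_of_le_of_lt (le_of_eq ?_) h.2
  refine setLIntegral_congr_fun measurableSet_Ioo fun s hs => ?_
  have hs1 : 0 < 1 - s := sub_pos.2 hs.2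
  rw [enorm_mul, ← ofReal_norm, ← ofReal_norm,
    Complex.norm_cpow_eq_rpow_re_of_pos hs.1, ← Complex.ofReal_one, ← Complex.ofReal_sub,
    ← Complex.ofReal_sub, ← Complex.ofReal_sub, Complex.norm_cpow_eq_rpow_re_of_pos hs1,
    ENNReal.ofReal_rpow_of_pos hs.1, ENNReal.ofReal_rpow_of_pos hs1, Complex.ofReal_re,
    Complex.ofReal_re, mul_comm]
  ring_nf

/-- Almost everywhere p(s) ≤ P s^(σ/2) and q(s) ≤ Q s^(σ/2). The substitution s ↦ ts in ∫₀ᵗ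
(t-s)^(-θ) s^σ ds leaves a beta integral and the power t^(1-θ+σ), for every t. -/
theorem exists_timePotential_le {θ σ : ℝ} (hθ : θ < 1) (hσ : -1 < σ) :
    ∃ C : ℝ≥0, ∀ (T : ℝ) (p q : ℝ → ℝ≥0∞), ∀ t ∈ Ioo 0 T,
      timePotential θ p q t ≤ C * ENNReal.ofReal t ^ (1 - θ + σ) *
        essSup (fun t : ℝ => ENNReal.ofReal (t ^ (-σ / 2)) * p t) (volume.restrict (Ioo 0 T)) *
        essSup (fun t : ℝ => ENNReal.ofReal (t ^ (-σ / 2)) * q t) (volume.restrict (Ioo 0 T)) := by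
  set J := ∫⁻ s in Ioo (0 : ℝ) 1, ENNReal.ofReal (1 - s) ^ (-θ) * ENNReal.ofReal s ^ σ with hJ
  have hJf : J < ∞ := lintegral_beta_lt_top hθ hσ
  refine ⟨J.toNNReal, fun T p q t ht => ?_⟩
  rw [ENNReal.coe_toNNReal hJf.ne]
  have hbd : ∀ p : ℝ → ℝ≥0∞, ∀ᵐ s ∂(volume.restrict (Ioo 0 T)), p s ≤
      essSup (fun t : ℝ => ENNReal.ofReal (t ^ (-σ / 2)) * p t) (volume.restrict (Ioo 0 T)) *
        ENNReal.ofReal s ^ (σ / 2) := by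
    intro p
    filter_upwards [ENNReal.ae_le_essSup (μ := volume.restrict (Ioo 0 T))
      (fun t : ℝ => ENNReal.ofReal (t ^ (-σ / 2)) * p t), ae_restrict_mem measurableSet_Ioo]
      with s hs hs'
    rw [← ENNReal.ofReal_rpow_of_pos hs'.1, ofReal_rpow_mul_le_iff hs'.1] at hs
    convert hs using 3
    ring
  set P := essSup (fun t : ℝ => ENNReal.ofReal (t ^ (-σ / 2)) * p t) (volume.restrict (Ioo 0 T))
  set Q := essSup (fun t : ℝ => ENNReal.ofReal (t ^ (-σ / 2)) * q t) (volume.restrict (Ioo 0 T))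
  have hΦ : Measurable fun s : ℝ => (Ioo 0 t).indicator
      (fun s => ENNReal.ofReal (t - s) ^ (-θ) * ENNReal.ofReal s ^ σ) s :=
    (((measurable_ofReal_rpow (-θ)).comp (measurable_const.sub measurable_id)).mul
      (measurable_ofReal_rpow σ)).indicator measurableSet_Ioo
  have hI : ∫⁻ s in Ioo 0 t, ENNReal.ofReal (t - s) ^ (-θ) * ENNReal.ofReal s ^ σ =
      ENNReal.ofReal t ^ (1 - θ + σ) * J := by
    have e : ∀ (t : ℝ) (f : ℝ → ℝ≥0∞), ∫⁻ s in Ioo 0 t, f s =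
        ∫⁻ s in Ioi (0 : ℝ), (Ioo 0 t).indicator f s := by
      intro t f
      rw [← lintegral_indicator measurableSet_Ioo, ← lintegral_indicator measurableSet_Ioi,
        indicator_indicator, inter_eq_right.2 Ioo_subset_Ioi_self]
    rw [e, lintegral_Ioi_eq_mul_comp_mul_left hΦ ht.1, hJ, e,
      ← lintegral_const_mul' _ _ (ofReal_rpow_ne_top ht.1 _)]
    refine setLIntegral_congr_fun measurableSet_Ioi fun s (hs : 0 < s) => ?_
    by_cases hs1 : s < 1
    · have h1 : t * s ∈ Ioo 0 t := ⟨mul_pos ht.1 hs, by nlinarith [ht.1]⟩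
      rw [indicator_of_mem h1, indicator_of_mem (show s ∈ Ioo (0 : ℝ) 1 from ⟨hs, hs1⟩),
        show t - t * s = t * (1 - s) by ring, ENNReal.ofReal_mul ht.1.le,
        ENNReal.ofReal_mul ht.1.le,
        ENNReal.mul_rpow_of_ne_top ENNReal.ofReal_ne_top ENNReal.ofReal_ne_top,
        ENNReal.mul_rpow_of_ne_top ENNReal.ofReal_ne_top ENNReal.ofReal_ne_top,
        show 1 - θ + σ = 1 + (-θ) + σ by ring, ofReal_rpow_add ht.1, ofReal_rpow_add ht.1,
        ENNReal.rpow_one]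
      ring
    · have h1 : t * s ∉ Ioo 0 t := fun h => hs1 (by nlinarith [h.2, ht.1])
      rw [indicator_of_notMem h1, indicator_of_notMem (fun h => hs1 h.2), mul_zero, mul_zero]
  calc timePotential θ p q t
      ≤ ∫⁻ s in Ioo 0 t, ENNReal.ofReal (t - s) ^ (-θ) * ENNReal.ofReal s ^ σ * (P * Q) := by
        refine lintegral_mono_ae ?_
        have hsub : volume.restrict (Ioo 0 t) ≤ volume.restrict (Ioo 0 T) :=
          Measure.restrict_mono (Ioo_subset_Ioo_right ht.2.le) le_rfl
        filter_upwards [ae_mono hsub (hbd p), ae_mono hsub (hbd q),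
          ae_restrict_mem measurableSet_Ioo] with s h1 h2 hs
        rw [mul_assoc]
        refine mul_le_mul' le_rfl ((mul_le_mul' h1 h2).trans (le_of_eq ?_))
        rw [← add_halves σ, ofReal_rpow_add hs.1, add_halves]
        ring
    _ = _ := by
        rw [lintegral_mul_const, hI]
        · ring
        · exact ((measurable_ofReal_rpow (-θ)).comp (measurable_const.sub measurable_id)).mul
            (measurable_ofReal_rpow σ)

end Duhamel


/-! ### Fourier integrals of homogeneous symbols against Gaussians. -/

section GaussianFourier

variable {n : ℕ}

theorem integrable_rexp_neg_mul_sq_norm {s : ℝ} (hs : 0 < s) :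
    Integrable fun ξ : E n => Real.exp (-(s * ‖ξ‖ ^ 2)) := by
  have h := (GaussianFourier.integrable_cexp_neg_mul_sq_norm_add (V := E n) (b := (s : ℂ))
    (by simpa using hs) 0 0).norm
  refine h.congr (Filter.Eventually.of_forall fun ξ => ?_)
  simp only [Complex.norm_exp]
  congr 1
  simp [← Complex.ofReal_pow]

theorem integrable_pow_mul_rexp {s : ℝ} (hs : 0 < s) (m : ℕ) :
    Integrable fun ξ : E n => ‖ξ‖ ^ m * Real.exp (-(s * ‖ξ‖ ^ 2)) := by
  have h := (integrable_rexp_neg_mul_sq_norm (n := n) (half_pos hs)).const_mul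
    (1 + m.factorial / (s / 2) ^ m)
  refine h.mono' (by fun_prop) (Filter.Eventually.of_forall fun ξ => ?_)
  rw [Real.norm_of_nonneg (by positivity)]
  -- Even powers are powers of ‖ξ‖², which one term of the exponential series bounds by half of the
  -- Gaussian exponent.
  have h1 : ‖ξ‖ ^ m ≤ 1 + ‖ξ‖ ^ (2 * m) := by
    rw [pow_mul']
    nlinarith [sq_nonneg (‖ξ‖ ^ m - 1), sq_nonneg (‖ξ‖ ^ m)]
  have h2 := Real.pow_div_factorial_le_exp (s / 2 * ‖ξ‖ ^ 2) (by positivity) m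
  have h3 : ‖ξ‖ ^ (2 * m) ≤ m.factorial / (s / 2) ^ m * Real.exp (s / 2 * ‖ξ‖ ^ 2) := by
    rw [div_le_iff₀ (by positivity), mul_pow, ← pow_mul] at h2
    rw [div_mul_eq_mul_div, le_div_iff₀ (by positivity)]
    linarith
  have h4 : 1 ≤ Real.exp (s / 2 * ‖ξ‖ ^ 2) := Real.one_le_exp (by positivity)
  calc ‖ξ‖ ^ m * Real.exp (-(s * ‖ξ‖ ^ 2))
      ≤ ((1 + m.factorial / (s / 2) ^ m) * Real.exp (s / 2 * ‖ξ‖ ^ 2)) *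
          Real.exp (-(s * ‖ξ‖ ^ 2)) := by
        gcongr
        linarith
    _ = _ := by
        rw [mul_assoc, ← Real.exp_add]
        congr 2; ring

theorem ofReal_sqrt_rpow {s : ℝ} (hs : 0 < s) (a : ℝ) :
    ENNReal.ofReal (√s) ^ a = ENNReal.ofReal s ^ (a / 2) := by
  rw [Real.sqrt_eq_rpow, ← ENNReal.ofReal_rpow_of_pos hs, ← ENNReal.rpow_mul]
  congr 1; ring

/-- The `m`-th absolute moment of the standard Gaussian weight. -/
def gaussMoment (n m : ℕ) : ℝ≥0∞ :=
  ∫⁻ ξ : E n, ENNReal.ofReal (‖ξ‖ ^ m * Real.exp (-‖ξ‖ ^ 2))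

theorem gaussMoment_lt_top (n m : ℕ) : gaussMoment n m < ∞ := by
  have h := (integrable_pow_mul_rexp (n := n) one_pos m).lintegral_lt_top
  simpa [gaussMoment] using h

theorem lintegral_pow_mul_rexp {s : ℝ} (hs : 0 < s) (m : ℕ) :
    ∫⁻ ξ : E n, ENNReal.ofReal (‖ξ‖ ^ m * Real.exp (-(s * ‖ξ‖ ^ 2))) =
      ENNReal.ofReal s ^ (-((m + n) / 2) : ℝ) * gaussMoment n m := by
  have hr : 0 < √s := Real.sqrt_pos.2 hs
  have h := lintegral_comp_smul_of_pos (volume : Measure (E n))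
    (fun ξ => ENNReal.ofReal (‖ξ‖ ^ m * Real.exp (-‖ξ‖ ^ 2))) hr
  have h2 : ∀ ξ : E n, ENNReal.ofReal (‖√s • ξ‖ ^ m * Real.exp (-‖√s • ξ‖ ^ 2)) =
      ENNReal.ofReal s ^ ((m : ℝ) / 2) *
        ENNReal.ofReal (‖ξ‖ ^ m * Real.exp (-(s * ‖ξ‖ ^ 2))) := by
    intro ξ
    rw [norm_smul, Real.norm_of_nonneg hr.le, mul_pow, mul_pow, Real.sq_sqrt hs.le, mul_assoc,
      ENNReal.ofReal_mul (by positivity), ← ofReal_sqrt_rpow hs, ENNReal.rpow_natCast,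
      ENNReal.ofReal_pow hr.le]
  simp only [h2] at h
  rw [lintegral_const_mul' _ _ (ofReal_rpow_ne_top hs _), ofReal_sqrt_rpow hs,
    finrank_euclideanSpace_fin] at h
  calc _ = ENNReal.ofReal s ^ (-((m : ℝ) / 2)) * (ENNReal.ofReal s ^ ((m : ℝ) / 2) *
        ∫⁻ ξ : E n, ENNReal.ofReal (‖ξ‖ ^ m * Real.exp (-(s * ‖ξ‖ ^ 2)))) := by
        rw [← mul_assoc, mul_comm (ENNReal.ofReal s ^ (-((m : ℝ) / 2))), ofReal_rpow_mul_neg hs,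
          one_mul]
    _ = _ := by
        rw [h, ← mul_assoc, ← ofReal_rpow_add hs, gaussMoment]
        congr 2; ring

/-- The oscillating Gaussian. -/
def osc (s : ℝ) (x ξ : E n) : ℂ :=
  Complex.exp (Complex.I * (inner ℝ x ξ : ℝ) - ((s * ‖ξ‖ ^ 2 : ℝ) : ℂ))

theorem norm_osc (s : ℝ) (x ξ : E n) : ‖osc s x ξ‖ = Real.exp (-(s * ‖ξ‖ ^ 2)) := by
  rw [osc, Complex.norm_exp]
  congr 1
  simp only [Complex.sub_re, Complex.mul_re, Complex.I_re, Complex.I_im, Complex.ofReal_re,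
    Complex.ofReal_im]
  ring

theorem continuous_osc : Continuous fun z : ℝ × E n × E n => osc z.1 z.2.1 z.2.2 := by
  unfold osc
  fun_prop

theorem measurable_osc (s : ℝ) (x : E n) : Measurable (osc s x) :=
  (continuous_osc.comp (Continuous.prodMk continuous_const
    (Continuous.prodMk continuous_const continuous_id))).measurable

/-- The Fourier integral of a symbol against a Gaussian. -/
def gaussFourier (p : E n → ℂ) (s : ℝ) (x : E n) : ℂ := ∫ ξ : E n, osc s x ξ * p ξ

/-- A measurable symbol bounded by a multiple of `‖ξ‖ ^ m`. -/
structure SymbolBound (p : E n → ℂ) (m : ℕ) (D : ℝ) : Prop where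
  meas : Measurable p
  le : ∀ ξ, ‖p ξ‖ ≤ D * ‖ξ‖ ^ m

variable {p : E n → ℂ} {m : ℕ} {D : ℝ}

theorem SymbolBound.norm_osc_mul_le (hp : SymbolBound p m D) (s : ℝ) (x ξ : E n) :
    ‖osc s x ξ * p ξ‖ ≤ D * (‖ξ‖ ^ m * Real.exp (-(s * ‖ξ‖ ^ 2))) := by
  rw [norm_mul, norm_osc]
  calc _ ≤ Real.exp (-(s * ‖ξ‖ ^ 2)) * (D * ‖ξ‖ ^ m) := by
        gcongr
        exact hp.le ξ
    _ = _ := by ring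

theorem SymbolBound.integrable (hp : SymbolBound p m D) {s : ℝ} (hs : 0 < s) (x : E n) :
    Integrable fun ξ => osc s x ξ * p ξ :=
  ((integrable_pow_mul_rexp hs m).const_mul D).mono'
    ((measurable_osc s x).mul hp.meas).aestronglyMeasurable
    (Filter.Eventually.of_forall fun ξ => hp.norm_osc_mul_le s x ξ)

theorem SymbolBound.lintegral_enorm_le (hp : SymbolBound p m D) {s : ℝ} (hs : 0 < s) (x : E n) :
    ∫⁻ ξ, ‖osc s x ξ * p ξ‖ₑ ≤
      ENNReal.ofReal D * gaussMoment n m * ENNReal.ofReal s ^ (-((m + n) / 2) : ℝ) := by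
  calc ∫⁻ ξ, ‖osc s x ξ * p ξ‖ₑ
      ≤ ∫⁻ ξ : E n, ENNReal.ofReal D *
          ENNReal.ofReal (‖ξ‖ ^ m * Real.exp (-(s * ‖ξ‖ ^ 2))) := by
        refine lintegral_mono fun ξ => ?_
        rw [← ENNReal.ofReal_mul' (by positivity), ← ofReal_norm]
        exact ENNReal.ofReal_le_ofReal (hp.norm_osc_mul_le s x ξ)
    _ = _ := by
        rw [lintegral_const_mul' _ _ ENNReal.ofReal_ne_top, lintegral_pow_mul_rexp hs]
        ring

theorem SymbolBound.mul_coord (hp : SymbolBound p m D) (k : Fin n) :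
    SymbolBound (fun ξ => Complex.I * (ξ k : ℂ) * p ξ) (m + 1) D where
  meas := by
    have := hp.meas
    fun_prop
  le ξ := by
    rw [norm_mul, norm_mul, Complex.norm_I, one_mul, Complex.norm_real, pow_succ']
    calc _ ≤ ‖ξ‖ * (D * ‖ξ‖ ^ m) :=
          mul_le_mul (PiLp.norm_apply_le ξ k) (hp.le ξ) (norm_nonneg _) (norm_nonneg _)
      _ = _ := by ring

/-- Differentiation under the integral, dominated by a Gaussian moment of order m + 1 that does not
depend on the point. -/
theorem SymbolBound.hasDerivAt (hp : SymbolBound p m D) {s : ℝ} (hs : 0 < s) (x : E n)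
    (k : Fin n) :
    HasDerivAt (fun h : ℝ => gaussFourier p s (x + h • EuclideanSpace.single k (1 : ℝ)))
      (gaussFourier (fun ξ => Complex.I * (ξ k : ℂ) * p ξ) s x) 0 := by
  have hin : ∀ (h : ℝ) (ξ : E n),
      inner ℝ (x + h • EuclideanSpace.single k (1 : ℝ)) ξ = inner ℝ x ξ + h * ξ k := by
    intro h ξ
    rw [inner_add_left, inner_smul_left, EuclideanSpace.inner_single_left]
    simp
  have key := hasDerivAt_integral_of_dominated_loc_of_deriv_le (μ := (volume : Measure (E n)))
    (F := fun (h : ℝ) ξ => osc s (x + h • EuclideanSpace.single k (1 : ℝ)) ξ * p ξ)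
    (F' := fun (h : ℝ) ξ => osc s (x + h • EuclideanSpace.single k (1 : ℝ)) ξ *
      (Complex.I * (ξ k : ℂ) * p ξ)) (x₀ := 0)
    (bound := fun ξ => D * (‖ξ‖ ^ (m + 1) * Real.exp (-(s * ‖ξ‖ ^ 2)))) Filter.univ_mem
    (Filter.Eventually.of_forall fun h =>
      ((measurable_osc s _).mul hp.meas).aestronglyMeasurable)
    (hp.integrable hs _)
    ((measurable_osc s _).mul (hp.mul_coord k).meas).aestronglyMeasurable
    (Filter.Eventually.of_forall fun ξ h _ => (hp.mul_coord k).norm_osc_mul_le s _ ξ)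
    ((integrable_pow_mul_rexp hs (m + 1)).const_mul D)
    (Filter.Eventually.of_forall fun ξ h _ => ?_)
  · simpa [gaussFourier] using key.2
  · simp only [osc, hin]
    have h1 : HasDerivAt (fun h : ℝ => ((inner ℝ x ξ + h * ξ k : ℝ) : ℂ)) (ξ k : ℂ) h := by
      have : HasDerivAt (fun h : ℝ => inner ℝ x ξ + h * ξ k) (ξ k) h := by
        simpa using ((hasDerivAt_id h).mul_const (ξ k)).const_add (inner ℝ x ξ)
      exact this.ofReal_comp
    have h2 := (((h1.const_mul Complex.I).sub_const ((s * ‖ξ‖ ^ 2 : ℝ) : ℂ)).cexp).mul_const (p ξ)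
    convert! h2 using 1
    ring

theorem SymbolBound.enorm_gaussFourier_le (hp : SymbolBound p m D) {s : ℝ} (hs : 0 < s)
    (x : E n) : ‖gaussFourier p s x‖ₑ ≤
      ENNReal.ofReal D * gaussMoment n m * ENNReal.ofReal s ^ (-((m + n) / 2) : ℝ) :=
  (enorm_integral_le_lintegral_enorm _).trans (hp.lintegral_enorm_le hs x)

theorem measurable_gaussFourier (hp : Measurable p) :
    Measurable fun z : ℝ × E n => gaussFourier p z.1 z.2 := by
  refine StronglyMeasurable.measurable (StronglyMeasurable.integral_prod_right'
    (f := fun z : (ℝ × E n) × E n => osc z.1.1 z.1.2 z.2 * p z.2) ?_)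
  refine Measurable.stronglyMeasurable (Measurable.mul ?_ (hp.comp measurable_snd))
  exact (continuous_osc.comp (Continuous.prodMk (continuous_fst.comp continuous_fst)
    (Continuous.prodMk (continuous_snd.comp continuous_fst) continuous_snd))).measurable

theorem gaussFourier_eq_smul {s : ℝ} (hs : 0 < s)
    (hom : ∀ (R : ℝ) (ξ : E n), 0 < R → p (R • ξ) = (R : ℂ) ^ m * p ξ) (x : E n) :
    gaussFourier p s x = (((√s)⁻¹ ^ (n + m) : ℝ) : ℂ) * gaussFourier p 1 ((√s)⁻¹ • x) := by
  have hr : 0 < (√s)⁻¹ := inv_pos.2 (Real.sqrt_pos.2 hs)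
  have h := Measure.integral_comp_smul_of_nonneg (volume : Measure (E n))
    (fun ξ => osc s x ξ * p ξ) (√s)⁻¹ (hR := hr.le)
  rw [finrank_euclideanSpace_fin] at h
  have h2 : ∀ ξ : E n, osc s x ((√s)⁻¹ • ξ) * p ((√s)⁻¹ • ξ) =
      (((√s)⁻¹ ^ m : ℝ) : ℂ) * (osc 1 ((√s)⁻¹ • x) ξ * p ξ) := by
    intro ξ
    have e1 : s * ‖(√s)⁻¹ • ξ‖ ^ 2 = 1 * ‖ξ‖ ^ 2 := by
      rw [norm_smul, Real.norm_of_nonneg hr.le, mul_pow, inv_pow, Real.sq_sqrt hs.le, ← mul_assoc,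
        mul_inv_cancel₀ hs.ne']
    rw [hom _ _ hr, osc, osc, e1, inner_smul_right, inner_smul_left]
    push_cast
    simp only [conj_trivial, Complex.ofReal_inv]
    ring
  simp only [h2] at h
  rw [integral_const_mul] at h
  rw [gaussFourier, gaussFourier, pow_add, Complex.ofReal_mul, mul_assoc, h, ← Complex.real_smul,
    smul_smul, mul_inv_cancel₀ (by positivity), one_smul]

/-- Homogeneity gives a prefactor s^(-(n+m)/2) and the argument x/√s; the change of variables in x
returns s^(n/2). -/
theorem lintegral_enorm_gaussFourier {s : ℝ} (hs : 0 < s)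
    (hom : ∀ (R : ℝ) (ξ : E n), 0 < R → p (R • ξ) = (R : ℂ) ^ m * p ξ) :
    ∫⁻ x, ‖gaussFourier p s x‖ₑ =
      ENNReal.ofReal s ^ (-(m / 2) : ℝ) * ∫⁻ x, ‖gaussFourier p 1 x‖ₑ := by
  have hr : 0 < √s := Real.sqrt_pos.2 hs
  have hr' : 0 < (√s)⁻¹ := inv_pos.2 hr
  have h := lintegral_comp_smul_of_pos (volume : Measure (E n))
    (fun x => ‖gaussFourier p 1 x‖ₑ) hr'
  rw [finrank_euclideanSpace_fin] at h
  have e : ∀ a : ℝ, ENNReal.ofReal (√s)⁻¹ ^ a = ENNReal.ofReal s ^ (-(a / 2)) := by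
    intro a
    rw [ENNReal.ofReal_inv_of_pos hr, ENNReal.inv_rpow, ofReal_sqrt_rpow hs, ENNReal.rpow_neg]
  calc ∫⁻ x, ‖gaussFourier p s x‖ₑ
      = ∫⁻ x, ENNReal.ofReal (√s)⁻¹ ^ ((n + m : ℕ) : ℝ) * ‖gaussFourier p 1 ((√s)⁻¹ • x)‖ₑ := by
        refine lintegral_congr fun x => ?_
        rw [gaussFourier_eq_smul hs hom x, enorm_mul, ← ofReal_norm (((√s)⁻¹ ^ (n + m) : ℝ) : ℂ),
          Complex.norm_real, Real.norm_of_nonneg (by positivity), ENNReal.ofReal_pow hr'.le,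
          ENNReal.rpow_natCast]
    _ = _ := by
        rw [lintegral_const_mul' _ _ (ofReal_rpow_ne_top hr' _), h, ← mul_assoc, e, e,
          ← ofReal_rpow_add hs]
        congr 2
        push_cast
        ring

/-- A symbol divided by `‖ξ‖ ^ 2` is recovered by integrating in time. -/
theorem SymbolBound.gaussFourier_div_sq (hp : SymbolBound p 3 D) {t : ℝ} (ht : 0 < t) (x : E n) :
    gaussFourier (fun ξ => p ξ / (‖ξ‖ ^ 2 : ℝ)) t x = ∫ s in Ioi t, gaussFourier p s x := by
  have hint : Integrable (Function.uncurry fun (s : ℝ) (ξ : E n) => osc s x ξ * p ξ)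
      ((volume.restrict (Ioi t)).prod volume) := by
    have hm : Measurable (Function.uncurry fun (s : ℝ) (ξ : E n) => osc s x ξ * p ξ) :=
      ((continuous_osc.comp (Continuous.prodMk continuous_fst
        (Continuous.prodMk continuous_const continuous_snd))).measurable).mul
        (hp.meas.comp measurable_snd)
    refine ⟨hm.aestronglyMeasurable, ?_⟩
    rw [HasFiniteIntegral, lintegral_prod _ hm.enorm.aemeasurable]
    calc _ ≤ ∫⁻ s in Ioi t, ENNReal.ofReal D * gaussMoment n 3 *
          ENNReal.ofReal s ^ (-(((3 : ℕ) + n) / 2) : ℝ) :=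
          setLIntegral_mono' measurableSet_Ioi fun s hs => hp.lintegral_enorm_le (ht.trans hs) x
      _ < ∞ := by
          have hfin : ENNReal.ofReal D * gaussMoment n 3 ≠ ∞ :=
            ENNReal.mul_ne_top ENNReal.ofReal_ne_top (gaussMoment_lt_top n 3).ne
          have hn : (0 : ℝ) ≤ n := Nat.cast_nonneg n
          rw [lintegral_const_mul' _ _ hfin, lintegral_Ioi_rpow (by push_cast; linarith) ht]
          refine ENNReal.mul_lt_top hfin.lt_top (ENNReal.div_lt_top (ofReal_rpow_ne_top ht _) ?_)
          exact ofReal_ne_zero_of_pos (by push_cast; linarith)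
  unfold gaussFourier
  rw [integral_integral_swap hint]
  refine integral_congr_ae (Filter.Eventually.of_forall fun ξ => ?_)
  simp only
  -- At the origin the quotient is 0 by the convention for division, and p vanishes there by its
  -- bound, so both sides are 0.
  by_cases hξ : ξ = 0
  · have : p 0 = 0 := by simpa using hp.le 0
    simp [hξ, this]
  have ha : 0 < ‖ξ‖ ^ 2 := by positivity
  have h1 : ∀ s : ℝ, osc s x ξ =
      Complex.exp (Complex.I * (inner ℝ x ξ : ℝ)) * Complex.exp (-((‖ξ‖ ^ 2 : ℝ) : ℂ) * s) := by
    intro s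
    rw [osc, ← Complex.exp_add]
    congr 1
    push_cast
    ring
  have h2 : ((‖ξ‖ ^ 2 : ℝ) : ℂ) ≠ 0 := by exact_mod_cast ha.ne'
  simp only [h1]
  rw [integral_mul_const, integral_const_mul, integral_exp_mul_complex_Ioi
    (by rw [Complex.neg_re, Complex.ofReal_re]; linarith)]
  field_simp

/-- Under the integral over times s > t the L¹ norm scales like s^(-3/2), and ∫_t^∞ s^(-3/2) ds =
2t^(-1/2). -/
theorem SymbolBound.lintegral_enorm_gaussFourier_div_sq_le (hp : SymbolBound p 3 D)
    (hom : ∀ (R : ℝ) (ξ : E n), 0 < R → p (R • ξ) = (R : ℂ) ^ 3 * p ξ) {t : ℝ} (ht : 0 < t) :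
    ∫⁻ x, ‖gaussFourier (fun ξ => p ξ / (‖ξ‖ ^ 2 : ℝ)) t x‖ₑ ≤
      2 * (∫⁻ x, ‖gaussFourier p 1 x‖ₑ) * ENNReal.ofReal t ^ (-(1 / 2) : ℝ) := by
  have hm : Measurable fun z : E n × ℝ => ‖gaussFourier p z.2 z.1‖ₑ :=
    ((measurable_gaussFourier hp.meas).comp (measurable_snd.prodMk measurable_fst)).enorm
  calc _ ≤ ∫⁻ x : E n, ∫⁻ s in Ioi t, ‖gaussFourier p s x‖ₑ := by
        refine lintegral_mono fun x => ?_
        rw [hp.gaussFourier_div_sq ht]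
        exact enorm_integral_le_lintegral_enorm _
    _ = ∫⁻ s in Ioi t, ∫⁻ x : E n, ‖gaussFourier p s x‖ₑ :=
        lintegral_lintegral_swap hm.aemeasurable
    _ = ∫⁻ s in Ioi t, ENNReal.ofReal s ^ (-((3 : ℕ) / 2) : ℝ) *
          ∫⁻ x, ‖gaussFourier p 1 x‖ₑ :=
        setLIntegral_congr_fun measurableSet_Ioi fun s hs =>
          lintegral_enorm_gaussFourier (m := 3) (ht.trans hs) hom
    _ = _ := by
        rw [lintegral_mul_const _ (measurable_ofReal_rpow _),
          lintegral_Ioi_rpow (by norm_num) ht,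
          show -(-(((3 : ℕ) : ℝ) / 2) + 1) = 2⁻¹ by norm_num, ENNReal.ofReal_inv_of_pos two_pos,
          div_eq_mul_inv, inv_inv, ENNReal.ofReal_ofNat,
          show -(((3 : ℕ) : ℝ) / 2) + 1 = -(1 / 2) by norm_num]
        ring

end GaussianFourier


/-! ### Explicit derivatives of the heat kernel at time one. -/

section GaussianDerivatives

variable {n : ℕ}

theorem coord_add_smul_single (x : E n) (h : ℝ) (k i : Fin n) :
    (x + h • EuclideanSpace.single k (1 : ℝ)) i = x i + h * (if i = k then 1 else 0) := by
  simp

theorem hasDerivAt_coord_line (x : E n) (k i : Fin n) :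
    HasDerivAt (fun h : ℝ => (((x + h • EuclideanSpace.single k (1 : ℝ)) i : ℝ) : ℂ))
      (if i = k then 1 else 0) 0 := by
  simp only [coord_add_smul_single]
  have : HasDerivAt (fun h : ℝ => x i + h * (if i = k then 1 else 0)) (if i = k then 1 else 0) 0 := by
    simpa using ((hasDerivAt_id (0 : ℝ)).mul_const (if i = k then (1 : ℝ) else 0)).const_add (x i)
  convert! this.ofReal_comp using 1
  split_ifs <;> simp

theorem symbolBound_one : SymbolBound (fun _ : E n => (1 : ℂ)) 0 1 where
  meas := measurable_const
  le ξ := by simp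

theorem gaussFourier_one (x : E n) :
    gaussFourier (fun _ => 1) 1 x = (Real.pi : ℂ) ^ ((n : ℂ) / 2) * osc (1 / 4) 0 x := by
  have h := GaussianFourier.integral_cexp_neg_mul_sq_norm_add (V := E n) (b := 1) (by simp)
    Complex.I x
  rw [finrank_euclideanSpace_fin] at h
  calc _ = ∫ v : E n, Complex.exp (-1 * (‖v‖ : ℂ) ^ 2 + Complex.I * (inner ℝ x v : ℝ)) := by
        refine integral_congr_ae (Filter.Eventually.of_forall fun v => ?_)
        simp only [osc, mul_one]
        congr 1
        push_cast
        ring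
    _ = _ := by
        rw [h, osc]
        congr 2
        · simp
        · simp
          ring

theorem hasDerivAt_osc_line (x : E n) (k : Fin n) :
    HasDerivAt (fun h : ℝ => osc (1 / 4) 0 (x + h • EuclideanSpace.single k (1 : ℝ)))
      (-(x k : ℂ) / 2 * osc (1 / 4) 0 x) 0 := by
  have hn : ∀ h : ℝ, ‖x + h • EuclideanSpace.single k (1 : ℝ)‖ ^ 2 =
      ‖x‖ ^ 2 + 2 * h * x k + h ^ 2 := by
    intro h
    rw [norm_add_sq_real, inner_smul_right, EuclideanSpace.inner_single_right, norm_smul, mul_pow]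
    simp
    ring
  simp only [osc, inner_zero_left, hn]
  have h1 : HasDerivAt (fun h : ℝ => 1 / 4 * (‖x‖ ^ 2 + 2 * h * x k + h ^ 2)) (x k / 2) 0 := by
    have a := ((((hasDerivAt_id (0 : ℝ)).const_mul 2).mul_const (x k)).const_add (‖x‖ ^ 2)).add
      ((hasDerivAt_id (0 : ℝ)).pow 2)
    convert! a.const_mul (1 / 4) using 1
    simp
    ring
  have h2 := (h1.ofReal_comp.const_sub (Complex.I * ((0 : ℝ) : ℂ))).cexp
  convert! h2 using 1
  simp
  ring

/-- The directional derivative of the Gaussian is computed twice, under the Fourier integral and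
from the closed form; uniqueness of derivatives equates the two. The second and third orders repeat
this. -/
theorem gaussFourier_coord (i : Fin n) (x : E n) :
    gaussFourier (fun ξ => Complex.I * (ξ i : ℂ) * 1) 1 x =
      (Real.pi : ℂ) ^ ((n : ℂ) / 2) * (-(x i : ℂ) / 2 * osc (1 / 4) 0 x) := by
  have h := symbolBound_one.hasDerivAt one_pos x i
  simp only [gaussFourier_one] at h
  exact h.unique ((hasDerivAt_osc_line x i).const_mul _)

theorem gaussFourier_coord_coord (j i : Fin n) (x : E n) :
    gaussFourier (fun ξ => Complex.I * (ξ j : ℂ) * (Complex.I * (ξ i : ℂ) * 1)) 1 x =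
      (Real.pi : ℂ) ^ ((n : ℂ) / 2) *
        ((-(if i = j then 1 else 0) / 2 + (x i : ℂ) * x j / 4) * osc (1 / 4) 0 x) := by
  have h := (symbolBound_one.mul_coord i).hasDerivAt one_pos x j
  simp only [gaussFourier_coord] at h
  have h2 := (((hasDerivAt_coord_line x j i).neg.div_const 2).mul
    (hasDerivAt_osc_line x j)).const_mul ((Real.pi : ℂ) ^ ((n : ℂ) / 2))
  rw [h.unique h2]
  simp only [zero_smul, add_zero, Pi.neg_apply]
  ring

theorem gaussFourier_coord_coord_coord (k j i : Fin n) (x : E n) :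
    gaussFourier (fun ξ => Complex.I * (ξ k : ℂ) *
        (Complex.I * (ξ j : ℂ) * (Complex.I * (ξ i : ℂ) * 1))) 1 x =
      (Real.pi : ℂ) ^ ((n : ℂ) / 2) *
        (((((if i = k then 1 else 0) * (x j : ℂ) + (if j = k then 1 else 0) * (x i : ℂ) +
          (if i = j then 1 else 0) * (x k : ℂ)) / 4) * osc (1 / 4) 0 x) -
          (x i : ℂ) * x j * x k / 8 * osc (1 / 4) 0 x) := by
  have h := ((symbolBound_one.mul_coord i).mul_coord j).hasDerivAt one_pos x k
  simp only [gaussFourier_coord_coord] at h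
  have h2 := (((((hasDerivAt_coord_line x k i).mul (hasDerivAt_coord_line x k j)).div_const
    4).const_add (-(if i = j then 1 else 0) / 2 : ℂ)).mul
    (hasDerivAt_osc_line x k)).const_mul ((Real.pi : ℂ) ^ ((n : ℂ) / 2))
  rw [h.unique h2]
  simp only [zero_smul, add_zero, Pi.mul_apply]
  ring

theorem integrable_coord_mul_osc (i : Fin n) :
    Integrable fun x : E n => (x i : ℂ) * osc (1 / 4) 0 x := by
  -- At frequency shift 0 the oscillating Gaussian is exp(-|x|²/4), so integrability in ξ is reused
  -- for functions of x.
  have h := (symbolBound_one.mul_coord i).integrable (s := 1 / 4) (by norm_num) 0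
  refine (h.const_mul (-Complex.I)).congr (Filter.Eventually.of_forall fun x => ?_)
  simp only
  linear_combination -(osc (1 / 4) 0 x * (x i : ℂ)) * Complex.I_mul_I

theorem integrable_coord_mul_coord_mul_coord_mul_osc (i j k : Fin n) :
    Integrable fun x : E n => (x i : ℂ) * x j * x k / 8 * osc (1 / 4) 0 x := by
  have h := (((symbolBound_one.mul_coord i).mul_coord j).mul_coord k).integrable
    (s := 1 / 4) (by norm_num) 0
  refine (h.const_mul (Complex.I / 8)).congr (Filter.Eventually.of_forall fun x => ?_)
  simp only
  have h4 : Complex.I ^ 4 = 1 := Complex.I_pow_four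
  linear_combination (osc (1 / 4) 0 x * (x i : ℂ) * x j * x k / 8) * h4

theorem lintegral_enorm_gaussFourier_coord_lt_top (i : Fin n) :
    ∫⁻ x, ‖gaussFourier (fun ξ : E n => Complex.I * (ξ i : ℂ) * 1) 1 x‖ₑ < ∞ := by
  have h : Integrable (gaussFourier (fun ξ : E n => Complex.I * (ξ i : ℂ) * 1) 1) := by
    refine ((integrable_coord_mul_osc i).const_mul
      ((Real.pi : ℂ) ^ ((n : ℂ) / 2) * (-1 / 2))).congr (Filter.Eventually.of_forall fun x => ?_)
    simp only
    rw [gaussFourier_coord]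
    ring
  exact h.2

theorem lintegral_enorm_gaussFourier_coord_coord_coord_lt_top (k j i : Fin n) :
    ∫⁻ x, ‖gaussFourier (fun ξ : E n => Complex.I * (ξ k : ℂ) *
        (Complex.I * (ξ j : ℂ) * (Complex.I * (ξ i : ℂ) * 1))) 1 x‖ₑ < ∞ := by
  have h : Integrable (gaussFourier (fun ξ : E n => Complex.I * (ξ k : ℂ) *
        (Complex.I * (ξ j : ℂ) * (Complex.I * (ξ i : ℂ) * 1))) 1) := by
    have h1 := (((integrable_coord_mul_osc j).const_mul ((if i = k then 1 else 0 : ℂ) / 4)).add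
      ((integrable_coord_mul_osc i).const_mul ((if j = k then 1 else 0 : ℂ) / 4))).add
      ((integrable_coord_mul_osc k).const_mul ((if i = j then 1 else 0 : ℂ) / 4))
    refine ((h1.sub (integrable_coord_mul_coord_mul_coord_mul_osc i j k)).const_mul
      ((Real.pi : ℂ) ^ ((n : ℂ) / 2))).congr (Filter.Eventually.of_forall fun x => ?_)
    simp only [Pi.add_apply, Pi.sub_apply]
    rw [gaussFourier_coord_coord_coord]
    ring
  exact h.2

end GaussianDerivatives

/-! ### Bounds for the gradient of the Oseen kernel. -/

section OseenKernel

variable {n : ℕ}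

/-- The symbol of the Leray projection. -/
def leraySymbol (i j : Fin n) (ξ : E n) : ℂ :=
  (((if i = j then 1 else 0) - ξ i * ξ j / ‖ξ‖ ^ 2 : ℝ) : ℂ)

theorem symbolBound_leraySymbol (i j : Fin n) : SymbolBound (leraySymbol i j) 0 2 where
  meas := by
    unfold leraySymbol
    fun_prop
  le ξ := by
    rw [leraySymbol, Complex.norm_real, pow_zero, mul_one, Real.norm_eq_abs]
    have h1 : |(if i = j then 1 else 0 : ℝ)| ≤ 1 := by split_ifs <;> simp
    have h2 : |ξ i * ξ j / ‖ξ‖ ^ 2| ≤ 1 := by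
      rw [abs_div, abs_mul, abs_of_nonneg (sq_nonneg ‖ξ‖), sq]
      refine div_le_one_of_le₀ ?_ (by positivity)
      exact mul_le_mul (PiLp.norm_apply_le ξ i) (PiLp.norm_apply_le ξ j) (abs_nonneg _)
        (norm_nonneg _)
    linarith [abs_sub (if i = j then 1 else 0 : ℝ) (ξ i * ξ j / ‖ξ‖ ^ 2)]

/-- The derivative of the Oseen kernel in the direction `k`, for positive times. -/
def oseenGradient (k i j : Fin n) (t : ℝ) (x : E n) : ℂ :=
  ((2 * Real.pi) ^ n : ℝ)⁻¹ * gaussFourier (fun ξ => Complex.I * (ξ k : ℂ) * leraySymbol i j ξ) t x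

theorem measurable_oseenGradient (k i j : Fin n) :
    Measurable fun z : ℝ × E n => oseenGradient k i j z.1 z.2 :=
  measurable_const.mul (measurable_gaussFourier ((symbolBound_leraySymbol i j).mul_coord k).meas)

theorem gradOseen_eq (k i j : Fin n) {t : ℝ} (ht : 0 < t) (x : E n) :
    gradOseen k i j t x = (oseenGradient k i j t x).re := by
  have h := ((symbolBound_leraySymbol i j).hasDerivAt ht x k).const_mul
    ((((2 * Real.pi) ^ n : ℝ)⁻¹ : ℝ) : ℂ)
  have h2 := (Complex.reCLM.hasFDerivAt.comp_hasDerivAt 0 h).deriv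
  rw [gradOseen, lineDeriv]
  exact h2

theorem homogeneous_coord (i : Fin n) (R : ℝ) (ξ : E n) :
    Complex.I * ((R • ξ) i : ℂ) * 1 = (R : ℂ) ^ 1 * (Complex.I * (ξ i : ℂ) * 1) := by
  simp
  ring

theorem homogeneous_coord_coord_coord (k j i : Fin n) (R : ℝ) (ξ : E n) :
    Complex.I * ((R • ξ) k : ℂ) * (Complex.I * ((R • ξ) j : ℂ) * (Complex.I * ((R • ξ) i : ℂ) * 1)) =
      (R : ℂ) ^ 3 * (Complex.I * (ξ k : ℂ) *
        (Complex.I * (ξ j : ℂ) * (Complex.I * (ξ i : ℂ) * 1))) := by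
  simp
  ring

/-- The minus sign of the Leray symbol is absorbed by i² = -1, so both terms are derivatives of heat
kernels, the second after division by |ξ|². -/
theorem gaussFourier_leraySymbol (k i j : Fin n) {t : ℝ} (ht : 0 < t) (x : E n) :
    gaussFourier (fun ξ => Complex.I * (ξ k : ℂ) * leraySymbol i j ξ) t x =
      (if i = j then 1 else 0) * gaussFourier (fun ξ => Complex.I * (ξ k : ℂ) * 1) t x +
      gaussFourier (fun ξ => Complex.I * (ξ k : ℂ) *
        (Complex.I * (ξ j : ℂ) * (Complex.I * (ξ i : ℂ) * 1)) / (‖ξ‖ ^ 2 : ℝ)) t x := by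
  have h1 := (symbolBound_one.mul_coord k).integrable ht x
  have h3 := ((symbolBound_leraySymbol i j).mul_coord k).integrable ht x
  have e : ∀ ξ : E n, osc t x ξ * (Complex.I * (ξ k : ℂ) *
        (Complex.I * (ξ j : ℂ) * (Complex.I * (ξ i : ℂ) * 1)) / (‖ξ‖ ^ 2 : ℝ)) =
      osc t x ξ * (Complex.I * (ξ k : ℂ) * leraySymbol i j ξ) -
        (if i = j then 1 else 0) * (osc t x ξ * (Complex.I * (ξ k : ℂ) * 1)) := by
    intro ξ
    have hl : leraySymbol i j ξ = (if i = j then 1 else 0) - ξ i * ξ j / (‖ξ‖ ^ 2 : ℝ) := by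
      rw [leraySymbol]
      split_ifs <;> push_cast <;> ring
    rw [hl]
    linear_combination (osc t x ξ * Complex.I * ξ k * ξ j * ξ i / (‖ξ‖ ^ 2 : ℝ)) * Complex.I_mul_I
  unfold gaussFourier
  rw [integral_congr_ae (Filter.Eventually.of_forall e), integral_sub h3 (h1.const_mul _),
    integral_const_mul]
  ring

theorem exists_lintegral_enorm_gaussFourier_leraySymbol_le (k i j : Fin n) :
    ∃ C : ℝ≥0∞, C < ∞ ∧ ∀ t : ℝ, 0 < t →
      ∫⁻ x, ‖gaussFourier (fun ξ : E n => Complex.I * (ξ k : ℂ) * leraySymbol i j ξ) t x‖ₑ ≤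
        C * ENNReal.ofReal t ^ (-(1 / 2) : ℝ) := by
  refine ⟨_, ENNReal.add_lt_top.2 ⟨lintegral_enorm_gaussFourier_coord_lt_top k,
    ENNReal.mul_lt_top (ENNReal.ofNat_lt_top (n := 2))
      (lintegral_enorm_gaussFourier_coord_coord_coord_lt_top k j i)⟩, fun t ht => ?_⟩
  have h3 := ((symbolBound_one.mul_coord i).mul_coord j).mul_coord k
  have hm : Measurable fun x : E n => ‖gaussFourier (fun ξ => Complex.I * (ξ k : ℂ) * 1) t x‖ₑ :=
    ((measurable_gaussFourier (symbolBound_one.mul_coord k).meas).comp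
      measurable_prodMk_left).enorm
  have h1 := lintegral_enorm_gaussFourier (m := 1)
    (p := fun ξ : E n => Complex.I * (ξ k : ℂ) * 1) ht (fun R ξ _ => homogeneous_coord k R ξ)
  calc _ ≤ ∫⁻ x, (‖gaussFourier (fun ξ => Complex.I * (ξ k : ℂ) * 1) t x‖ₑ +
        ‖gaussFourier (fun ξ => Complex.I * (ξ k : ℂ) *
          (Complex.I * (ξ j : ℂ) * (Complex.I * (ξ i : ℂ) * 1)) / (‖ξ‖ ^ 2 : ℝ)) t x‖ₑ) := by
        refine lintegral_mono fun x => ?_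
        rw [gaussFourier_leraySymbol k i j ht]
        refine (enorm_add_le _ _).trans (add_le_add ?_ le_rfl)
        split_ifs <;> simp
    _ ≤ _ := by
        rw [lintegral_add_left hm, h1, add_mul]
        refine add_le_add (le_of_eq ?_) (h3.lintegral_enorm_gaussFourier_div_sq_le
          (fun R ξ _ => homogeneous_coord_coord_coord k j i R ξ) ht)
        rw [mul_comm]
        norm_num

/-- The total size of the gradient of the Oseen kernel. -/
def oseenMajorant (n : ℕ) (t : ℝ) (x : E n) : ℝ≥0∞ :=
  ∑ k, ∑ i, ∑ j, ‖oseenGradient k i j t x‖ₑ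

/-- The L¹ bound comes from the heat kernel decomposition; the supremum is bounded by the first
Gaussian moment, as the symbol is O(|ξ|). -/
theorem exists_oseenBound_oseenGradient (k i j : Fin n) :
    ∃ C : ℝ≥0, OseenBound (fun t x => ‖oseenGradient k i j t x‖ₑ) C := by
  obtain ⟨C, hC, h⟩ := exists_lintegral_enorm_gaussFourier_leraySymbol_le k i j
  set c : ℝ≥0∞ := ‖(((2 * Real.pi) ^ n : ℝ)⁻¹ : ℂ)‖ₑ with hc
  set M : ℝ≥0∞ := ENNReal.ofReal 2 * gaussMoment n 1 with hM
  have hMt : M < ∞ := ENNReal.mul_lt_top ENNReal.ofReal_lt_top (gaussMoment_lt_top n 1)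
  have hfin : c * (C + M) ≠ ∞ :=
    ENNReal.mul_ne_top enorm_ne_top (ENNReal.add_lt_top.2 ⟨hC, hMt⟩).ne
  refine ⟨(c * (C + M)).toNNReal, (measurable_oseenGradient k i j).enorm, fun τ hτ => ?_,
    fun τ hτ x => ?_⟩
  · rw [ENNReal.coe_toNNReal hfin]
    simp only [oseenGradient, enorm_mul]
    rw [lintegral_const_mul' _ _ enorm_ne_top, mul_assoc]
    refine mul_le_mul' (le_of_eq ?_) ((h τ hτ).trans (mul_le_mul' le_self_add le_rfl))
    simp [hc]
  · rw [ENNReal.coe_toNNReal hfin]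
    simp only [oseenGradient, enorm_mul]
    rw [mul_assoc]
    have h1 := ((symbolBound_leraySymbol i j).mul_coord k).enorm_gaussFourier_le hτ x
    refine mul_le_mul' (le_of_eq ?_) ((h1.trans (le_of_eq ?_)).trans
      (mul_le_mul' (le_add_self (a := M) (b := C)) le_rfl))
    · simp [hc]
    · rw [hM]
      congr 2
      push_cast
      ring

theorem OseenBound.zero : OseenBound (fun (_ : ℝ) (_ : E n) => 0) 0 where
  meas := measurable_const
  lintegral_le τ _ := by simp
  le τ _ x := by simp

theorem OseenBound.add {K L : ℝ → E n → ℝ≥0∞} {C D : ℝ≥0} (hK : OseenBound K C)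
    (hL : OseenBound L D) : OseenBound (fun t x => K t x + L t x) (C + D) where
  meas := hK.meas.add hL.meas
  lintegral_le τ hτ := by
    have hm : Measurable (K τ) := hK.meas.comp measurable_prodMk_left
    rw [lintegral_add_left hm, ENNReal.coe_add, add_mul]
    exact add_le_add (hK.lintegral_le τ hτ) (hL.lintegral_le τ hτ)
  le τ hτ x := by
    rw [ENNReal.coe_add, add_mul]
    exact add_le_add (hK.le τ hτ x) (hL.le τ hτ x)

theorem exists_oseenBound_sum {ι : Type*} (s : Finset ι) {K : ι → ℝ → E n → ℝ≥0∞}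
    (h : ∀ i, ∃ C : ℝ≥0, OseenBound (K i) C) :
    ∃ C : ℝ≥0, OseenBound (fun t x => ∑ i ∈ s, K i t x) C := by
  classical
  induction s using Finset.induction_on with
  | empty => exact ⟨0, by simpa using OseenBound.zero⟩
  | insert a s ha ih =>
    obtain ⟨C, hC⟩ := ih
    obtain ⟨D, hD⟩ := h a
    exact ⟨D + C, by simpa [Finset.sum_insert ha] using hD.add hC⟩

theorem exists_oseenBound_oseenMajorant (n : ℕ) :
    ∃ C : ℝ≥0, OseenBound (oseenMajorant n) C :=
  exists_oseenBound_sum _ fun k => exists_oseenBound_sum _ fun i => exists_oseenBound_sum _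
    fun j => exists_oseenBound_oseenGradient k i j

/-- In dimension one ξ²/|ξ|² = 1 off the origin, so the Leray symbol vanishes there, and the factor
ξ_k handles the origin. This covers n = 1 with 1 < r ≤ 2, which the convolution estimate does not
reach. -/
theorem oseenMajorant_one (t : ℝ) (x : E 1) : oseenMajorant 1 t x = 0 := by
  have h : ∀ k i j : Fin 1, oseenGradient k i j t x = 0 := by
    intro k i j
    have hz : ∀ ξ : E 1, osc t x ξ * (Complex.I * (ξ k : ℂ) * leraySymbol i j ξ) = 0 := by
      intro ξ
      by_cases hξ : ξ = 0
      · simp [hξ]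
      · have hl : leraySymbol i j ξ = 0 := by
          rw [leraySymbol, Subsingleton.elim j i, if_pos rfl, EuclideanSpace.norm_sq_eq,
            Fin.sum_univ_one, Subsingleton.elim i 0, Real.norm_eq_abs, sq_abs, ← sq, div_self,
            sub_self, Complex.ofReal_zero]
          intro h0
          refine hξ (PiLp.ext fun l => ?_)
          rw [Subsingleton.elim l 0]
          simpa using h0
        simp [hl]
    simp [oseenGradient, gaussFourier, hz]
  simp [oseenMajorant, h]

end OseenKernel


/-! ### The bilinear operator: domination, measurability, restriction to the strip. -/

section Bilinear

variable {n : ℕ}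

/-- The Duhamel integral of `|u| |v|` against the gradient of the Oseen kernel. -/
def bilinearMajorant (u v : ℝ → E n → E n) : ℝ → E n → ℝ≥0∞ :=
  duhamel (oseenMajorant n) (fun s y => ‖u s y‖ₑ) (fun s y => ‖v s y‖ₑ)

theorem measurable_oseenMajorant : Measurable fun z : ℝ × E n => oseenMajorant n z.1 z.2 :=
  Finset.measurable_fun_sum _ fun k _ => Finset.measurable_fun_sum _ fun i _ =>
    Finset.measurable_fun_sum _ fun j _ => (measurable_oseenGradient k i j).enorm

theorem measurable_bilinearMajorant {u v : ℝ → E n → E n}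
    (hu : Measurable fun z : ℝ × E n => u z.1 z.2)
    (hv : Measurable fun z : ℝ × E n => v z.1 z.2) :
    Measurable fun z : ℝ × E n => bilinearMajorant u v z.1 z.2 :=
  measurable_duhamel measurable_oseenMajorant hu.enorm hv.enorm

theorem enorm_coord_le (x : E n) (i : Fin n) : ‖x i‖ₑ ≤ ‖x‖ₑ := by
  rw [← ofReal_norm, ← ofReal_norm]
  exact ENNReal.ofReal_le_ofReal (PiLp.norm_apply_le x i)

theorem enorm_le_sum_enorm_coord (x : E n) : ‖x‖ₑ ≤ ∑ i, ‖x i‖ₑ := by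
  simp only [← ofReal_norm]
  rw [← ENNReal.ofReal_sum_of_nonneg fun i _ => norm_nonneg _]
  refine ENNReal.ofReal_le_ofReal ?_
  rw [EuclideanSpace.norm_eq]
  exact Real.sqrt_le_iff.2 ⟨Finset.sum_nonneg fun i _ => norm_nonneg _,
    Finset.sum_sq_le_sq_sum_of_nonneg fun i _ => norm_nonneg _⟩

theorem enorm_gradOseen_le (k i j : Fin n) {t : ℝ} (ht : 0 < t) (x : E n) :
    ‖gradOseen k i j t x‖ₑ ≤ ‖oseenGradient k i j t x‖ₑ := by
  rw [gradOseen_eq k i j ht, ← ofReal_norm, ← ofReal_norm]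
  exact ENNReal.ofReal_le_ofReal (Complex.abs_re_le_norm _)

theorem enorm_oseenGradient_le (k i j : Fin n) (t : ℝ) (x : E n) :
    ‖oseenGradient k i j t x‖ₑ ≤ oseenMajorant n t x :=
  calc ‖oseenGradient k i j t x‖ₑ ≤ ∑ j, ‖oseenGradient k i j t x‖ₑ :=
        Finset.single_le_sum (f := fun j => ‖oseenGradient k i j t x‖ₑ)
          (fun _ _ => zero_le) (Finset.mem_univ j)
    _ ≤ ∑ i, ∑ j, ‖oseenGradient k i j t x‖ₑ :=
        Finset.single_le_sum (f := fun i => ∑ j, ‖oseenGradient k i j t x‖ₑ)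
          (fun _ _ => zero_le) (Finset.mem_univ i)
    _ ≤ oseenMajorant n t x :=
        Finset.single_le_sum (f := fun k => ∑ i, ∑ j, ‖oseenGradient k i j t x‖ₑ)
          (fun _ _ => zero_le) (Finset.mem_univ k)

/-- Tonelli turns the finite iterated majorant into integrability on the product. `oseenGradient` is
known to be jointly measurable, and its real part is `gradOseen` for the positive times t - s that
occur. -/
theorem bDefined_of_bilinearMajorant_lt_top {u v : ℝ → E n → E n}
    (hu : Measurable fun z : ℝ × E n => u z.1 z.2)
    (hv : Measurable fun z : ℝ × E n => v z.1 z.2) {t : ℝ} {x : E n}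
    (h : bilinearMajorant u v t x < ∞) : BDefined u v t x := by
  intro i j k
  have hS : MeasurableSet (Ioo (0 : ℝ) t ×ˢ (univ : Set (E n))) :=
    measurableSet_Ioo.prod MeasurableSet.univ
  have hsub : Measurable fun z : ℝ × E n => (t - z.1, x - z.2) := by fun_prop
  have hm : Measurable fun z : ℝ × E n => (oseenGradient k i j (t - z.1) (x - z.2)).re *
      (u z.1 z.2 j * v z.1 z.2 k) := by
    have h1 := (Complex.measurable_re.comp (measurable_oseenGradient k i j)).comp hsub
    exact h1.mul (Measurable.mul (by fun_prop) (by fun_prop))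
  have hI : IntegrableOn (fun z : ℝ × E n => (oseenGradient k i j (t - z.1) (x - z.2)).re *
      (u z.1 z.2 j * v z.1 z.2 k)) (Ioo (0 : ℝ) t ×ˢ univ) := by
    refine ⟨hm.aestronglyMeasurable, ?_⟩
    rw [HasFiniteIntegral, Measure.volume_eq_prod, ← Measure.prod_restrict, Measure.restrict_univ,
      lintegral_prod _ hm.enorm.aemeasurable]
    refine lt_of_le_of_lt ?_ h
    refine lintegral_mono fun s => lintegral_mono fun y => ?_
    simp only
    rw [enorm_mul, enorm_mul]
    refine mul_le_mul' (le_trans ?_ (enorm_oseenGradient_le k i j _ _))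
      (mul_le_mul' (enorm_coord_le _ _) (enorm_coord_le _ _))
    rw [← ofReal_norm, ← ofReal_norm]
    exact ENNReal.ofReal_le_ofReal (Complex.abs_re_le_norm _)
  refine hI.congr_fun (fun z hz => ?_) hS
  simp only
  rw [gradOseen_eq k i j (sub_pos.2 hz.1.2)]
  rfl

/-- The part of the majorant that controls the `i`-th component. -/
def componentMajorant (i : Fin n) (t : ℝ) (x : E n) : ℝ≥0∞ :=
  ∑ j, ∑ k, ‖oseenGradient k i j t x‖ₑ

theorem measurable_componentMajorant (i : Fin n) :
    Measurable fun z : ℝ × E n => componentMajorant i z.1 z.2 :=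
  Finset.measurable_fun_sum _ fun j _ => Finset.measurable_fun_sum _ fun k _ =>
    (measurable_oseenGradient k i j).enorm

theorem sum_componentMajorant (t : ℝ) (x : E n) :
    ∑ i, componentMajorant i t x = oseenMajorant n t x := by
  unfold componentMajorant oseenMajorant
  rw [Finset.sum_comm_cycle]

/-- No integrability is assumed: where a Bochner integral diverges it is 0 by convention, and the
bound still holds. -/
theorem enorm_B_coord_le (u v : ℝ → E n → E n) (t : ℝ) (x : E n) (i : Fin n) :
    ‖B u v t x i‖ₑ ≤ duhamel (componentMajorant i) (fun s y => ‖u s y‖ₑ) (fun s y => ‖v s y‖ₑ) t x := by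
  refine (enorm_integral_le_lintegral_enorm _).trans ?_
  refine setLIntegral_mono' measurableSet_Ioo fun s hs => ?_
  refine (enorm_integral_le_lintegral_enorm _).trans (lintegral_mono fun y => ?_)
  rw [componentMajorant, Finset.sum_mul]
  refine (enorm_sum_le _ _).trans (Finset.sum_le_sum fun j _ => ?_)
  rw [Finset.sum_mul]
  refine (enorm_sum_le _ _).trans (Finset.sum_le_sum fun k _ => ?_)
  rw [enorm_mul]
  refine mul_le_mul' (enorm_gradOseen_le k i j (sub_pos.2 hs.2) _) ?_
  simp only [tensor, Matrix.of_apply]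
  rw [enorm_mul]
  exact mul_le_mul' (enorm_coord_le _ _) (enorm_coord_le _ _)

theorem sum_duhamel {ι : Type*} (S : Finset ι) {K : ι → ℝ → E n → ℝ≥0∞}
    (hK : ∀ i, Measurable fun z : ℝ × E n => K i z.1 z.2)
    {a b : ℝ → E n → ℝ≥0∞} (ha : Measurable fun z : ℝ × E n => a z.1 z.2)
    (hb : Measurable fun z : ℝ × E n => b z.1 z.2) (t : ℝ) (x : E n) :
    ∑ i ∈ S, duhamel (K i) a b t x = duhamel (fun t x => ∑ i ∈ S, K i t x) a b t x := by
  have hG : ∀ i, Measurable fun z : ℝ × E n =>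
      K i (t - z.1) (x - z.2) * (a z.1 z.2 * b z.1 z.2) := by
    intro i
    have hsub : Measurable fun z : ℝ × E n => (t - z.1, x - z.2) := by fun_prop
    exact ((hK i).comp hsub).mul (ha.mul hb)
  have h1 : ∀ i, Measurable fun s => ∫⁻ y, K i (t - s) (x - y) * (a s y * b s y) :=
    fun i => (hG i).lintegral_prod_right'
  have h2 : ∀ s i, Measurable fun y => K i (t - s) (x - y) * (a s y * b s y) :=
    fun s i => (hG i).comp measurable_prodMk_left
  unfold duhamel
  rw [← lintegral_finsetSum S fun i _ => h1 i]
  refine lintegral_congr fun s => ?_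
  rw [← lintegral_finsetSum S fun i _ => h2 s i]
  exact lintegral_congr fun y => (Finset.sum_mul _ _ _).symm

theorem enorm_B_le {u v : ℝ → E n → E n}
    (hu : Measurable fun z : ℝ × E n => u z.1 z.2)
    (hv : Measurable fun z : ℝ × E n => v z.1 z.2) (t : ℝ) (x : E n) :
    ‖B u v t x‖ₑ ≤ bilinearMajorant u v t x := by
  refine (enorm_le_sum_enorm_coord _).trans
    ((Finset.sum_le_sum fun i _ => enorm_B_coord_le u v t x i).trans (le_of_eq ?_))
  rw [sum_duhamel _ (fun i => measurable_componentMajorant i) hu.enorm hv.enorm]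
  simp only [sum_componentMajorant]
  rfl

theorem measurable_B {u v : ℝ → E n → E n}
    (hu : Measurable fun z : ℝ × E n => u z.1 z.2)
    (hv : Measurable fun z : ℝ × E n => v z.1 z.2) :
    Measurable fun z : ℝ × E n => B u v z.1 z.2 := by
  refine (WithLp.measurable_toLp 2 _).comp (measurable_pi_lambda _ fun i => ?_)
  -- The integrand with `gradOseen` replaced by its jointly measurable form; the two agree on 0 < s
  -- < t, and an indicator removes the other s.
  set f : ((ℝ × E n) × ℝ) × E n → ℝ := fun z =>
    ∑ j, ∑ k, (oseenGradient k i j (z.1.1.1 - z.1.2) (z.1.1.2 - z.2)).re *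
      (u z.1.2 z.2 j * v z.1.2 z.2 k) with hf
  have hfm : Measurable f := by
    have h1 : Measurable fun z : ((ℝ × E n) × ℝ) × E n => (z.1.1.1 - z.1.2, z.1.1.2 - z.2) := by
      fun_prop
    have h2 : Measurable fun z : ((ℝ × E n) × ℝ) × E n => (z.1.2, z.2) := by fun_prop
    refine Finset.measurable_fun_sum _ fun j _ => Finset.measurable_fun_sum _ fun k _ => ?_
    have hu' := hu.comp h2
    have hv' := hv.comp h2
    simp only [Function.comp_def] at hu' hv'
    exact ((Complex.measurable_re.comp (measurable_oseenGradient k i j)).comp h1).mul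
      (Measurable.mul (by fun_prop) (by fun_prop))
  have hS : MeasurableSet {z : (ℝ × E n) × ℝ | z.2 ∈ Ioo 0 z.1.1} :=
    (measurableSet_lt measurable_const measurable_snd).inter
      (measurableSet_lt measurable_snd (measurable_fst.comp measurable_fst))
  have h1 : StronglyMeasurable fun w : (ℝ × E n) × ℝ => ∫ y, f (w, y) :=
    hfm.stronglyMeasurable.integral_prod_right'
  have h2 := (h1.indicator hS).integral_prod_right' (ν := volume)
  convert! h2.measurable using 1
  funext z
  rw [← integral_indicator measurableSet_Ioo]
  refine integral_congr_ae (Filter.Eventually.of_forall fun s => ?_)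
  simp only
  by_cases hs : s ∈ Ioo 0 z.1
  · rw [indicator_of_mem hs, indicator_of_mem (show (z, s) ∈ {z : (ℝ × E n) × ℝ |
      z.2 ∈ Ioo 0 z.1.1} from hs)]
    refine integral_congr_ae (Filter.Eventually.of_forall fun y => ?_)
    simp only [hf, tensor, Matrix.of_apply, gradOseen_eq _ i _ (sub_pos.2 hs.2)]
  · rw [indicator_of_notMem hs, indicator_of_notMem (show (z, s) ∉ {z : (ℝ × E n) × ℝ |
      z.2 ∈ Ioo 0 z.1.1} from hs)]

theorem B_congr {u v u' v' : ℝ → E n → E n} {t : ℝ} (hu : ∀ s ∈ Ioo 0 t, u s = u' s)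
    (hv : ∀ s ∈ Ioo 0 t, v s = v' s) : B u v t = B u' v' t := by
  funext x
  refine PiLp.ext fun i => ?_
  refine setIntegral_congr_fun measurableSet_Ioo fun s hs => ?_
  simp only [tensor, Matrix.of_apply, hu s hs, hv s hs]

theorem BDefined.congr {u v u' v' : ℝ → E n → E n} {t : ℝ} {x : E n}
    (h : BDefined u v t x) (hu : ∀ s ∈ Ioo 0 t, u s = u' s)
    (hv : ∀ s ∈ Ioo 0 t, v s = v' s) : BDefined u' v' t x := by
  intro i j k
  refine (h i j k).congr_fun (fun z hz => ?_) (measurableSet_Ioo.prod MeasurableSet.univ)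
  simp only [tensor, Matrix.of_apply, hu z.1 hz.1, hv z.1 hz.1]

/-- Allows Tonelli on all of ℝ × ℝⁿ. The values outside the strip do not matter, because B at time t
< T sees only times in (0, t). -/
theorem exists_measurable_extension {T : ℝ} {u : ℝ → E n → E n} (hu : MeasurableOnStrip T u) :
    ∃ u' : ℝ → E n → E n, Measurable (fun z : ℝ × E n => u' z.1 z.2) ∧
      ∀ s ∈ Ioo 0 T, u s = u' s := by
  have he : MeasurableEmbedding fun z : Ioo (0 : ℝ) T × E n => ((z.1 : ℝ), z.2) :=
    (MeasurableEmbedding.subtype_coe measurableSet_Ioo).prodMap MeasurableEmbedding.id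
  obtain ⟨g, hg, hgu⟩ := he.exists_measurable_extend hu fun _ => ⟨0⟩
  refine ⟨fun s x => g (s, x), by simpa using hg, fun s hs => funext fun x => ?_⟩
  exact (congrFun hgu (⟨s, hs⟩, x)).symm

theorem measurableOnStrip_B {T : ℝ} {u v : ℝ → E n → E n} (hu : MeasurableOnStrip T u)
    (hv : MeasurableOnStrip T v) : MeasurableOnStrip T (B u v) := by
  obtain ⟨u', hu', huu⟩ := exists_measurable_extension hu
  obtain ⟨v', hv', hvv⟩ := exists_measurable_extension hv
  have h : ∀ z : Ioo (0 : ℝ) T × E n, B u v z.1 z.2 = B u' v' z.1 z.2 := fun z => by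
    rw [B_congr (fun s hs => huu s ⟨hs.1, hs.2.trans z.1.2.2⟩)
      (fun s hs => hvv s ⟨hs.1, hs.2.trans z.1.2.2⟩)]
  have hm : Measurable fun z : Ioo (0 : ℝ) T × E n => ((z.1 : ℝ), z.2) := by fun_prop
  unfold MeasurableOnStrip
  simp only [h]
  exact (measurable_B hu' hv').comp hm

theorem natCast_mul_toReal_inv_lt_one {r : ℝ≥0∞} (hr : (n : ℝ≥0∞) < r) : n * (r⁻¹).toReal < 1 := by
  by_cases hr' : r = ∞
  · simp [hr']
  have h1 : (n : ℝ) < r.toReal := by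
    simpa using (ENNReal.toReal_lt_toReal (by simp) hr').2 hr
  have h2 : 0 < r.toReal := (Nat.cast_nonneg n).trans_lt h1
  rw [ENNReal.toReal_inv, ← div_eq_mul_inv, div_lt_one h2]
  exact h1

/-- The bilinear operator is controlled by a fractional integral of the norms in space. -/
theorem exists_spaceQNorm_B_le (hn : 1 ≤ n) {r : ℝ≥0∞} (hr : (n : ℝ≥0∞) < r) :
    ∃ C : ℝ≥0, ∀ u v : ℝ → E n → E n, Measurable (fun z : ℝ × E n => u z.1 z.2) →
      Measurable (fun z : ℝ × E n => v z.1 z.2) → ∀ (t : ℝ) (H : ℝ≥0∞),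
      timePotential (1 / 2 + n * (r⁻¹).toReal / 2) (fun s => spaceQNorm (.std r) ∞ (u s))
        (fun s => spaceQNorm (.std r) ∞ (v s)) t = H →
      (H < ∞ → (∀ᵐ x, bilinearMajorant u v t x < ∞) ∧
        (r = ∞ → ∀ x, bilinearMajorant u v t x < ∞)) ∧
      spaceQNorm (overline r) ∞ (B u v t) ≤ C * H := by
  obtain ⟨C₀, hK⟩ := exists_oseenBound_oseenMajorant n
  have hweak : ∃ C' : ℝ≥0, ∀ a b : ℝ → E n → ℝ≥0∞, Measurable (fun z : ℝ × E n => a z.1 z.2) →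
      Measurable (fun z : ℝ × E n => b z.1 z.2) → ∀ t : ℝ,
      lorentzQNorm r ∞ (duhamel (oseenMajorant n) a b t) ≤
        C' * timePotential (1 / 2 + n * (r⁻¹).toReal / 2)
          (fun s => lorentzQNorm r ∞ (a s)) (fun s => lorentzQNorm r ∞ (b s)) t := by
    -- Only n = 1 leaves room for r ≤ 2, and there the kernel is zero.
    rcases hn.eq_or_lt with h1 | h2
    · subst h1
      refine ⟨0, fun a b _ _ t => lorentzQNorm_top_le fun τ _ => ?_⟩
      refine (rearrangement_le_of_forall_le (M := 0) (fun x => ?_) τ).trans zero_le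
      simp [duhamel, oseenMajorant_one]
    · exact hK.exists_lorentzQNorm_duhamel_le (lt_of_le_of_lt (by exact_mod_cast h2) hr)
  obtain ⟨C', hC'⟩ := hweak
  have htop : r = ∞ → ∀ (u v : ℝ → E n → E n) (t : ℝ) (x : E n), bilinearMajorant u v t x ≤
      C₀ * timePotential (1 / 2 + n * (r⁻¹).toReal / 2) (fun s => spaceQNorm (.std r) ∞ (u s))
        (fun s => spaceQNorm (.std r) ∞ (v s)) t := by
    intro h u v t x
    subst h
    simpa [bilinearMajorant, spaceQNorm] using
      hK.duhamel_le (fun s y => ‖u s y‖ₑ) (fun s y => ‖v s y‖ₑ) t x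
  -- `C'` serves the weak quasinorm for finite r, and `C₀` the pointwise supremum for r = ∞.
  refine ⟨C' + C₀, fun u v hu hv t H hH => ⟨fun hfin => ⟨?_, fun h x => ?_⟩, ?_⟩⟩
  · refine ae_lt_top_of_lorentzQNorm_top_lt_top (p := r) ((hC' _ _ hu.enorm hv.enorm t).trans_lt ?_)
    refine ENNReal.mul_lt_top ENNReal.coe_lt_top ?_
    rw [← hH] at hfin
    exact hfin
  · refine (htop h u v t x).trans_lt (ENNReal.mul_lt_top ENNReal.coe_lt_top ?_)
    rwa [hH]
  · by_cases h : r = ∞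
    · rw [overline, if_pos h]
      refine iSup_le fun x => (enorm_B_le hu hv t x).trans ((htop h u v t x).trans ?_)
      rw [hH, ENNReal.coe_add]
      exact mul_le_mul' le_add_self le_rfl
    · rw [overline, if_neg h]
      refine (lorentzQNorm_mono_ae (Filter.Eventually.of_forall fun x =>
        enorm_B_le hu hv t x)).trans ((hC' _ _ hu.enorm hv.enorm t).trans ?_)
      rw [ENNReal.coe_add, ← hH]
      exact mul_le_mul' le_self_add le_rfl

theorem normL_congr {p : SpaceExponent} {q α β : ℝ≥0∞} {T : ℝ} {u v : ℝ → E n → E n}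
    (h : ∀ s ∈ Ioo 0 T, u s = v s) : normL p q α β T u = normL p q α β T v := by
  unfold normL
  congr 1
  exact indicator_congr fun s hs => by rw [h s hs]

theorem normK_congr {p : SpaceExponent} {q : ℝ≥0∞} {σ T : ℝ} {u v : ℝ → E n → E n}
    (h : ∀ s ∈ Ioo 0 T, u s = v s) : normK p q σ T u = normK p q σ T v := by
  refine essSup_congr_ae ?_
  filter_upwards [ae_restrict_mem measurableSet_Ioo] with s hs
  rw [h s hs]

end Bilinear

/-! ### The two parts of the lemma. -/

theorem exists_normL_B_le {n : ℕ} {r α β : ℝ≥0∞} (hn : 1 ≤ n) (hr : (n : ℝ≥0∞) < r)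
    (hα : 2 < α) (hα' : α < ∞) (hβ : 1 ≤ β) (hαr : 2 / α + n / r ≤ 1) :
    ∃ C : ℝ≥0, ∀ (T : ℝ) (u v : ℝ → E n → E n), 0 < T →
      MemL (.std r) ∞ α β T u → MemL (.std r) ∞ α β T v →
      (∀ᵐ z : ℝ × E n ∂(volume.restrict (Ioo (0 : ℝ) T ×ˢ univ)), BDefined u v z.1 z.2) ∧
      (r = ∞ → ∀ᵐ t : ℝ ∂(volume.restrict (Ioo (0 : ℝ) T)), ∀ x : E n, BDefined u v t x) ∧
      MemL (overline r) ∞ α β T (B u v) ∧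
      normL (overline r) ∞ α β T (B u v) ≤
        C * ENNReal.ofReal
            (T ^ ((1 / 2 : ℝ) * (1 - (2 / α).toReal - ((n : ℝ≥0∞) / r).toReal))) *
          normL (.std r) ∞ α β T u * normL (.std r) ∞ α β T v := by
  obtain ⟨C₁, hC₁⟩ := exists_spaceQNorm_B_le hn hr
  have hβ0 : β ≠ 0 := (one_pos.trans_le hβ).ne'
  have e1 : (2 / α).toReal = 2 * (α⁻¹).toReal := by
    rw [div_eq_mul_inv, ENNReal.toReal_mul, ENNReal.toReal_ofNat]
  have e2 : ((n : ℝ≥0∞) / r).toReal = n * (r⁻¹).toReal := by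
    rw [div_eq_mul_inv, ENNReal.toReal_mul, ENNReal.toReal_natCast]
  have hsum : 2 * (α⁻¹).toReal + n * (r⁻¹).toReal ≤ 1 := by
    have h1 : 2 / α ≠ ∞ := ne_top_of_le_ne_top ENNReal.one_ne_top (le_self_add.trans hαr)
    have h2 : (n : ℝ≥0∞) / r ≠ ∞ := ne_top_of_le_ne_top ENNReal.one_ne_top (le_add_self.trans hαr)
    rw [← e1, ← e2, ← ENNReal.toReal_add h1 h2]
    exact ENNReal.toReal_le_of_le_ofReal zero_le_one (by simpa using hαr)
  -- The condition 2/α + n/r ≤ 1 is θ ≤ 1 - 1/α for θ = 1/2 + n/(2r), and the power of T is 1 - 1/α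
  -- - θ.
  obtain ⟨C₂, hC₂⟩ := exists_lorentzQNorm_timePotential_le hα hα' hβ
    (θ := 1 / 2 + n * (r⁻¹).toReal / 2) (by linarith)
  refine ⟨C₁ * C₂, fun T u v hT hu hv => ?_⟩
  obtain ⟨u', hum, huu⟩ := exists_measurable_extension hu.1
  obtain ⟨v', hvm, hvv⟩ := exists_measurable_extension hv.1
  have hBcongr : ∀ t ∈ Ioo 0 T, B u v t = B u' v' t := fun t ht =>
    B_congr (fun s hs => huu s ⟨hs.1, hs.2.trans ht.2⟩) (fun s hs => hvv s ⟨hs.1, hs.2.trans ht.2⟩)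
  have hdef : ∀ t ∈ Ioo 0 T, ∀ x, bilinearMajorant u' v' t x < ∞ → BDefined u v t x :=
    fun t ht x hx => (bDefined_of_bilinearMajorant_lt_top hum hvm hx).congr
      (fun s hs => (huu s ⟨hs.1, hs.2.trans ht.2⟩).symm)
      (fun s hs => (hvv s ⟨hs.1, hs.2.trans ht.2⟩).symm)
  have hpm : Measurable fun s => spaceQNorm (.std r) ∞ (u' s) :=
    measurable_lorentzQNorm_top r hum.enorm
  have hqm : Measurable fun s => spaceQNorm (.std r) ∞ (v' s) :=
    measurable_lorentzQNorm_top r hvm.enorm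
  have huf := hu.2
  have hvf := hv.2
  rw [normL_congr huu] at huf ⊢
  rw [normL_congr hvv] at hvf ⊢
  obtain ⟨hae, hle⟩ := hC₂ T _ _ hT hpm hqm huf hvf
  have hbound : normL (overline r) ∞ α β T (B u v) ≤
      (C₁ * C₂ : ℝ≥0) * ENNReal.ofReal
            (T ^ ((1 / 2 : ℝ) * (1 - (2 / α).toReal - ((n : ℝ≥0∞) / r).toReal))) *
          normL (.std r) ∞ α β T u' * normL (.std r) ∞ α β T v' := by
    rw [normL_congr hBcongr]
    calc normL (overline r) ∞ α β T (B u' v')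
        ≤ lorentzQNorm α β fun t => C₁ * (Ioo (0 : ℝ) T).indicator
            (timePotential (1 / 2 + n * (r⁻¹).toReal / 2)
              (fun s => spaceQNorm (.std r) ∞ (u' s)) (fun s => spaceQNorm (.std r) ∞ (v' s))) t := by
          refine lorentzQNorm_mono_ae (Filter.Eventually.of_forall fun t => ?_)
          by_cases ht : t ∈ Ioo 0 T
          · simp only [indicator_of_mem ht]
            exact (hC₁ u' v' hum hvm t _ rfl).2
          · rw [indicator_of_notMem ht]
            exact zero_le
      _ ≤ _ := lorentzQNorm_const_mul_le hβ0 _ _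
      _ ≤ _ := mul_le_mul' le_rfl hle
      _ = _ := by
          rw [ENNReal.ofReal_rpow_of_pos hT, e1, e2, ENNReal.coe_mul, normL, normL,
            show 1 - (α⁻¹).toReal - (1 / 2 + n * (r⁻¹).toReal / 2) =
              1 / 2 * (1 - 2 * (α⁻¹).toReal - n * (r⁻¹).toReal) by ring]
          ring
  refine ⟨?_, fun hrt => ?_, ⟨measurableOnStrip_B hu.1 hv.1, ?_⟩, hbound⟩
  · have hms : MeasurableSet {z : ℝ × E n | bilinearMajorant u' v' z.1 z.2 < ∞} :=
      measurableSet_lt (measurable_bilinearMajorant hum hvm) measurable_const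
    have h : ∀ᵐ z : ℝ × E n ∂(volume.restrict (Ioo (0 : ℝ) T ×ˢ univ)),
        bilinearMajorant u' v' z.1 z.2 < ∞ := by
      -- Since the majorant is jointly measurable, finiteness for almost every t and then almost
      -- every x is finiteness almost everywhere on the strip.
      rw [Measure.volume_eq_prod, ← Measure.prod_restrict, Measure.restrict_univ,
        Measure.ae_prod_iff_ae_ae hms, ae_restrict_iff' measurableSet_Ioo]
      filter_upwards [hae] with t ht htT
      exact ((hC₁ u' v' hum hvm t _ rfl).1 (ht htT)).1
    filter_upwards [h, ae_restrict_mem (measurableSet_Ioo.prod MeasurableSet.univ)] with z hz hzT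
    exact hdef z.1 hzT.1 z.2 hz
  · rw [ae_restrict_iff' measurableSet_Ioo]
    filter_upwards [hae] with t ht htT x
    exact hdef t htT x (((hC₁ u' v' hum hvm t _ rfl).1 (ht htT)).2 hrt x)
  · exact hbound.trans_lt (ENNReal.mul_lt_top (ENNReal.mul_lt_top
      (ENNReal.mul_lt_top ENNReal.coe_lt_top ENNReal.ofReal_lt_top) huf) hvf)

theorem exists_normJ_B_le {n : ℕ} {r : ℝ≥0∞} {σ : ℝ} (hn : 1 ≤ n) (hr : (n : ℝ≥0∞) < r)
    (hσ : -1 < σ) (hσr : -σ + ((n : ℝ≥0∞) / r).toReal ≤ 1) :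
    ∃ C : ℝ≥0, ∀ (T : ℝ) (u v : ℝ → E n → E n), 0 < T →
      MemK (.std r) ∞ σ T u → MemK (.std r) ∞ σ T v →
      (∀ t ∈ Ioo (0 : ℝ) T, ∀ᵐ x : E n, BDefined u v t x) ∧
      (r = ∞ → ∀ t ∈ Ioo (0 : ℝ) T, ∀ x : E n, BDefined u v t x) ∧
      MemJ (overline r) ∞ σ T (B u v) ∧
      normJ (overline r) ∞ σ T (B u v) ≤
        C * ENNReal.ofReal (T ^ ((1 / 2 : ℝ) * (1 + σ - ((n : ℝ≥0∞) / r).toReal))) *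
          normK (.std r) ∞ σ T u * normK (.std r) ∞ σ T v := by
  obtain ⟨C₁, hC₁⟩ := exists_spaceQNorm_B_le hn hr
  have e2 : ((n : ℝ≥0∞) / r).toReal = n * (r⁻¹).toReal := by
    rw [div_eq_mul_inv, ENNReal.toReal_mul, ENNReal.toReal_natCast]
  have hν := natCast_mul_toReal_inv_lt_one hr
  -- Here θ < 1 is exactly n/r < 1.
  obtain ⟨C₂, hC₂⟩ := exists_timePotential_le (θ := 1 / 2 + n * (r⁻¹).toReal / 2)
    (by linarith) hσ
  refine ⟨C₁ * C₂, fun T u v hT hu hv => ?_⟩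
  obtain ⟨u', hum, huu⟩ := exists_measurable_extension hu.1
  obtain ⟨v', hvm, hvv⟩ := exists_measurable_extension hv.1
  have hdef : ∀ t ∈ Ioo 0 T, ∀ x, bilinearMajorant u' v' t x < ∞ → BDefined u v t x :=
    fun t ht x hx => (bDefined_of_bilinearMajorant_lt_top hum hvm hx).congr
      (fun s hs => (huu s ⟨hs.1, hs.2.trans ht.2⟩).symm)
      (fun s hs => (hvv s ⟨hs.1, hs.2.trans ht.2⟩).symm)
  have huf := hu.2
  have hvf := hv.2
  rw [normK_congr huu] at huf ⊢
  rw [normK_congr hvv] at hvf ⊢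
  have hpot := fun t ht => hC₂ T (fun s => spaceQNorm (.std r) ∞ (u' s))
    (fun s => spaceQNorm (.std r) ∞ (v' s)) t ht
  have hfin : ∀ t ∈ Ioo 0 T, timePotential (1 / 2 + n * (r⁻¹).toReal / 2)
      (fun s => spaceQNorm (.std r) ∞ (u' s)) (fun s => spaceQNorm (.std r) ∞ (v' s)) t < ∞ :=
    fun t ht => (hpot t ht).trans_lt (ENNReal.mul_lt_top (ENNReal.mul_lt_top
      (ENNReal.mul_lt_top ENNReal.coe_lt_top (ofReal_rpow_ne_top ht.1 _).lt_top) huf) hvf)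
  have hbound : normJ (overline r) ∞ σ T (B u v) ≤
      (C₁ * C₂ : ℝ≥0) *
        ENNReal.ofReal (T ^ ((1 / 2 : ℝ) * (1 + σ - ((n : ℝ≥0∞) / r).toReal))) *
          normK (.std r) ∞ σ T u' * normK (.std r) ∞ σ T v' := by
    refine iSup₂_le fun t ht => ?_
    rw [B_congr (fun s hs => huu s ⟨hs.1, hs.2.trans ht.2⟩)
      (fun s hs => hvv s ⟨hs.1, hs.2.trans ht.2⟩), ← ENNReal.ofReal_rpow_of_pos ht.1,
      ← ENNReal.ofReal_rpow_of_pos hT, e2, ENNReal.coe_mul]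
    rw [e2] at hσr
    set P := normK (.std r) ∞ σ T u' with hP
    set Q := normK (.std r) ∞ σ T v' with hQ
    calc _ ≤ ENNReal.ofReal t ^ (-σ / 2) * (C₁ * (C₂ * ENNReal.ofReal t ^
          (1 - (1 / 2 + n * (r⁻¹).toReal / 2) + σ) * P * Q)) :=
          mul_le_mul' le_rfl (((hC₁ u' v' hum hvm t _ rfl).2).trans
            (mul_le_mul' le_rfl (hpot t ht)))
      _ = C₁ * C₂ * ENNReal.ofReal t ^ (1 / 2 * (1 + σ - n * (r⁻¹).toReal)) * P * Q := by
          rw [show 1 / 2 * (1 + σ - n * (r⁻¹).toReal) =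
            -σ / 2 + (1 - (1 / 2 + n * (r⁻¹).toReal / 2) + σ) by ring,
            ofReal_rpow_add ht.1 (-σ / 2)]
          ring
      -- The exponent (1 + σ - n/r)/2 is nonnegative by hypothesis, so t may be replaced by T.
      _ ≤ _ := by
          gcongr
          · linarith
          · exact ht.2.le
  refine ⟨fun t ht => ?_, fun hrt t ht x => ?_, ⟨measurableOnStrip_B hu.1 hv.1, ?_⟩, hbound⟩
  · filter_upwards [((hC₁ u' v' hum hvm t _ rfl).1 (hfin t ht)).1] with x hx
    exact hdef t ht x hx
  · exact hdef t ht x (((hC₁ u' v' hum hvm t _ rfl).1 (hfin t ht)).2 hrt x)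
  · exact hbound.trans_lt (ENNReal.mul_lt_top (ENNReal.mul_lt_top
      (ENNReal.mul_lt_top ENNReal.coe_lt_top ENNReal.ofReal_lt_top) huf) hvf)

end NSLorentz

end

theorem lemma2p1 :
    -- part (i)
    (∀ (n : ℕ) (r α β : ℝ≥0∞), 1 ≤ n → (n : ℝ≥0∞) < r → 2 < α → α < ∞ → 1 ≤ β →
      2 / α + n / r ≤ 1 →
      ∃ C : ℝ≥0, ∀ (T : ℝ) (u v : ℝ → NSLorentz.E n → NSLorentz.E n), 0 < T →
        NSLorentz.MemL (.std r) ∞ α β T u → NSLorentz.MemL (.std r) ∞ α β T v →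
        (∀ᵐ z : ℝ × NSLorentz.E n ∂(volume.restrict (Ioo (0 : ℝ) T ×ˢ univ)),
          NSLorentz.BDefined u v z.1 z.2) ∧
        (r = ∞ → ∀ᵐ t : ℝ ∂(volume.restrict (Ioo (0 : ℝ) T)),
          ∀ x : NSLorentz.E n, NSLorentz.BDefined u v t x) ∧
        NSLorentz.MemL (NSLorentz.overline r) ∞ α β T (NSLorentz.B u v) ∧
        NSLorentz.normL (NSLorentz.overline r) ∞ α β T (NSLorentz.B u v) ≤
          C * ENNReal.ofReal
              (T ^ ((1 / 2 : ℝ) * (1 - (2 / α).toReal - ((n : ℝ≥0∞) / r).toReal))) *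
            NSLorentz.normL (.std r) ∞ α β T u * NSLorentz.normL (.std r) ∞ α β T v) ∧
    -- part (ii)
    (∀ (n : ℕ) (r : ℝ≥0∞) (σ : ℝ), 1 ≤ n → (n : ℝ≥0∞) < r → -1 < σ →
      -σ + ((n : ℝ≥0∞) / r).toReal ≤ 1 →
      ∃ C : ℝ≥0, ∀ (T : ℝ) (u v : ℝ → NSLorentz.E n → NSLorentz.E n), 0 < T →
        NSLorentz.MemK (.std r) ∞ σ T u → NSLorentz.MemK (.std r) ∞ σ T v →
        (∀ t ∈ Ioo (0 : ℝ) T, ∀ᵐ x : NSLorentz.E n, NSLorentz.BDefined u v t x) ∧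
        (r = ∞ → ∀ t ∈ Ioo (0 : ℝ) T, ∀ x : NSLorentz.E n, NSLorentz.BDefined u v t x) ∧
        NSLorentz.MemJ (NSLorentz.overline r) ∞ σ T (NSLorentz.B u v) ∧
        NSLorentz.normJ (NSLorentz.overline r) ∞ σ T (NSLorentz.B u v) ≤
          C * ENNReal.ofReal
              (T ^ ((1 / 2 : ℝ) * (1 + σ - ((n : ℝ≥0∞) / r).toReal))) *
            NSLorentz.normK (.std r) ∞ σ T u * NSLorentz.normK (.std r) ∞ σ T v) := by
  exact ⟨fun n r α β hn hr hα hα' hβ h => NSLorentz.exists_normL_B_le hn hr hα hα' hβ h,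
    fun n r σ hn hr hσ h => NSLorentz.exists_normJ_B_le hn hr hσ h⟩
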